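/- **Setting.** Let $L\cong\mathbb Z^r$ be a lattice, $\|\cdot\|$ a norm on $L\otimes\mathbb R$, and $\mu\colon L\to\mathbb C$ an additive homomorphism with the support property: there is $R>0$ with $R\|\gamma\|\le|\mu(\gamma)|$ for all $\gamma\in L$. Let $C\subset\mathbb C$ be a finite set such that there are no distinct $c,c'\in C$ and $\gamma\in L$ with $c=c'+\mu(\gamma)$. For $e^{i\theta}\in S^1$ write $c<_\theta c'$ if $\mathrm{Re}(e^{-i\theta}(c-c'))<0$, and $c\leqslant_\theta c'$ if $c<_\theta c'$ or $c=c'$; for $I\subset S^1$ open, $c\leqslant_I c'$ means $c\leqslant_\theta c'$ for all $e^{i\theta}\in I$. On $S^1$, the boundary of the real oriented blow-up of $\mathbb C$ at $0$, let $\widetilde{\mathscr O}$ be the sheaf of germs of holomorphic functions on $\mathbb C^*$ near the boundary, $\mathscr A^{\leqslant0}\subset\widetilde{\mathscr O}$ the subsheaf of functions of moderate growth, and $\mathscr A^{\leqslant c}=e^{c/z}\mathscr A^{\leqslant0}$. Let $\mathscr A_\mu^{\leqslant0}$ be the sheaf associated to $I\mapsto\{\sum_{\mu(\gamma)\leqslant_I0}a_\gamma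 e^{\mu(\gamma)/z}\mid \sum|a_\gamma|\varrho^{\|\gamma\|}<\infty\text{ for some }\varrho>0\}$, put $u^\gamma=e^{\mu(\gamma)/z}$, $\mathscr A_\mu=\sum_{\gamma\in L}u^\gamma\mathscr A_\mu^{\leqslant0}$ and $\mathscr A_\mu^{\leqslant c}=\mathscr A_\mu\cap\mathscr A^{\leqslant c}$. A *filtered $\mathscr A_\mu$-module* is a sheaf of $\mathscr A_\mu$-modules $\mathscr L$ on $S^1$ with $\mathscr A_\mu^{\leqslant0}$-submodules $\mathscr L_{\leqslant c}$ $(c\in\mathbb C)$ such that $(\mathscr L_{\leqslant c})_{e^{i\theta}}\subset(\mathscr L_{\leqslant c'})_{e^{i\theta}}$ if $c\leqslant_\theta c'$, and $u^\gamma\mathscr L_{\leqslant c}=\mathscr L_{\leqslant c+\mu(\gamma)}$. Let $(\mathscr L_{<c})_{e^{i\theta}}=\sum_{c'<_\theta c}(\mathscr L_{\leqslant c'})_{e^{i\theta}}$, $\mathrm{gr}_c\mathscr L=\mathscr L_{\leqslant c}/\mathscr L_{<c}$ and $\mathrm{gr}\,\mathscr L=\bigoplus_c\mathrm{gr}_c\mathscr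 L$, a sheaf of $\mathbb C[L]$-modules. The module $\mathscr A_\mu\otimes_{\mathbb C[L]}\mathrm{gr}\,\mathscr L$ is filtered by $\sum_{c'+c''\leqslant c}\mathscr A_\mu^{\leqslant c'}\otimes\mathrm{gr}_{c''}\mathscr L$ (on stalks). Isomorphisms of filtered modules are $\mathscr A_\mu$-linear isomorphisms which, together with their inverses, preserve the filtrations. An *object of $\mathsf{Be}_{C,\mu}$* is a filtered $\mathscr A_\mu$-module $\mathscr L$ such that (a) every $\mathrm{gr}_c\mathscr L$ is a local system of finite-dimensional complex vector spaces; (b) $\mathrm{gr}_c\mathscr L\ne0$ only if $c\in-C+\mu(L)$; (c) every point of $S^1$ has an open neighbourhood $I$ with a filtered isomorphism $\eta_I\colon(\mathscr A_\mu\otimes_{\mathbb C[L]}\mathrm{gr}\,\mathscr L)|_I\to\mathscr L|_I$ such that $\mathrm{gr}(\eta_I)=\mathrm{id}$ (a *splitting* on $I$). It is *graded* if it is isomorphic to $\mathscr A_\mu\otimes_{\mathbb C[L]}\mathrm{gr}\,\mathscr L$ as a filtered $\mathscr A_\mu$-module. Filter $\mathscr{H}om(\mathscr L,\mathscr L)$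 by letting $\mathscr{H}om(\mathscr L,\mathscr L)_{\leqslant c}$ consist of the $\mathscr A_\mu$-linear maps sending $\mathscr L_{\leqslant b}$ into $\mathscr L_{\leqslant b+c}$ for all $b$, let $\mathscr End^{<0}(\mathscr L)$ be the subsheaf with stalk at $e^{i\theta}$ the sum of the stalks of $\mathscr{H}om(\mathscr L,\mathscr L)_{\leqslant c}$ over $c<_\theta0$, and let $\mathscr Aut^{<0}_\mu(\mathscr L)=\mathrm{id}+\mathscr End^{<0}(\mathscr L)$, a sheaf of groups. For a sheaf of groups $\mathscr S$ on $S^1$, $H^1(S^1,\mathscr S)$ is the nonabelian Čech cohomology set (the colimit over open covers). **Theorem.** Let $\mathscr G$ be a graded $\mathscr A_\mu$-module in $\mathsf{Be}_{C,\mu}$. Consider pairs $(\mathscr L,\xi)$ of an object $\mathscr L$ of $\mathsf{Be}_{C,\mu}$ and an isomorphism $\xi\colon\mathscr A_\mu\otimes_{\mathbb C[L]}\mathrm{gr}\,\mathscr L\to\mathscr G$ of filtered $\mathscr A_\mu$-modules; an isomorphism $(\mathscr L,\xi)\cong(\mathscr L',\xi')$ is a filtered isomorphism $f\colon\mathscr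 L\to\mathscr L'$ with $\xi'\circ(\mathrm{id}\otimes\mathrm{gr}f)=\xi$. There is a unique bijection from the set of isomorphism classes of such pairs to $H^1(S^1,\mathscr Aut^{<0}_\mu(\mathscr G))$ which has the following property: for every pair $(\mathscr L,\xi)$, every open cover $(U_i)_i$ of $S^1$ and every family of splittings $\eta_i$ of $\mathscr L$ on $U_i$, the automorphisms $g_{ij}=\xi\,\eta_i^{-1}\eta_j\,\xi^{-1}$ of $\mathscr G|_{U_i\cap U_j}$ form a 1-cocycle with values in $\mathscr Aut^{<0}_\mu(\mathscr G)$, and the class of $(\mathscr L,\xi)$ is sent to the cohomology class of $(g_{ij})$. -/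

import Mathlib

open Filter Topology TopologicalSpace CategoryTheory
open scoped TensorProduct DirectSum

noncomputable section

namespace BettiStokes

/-- A homomorphism `μ : L → ℂ` of additive groups together with a norm on `L ⊗ ℝ` (a definite
seminorm), satisfying the support property `R ‖γ‖ ≤ |μ(γ)|` for some `R > 0`. -/
structure PeriodMap (L : Type) [AddCommGroup L] where
  μ : L →+ ℂ
  nrm : Seminorm ℝ (ℝ ⊗[ℤ] L)
  nrm_definite : ∀ v, nrm v = 0 → v = 0
  support : ∃ R : ℝ, 0 < R ∧ ∀ γ : L, R * nrm (1 ⊗ₜ[ℤ] γ) ≤ ‖μ γ‖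

/-- `c <_θ c'` at the point `x = e^{iθ}` of the circle: `Re (e^{-iθ} (c - c')) < 0`. -/
def ltAt (x : Circle) (c c' : ℂ) : Prop := ((x : ℂ)⁻¹ * (c - c')).re < 0

/-- `c ≤_θ c'` at `x = e^{iθ}`: either `c <_θ c'` or `c = c'`. -/
def leAt (x : Circle) (c c' : ℂ) : Prop := ltAt x c c' ∨ c = c'

/-- The trace on `ℂ ∖ {0}` of the neighbourhoods of the boundary point `x` in the real oriented
blow-up `{(z, w) ∈ ℂ × S¹ | z = |z| w}` of `ℂ` at the origin, i.e. the filter generated by the small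
sectors `{z | 0 < |z| < r, z / |z| near x}`. -/
def sectorFilter (x : Circle) : Filter ℂ :=
  𝓝[≠] (0 : ℂ) ⊓ comap (fun z : ℂ => z / (‖z‖ : ℂ)) (𝓝 (x : ℂ))

/-- Germs of functions on small sectors around the direction `x`. The stalk at `x` of the sheaf of
holomorphic functions on punctured sectors is a subring of it; all the germs used below are germs of
locally uniformly convergent exponential series, hence holomorphic. -/
abbrev FunGerm (x : Circle) : Type := Germ (sectorFilter x) ℂ

instance (x : Circle) : Algebra ℂ (FunGerm x) :=
  Algebra.ofModule
    (fun r f g => by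
      induction f using Germ.inductionOn with | _ f =>
      induction g using Germ.inductionOn with | _ g =>
      exact congrArg (Germ.ofFun (l := sectorFilter x)) (funext fun z => smul_mul_assoc r (f z) (g z)))
    (fun r f g => by
      induction f using Germ.inductionOn with | _ f =>
      induction g using Germ.inductionOn with | _ g =>
      exact congrArg (Germ.ofFun (l := sectorFilter x)) (funext fun z => mul_smul_comm r (f z) (g z)))

section coefficients

variable {L : Type} [AddCommGroup L]

namespace PeriodMap

variable (P : PeriodMap L)

/-- The norm of the lattice element `γ`, i.e. the norm of `1 ⊗ γ`. -/
def len (γ : L) : ℝ := P.nrm (1 ⊗ₜ[ℤ] γ)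

/-- `f = ∑_γ a_γ exp(μ(γ)/z)`, the sum being over the `γ` with `μ(γ) ≤_U 0`, with
`∑ |a_γ| ρ^‖γ‖ < ∞` for some `ρ > 0`. -/
def IsExpSeries (U : Opens Circle) (f : ℂ → ℂ) : Prop :=
  ∃ a : L → ℂ,
    (∀ γ, a γ ≠ 0 → ∀ y ∈ U, leAt y (P.μ γ) 0) ∧
    (∃ ρ : ℝ, 0 < ρ ∧ Summable fun γ => ‖a γ‖ * ρ ^ P.len γ) ∧
    ∀ z, f z = ∑' γ, a γ * Complex.exp (P.μ γ / z)

/-- The stalk at `x` of `𝒜_μ^{≤ 0}`, as the sheaf associated to the presheaf of the exponential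
series above (the union over `ρ > 0`). -/
def seriesStalk (x : Circle) : Set (FunGerm x) :=
  {g | ∃ U : Opens Circle, x ∈ U ∧ ∃ f : ℂ → ℂ, P.IsExpSeries U f ∧ g = (f : FunGerm x)}

/-- The germ of `u^γ = exp(μ(γ)/z)`. -/
def expGerm (x : Circle) (γ : L) : FunGerm x := ((fun z => Complex.exp (P.μ γ / z) : ℂ → ℂ) : FunGerm x)

/-- The stalk at `x` of `∑_γ exp(μ(γ)/z) 𝒜_μ^{≤ 0}`, as a vector space. -/
def stalkSpan (x : Circle) : Submodule ℂ (FunGerm x) :=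
  Submodule.span ℂ {g | ∃ γ : L, ∃ h ∈ P.seriesStalk x, g = P.expGerm x γ * h}

theorem cone_bound {x : Circle} {U : Opens Circle} (hx : x ∈ U) :
    ∃ κ : ℝ, 0 < κ ∧ ∀ m : ℂ, (∀ y ∈ U, leAt y m 0) → ((x : ℂ)⁻¹ * m).re ≤ -κ * ‖m‖ := by
  have hcont : Continuous (fun t : ℝ => x * Circle.exp t) := by fun_prop
  have hU : ∀ᶠ t in 𝓝 (0 : ℝ), x * Circle.exp t ∈ U := by
    apply hcont.continuousAt.eventually_mem
    apply U.isOpen.mem_nhds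
    simpa using hx
  obtain ⟨ε, hε, hball⟩ := Metric.eventually_nhds_iff.1 hU
  set η : ℝ := min (ε / 2) 1 with hη
  have hη0 : 0 < η := by positivity
  have hη1 : η ≤ 1 := min_le_right _ _
  have hηε : η < ε := lt_of_le_of_lt (min_le_left _ _) (by linarith)
  have hs : 0 < Real.sin η := Real.sin_pos_of_pos_of_lt_pi hη0 (by linarith [Real.pi_gt_three])
  have hc : 0 < Real.cos η := Real.cos_pos_of_mem_Ioo ⟨by linarith [Real.pi_gt_three], by linarith [Real.pi_gt_three]⟩
  have h1 : x * Circle.exp η ∈ U := hball (by simpa [abs_of_pos hη0] using hηε)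
  have h2 : x * Circle.exp (-η) ∈ U := hball (by simpa [abs_of_pos hη0] using hηε)
  have hle : ∀ (y : Circle) (m : ℂ), leAt y m 0 → ((y : ℂ)⁻¹ * m).re ≤ 0 := by
    rintro y m (h | rfl)
    · have : ((y : ℂ)⁻¹ * (m - 0)).re < 0 := h
      rw [sub_zero] at this
      exact this.le
    · simp
  refine ⟨Real.sin η / 2, by positivity, fun m hm => ?_⟩
  have e1 := hle _ _ (hm _ h1)
  have e2 := hle _ _ (hm _ h2)
  have key : ∀ t : ℝ, ((x * Circle.exp t : Circle) : ℂ)⁻¹ * m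
      = Complex.exp (((-t : ℝ) : ℂ) * Complex.I) * ((x : ℂ)⁻¹ * m) := by
    intro t
    rw [Circle.coe_mul, Circle.coe_exp, mul_inv, ← Complex.exp_neg]
    push_cast
    ring_nf
  rw [key] at e1 e2
  set w : ℂ := (x : ℂ)⁻¹ * m with hw
  have hnorm : ‖m‖ = ‖w‖ := by rw [hw, norm_mul, norm_inv, Circle.norm_coe, inv_one, one_mul]
  rw [hnorm]
  rw [Complex.mul_re, Complex.exp_ofReal_mul_I_re, Complex.exp_ofReal_mul_I_im] at e1 e2
  simp only [Real.cos_neg, Real.sin_neg, neg_neg] at e1 e2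
  have habs : Real.sin η * |w.im| ≤ - (Real.cos η * w.re) := by
    rcases abs_cases w.im with ⟨h, _⟩ | ⟨h, _⟩ <;> rw [h] <;> nlinarith
  have hre : w.re ≤ 0 := by
    have : 0 ≤ Real.sin η * |w.im| := by positivity
    by_contra hcon
    push Not at hcon
    nlinarith [mul_pos hc hcon]
  have hn : ‖w‖ ≤ |w.re| + |w.im| := Complex.norm_le_abs_re_add_abs_im w
  rw [abs_of_nonpos hre] at hn
  have hs1 : Real.sin η ≤ 1 := Real.sin_le_one _
  have hc1 : Real.cos η ≤ 1 := Real.cos_le_one _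
  nlinarith

theorem exists_upper_bound [Module.Finite ℤ L] : ∃ K : ℝ, 0 < K ∧ ∀ γ, ‖P.μ γ‖ ≤ K * P.len γ := by
  let N : NormedAddCommGroup (ℝ ⊗[ℤ] L) :=
    AddGroupNorm.toNormedAddCommGroup
      { toFun := P.nrm
        map_zero' := map_zero P.nrm
        add_le' := map_add_le_add P.nrm
        neg' := map_neg_eq_map P.nrm
        eq_zero_of_map_eq_zero' := P.nrm_definite }
  let S : NormedSpace ℝ (ℝ ⊗[ℤ] L) :=
    { norm_smul_le := fun a v => le_of_eq (map_smul_eq_mul P.nrm a v) }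
  let F : (ℝ ⊗[ℤ] L) →ₗ[ℝ] ℂ := LinearMap.liftBaseChange ℝ P.μ.toIntLinearMap
  have hF : ∀ γ, F (1 ⊗ₜ[ℤ] γ) = P.μ γ := fun γ => by simp [F]
  let F' : (ℝ ⊗[ℤ] L) →L[ℝ] ℂ := ⟨F, F.continuous_of_finiteDimensional⟩
  refine ⟨‖F'‖ + 1, by positivity, fun γ => ?_⟩
  have h := F'.le_opNorm (1 ⊗ₜ[ℤ] γ)
  have h2 : ‖(1 ⊗ₜ[ℤ] γ : ℝ ⊗[ℤ] L)‖ = P.len γ := rfl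
  have h3 : F' (1 ⊗ₜ[ℤ] γ) = P.μ γ := hF γ
  rw [h2, h3] at h
  have h4 : 0 ≤ P.len γ := apply_nonneg P.nrm _
  nlinarith

theorem len_nonneg (γ : L) : 0 ≤ P.len γ := apply_nonneg P.nrm _

theorem len_bound : ∃ R : ℝ, 0 < R ∧ ∀ γ, R * P.len γ ≤ ‖P.μ γ‖ := P.support

/-- Domination of the exponentials by powers on a small sector. -/
theorem exp_bound {x : Circle} {U : Opens Circle} (hx : x ∈ U) {ρ : ℝ} (hρ : 0 < ρ) :
    ∀ᶠ z in sectorFilter x, ∀ γ, (∀ y ∈ U, leAt y (P.μ γ) 0) →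
      ‖Complex.exp (P.μ γ / z)‖ ≤ ρ ^ P.len γ := by
  obtain ⟨κ, hκ, hcone⟩ := cone_bound hx
  obtain ⟨R, hR, hlen⟩ := P.len_bound
  have h1 : ∀ᶠ z in sectorFilter x, ‖z / (‖z‖ : ℂ) - x‖ < κ / 2 := by
    apply mem_inf_of_right
    exact preimage_mem_comap (Metric.ball_mem_nhds (x : ℂ) (half_pos hκ) |> fun h =>
      by simpa [Metric.ball, dist_eq_norm] using h)
  have h2 : ∀ᶠ z in sectorFilter x, z ≠ 0 :=
    mem_inf_of_left self_mem_nhdsWithin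
  have h3 : ∀ᶠ z in sectorFilter x, ‖z‖ * |Real.log ρ| < κ / 2 * R := by
    apply mem_inf_of_left
    apply mem_nhdsWithin_of_mem_nhds
    have : Continuous fun z : ℂ => ‖z‖ * |Real.log ρ| := by fun_prop
    apply this.continuousAt.eventually_lt continuousAt_const
    simp; positivity
  filter_upwards [h1, h2, h3] with z hz1 hz2 hz3 γ hγ
  have hzn : 0 < ‖z‖ := norm_pos_iff.2 hz2
  set m := P.μ γ with hm
  rw [Complex.norm_exp, Real.rpow_def_of_pos hρ]
  apply Real.exp_le_exp.2
  have e1 := hcone m hγ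
  set w : ℂ := z / (‖z‖ : ℂ) with hw
  have hwn : ‖w‖ = 1 := by
    rw [hw, norm_div, Complex.norm_real, norm_norm, div_self hzn.ne']
  have hzw : z = ‖z‖ * w := by
    have hz0 : (‖z‖ : ℂ) ≠ 0 := by exact_mod_cast hzn.ne'
    rw [hw, mul_div_cancel₀ _ hz0]
  have e2 : m / z = (((‖z‖)⁻¹ : ℝ) : ℂ) * (w⁻¹ * m) := by
    conv_lhs => rw [hzw]
    push_cast
    rw [div_eq_mul_inv, mul_inv]; ring
  rw [e2, Complex.re_ofReal_mul]
  have hxne : (x : ℂ) ≠ 0 := Circle.coe_ne_zero x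
  have hwne : w ≠ 0 := by intro h; simp [h] at hwn
  have e3 : ‖w⁻¹ - (x : ℂ)⁻¹‖ < κ / 2 := by
    have : w⁻¹ - (x : ℂ)⁻¹ = -(w⁻¹ * (x : ℂ)⁻¹ * (w - x)) := by field_simp; ring
    rw [this, norm_neg, norm_mul, norm_mul, norm_inv, norm_inv, hwn, Circle.norm_coe]
    simpa using hz1
  have e4 : (w⁻¹ * m).re ≤ -(κ / 2) * ‖m‖ := by
    have : w⁻¹ * m = (x : ℂ)⁻¹ * m + (w⁻¹ - (x : ℂ)⁻¹) * m := by ring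
    rw [this, Complex.add_re]
    have h5 : ((w⁻¹ - (x : ℂ)⁻¹) * m).re ≤ κ / 2 * ‖m‖ := by
      refine (Complex.re_le_norm _).trans ?_
      rw [norm_mul]
      exact mul_le_mul_of_nonneg_right e3.le (norm_nonneg _)
    linarith
  have hl := P.len_nonneg γ
  have e5 := hlen γ
  rw [← hm] at e5
  have e6 : (w⁻¹ * m).re ≤ -(κ / 2 * R) * P.len γ := by nlinarith
  have e7 : -(κ / 2 * R) * P.len γ ≤ -(‖z‖ * |Real.log ρ|) * P.len γ := by nlinarith
  calc ‖z‖⁻¹ * (w⁻¹ * m).re ≤ ‖z‖⁻¹ * (-(‖z‖ * |Real.log ρ|) * P.len γ) := by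
        apply mul_le_mul_of_nonneg_left (e6.trans e7) (by positivity)
    _ = -|Real.log ρ| * P.len γ := by field_simp
    _ ≤ Real.log ρ * P.len γ := by
        apply mul_le_mul_of_nonneg_right (neg_abs_le _) hl

theorem leAt_add {x : Circle} {a a' b b' : ℂ} (h : leAt x a b) (h' : leAt x a' b') :
    leAt x (a + a') (b + b') := by
  have key : (x : ℂ)⁻¹ * (a + a' - (b + b')) = (x : ℂ)⁻¹ * (a - b) + (x : ℂ)⁻¹ * (a' - b') := by ring
  rcases h with h | rfl
  · left
    unfold ltAt at h ⊢
    rw [key, Complex.add_re]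
    rcases h' with h' | rfl
    · unfold ltAt at h'; linarith
    · simpa using h
  · rcases h' with h' | rfl
    · left
      unfold ltAt at h' ⊢
      rw [key, Complex.add_re]
      simpa using h'
    · right; rfl

/-- almost additivity of the norm on a cone -/
theorem len_add_le [Module.Finite ℤ L] {x : Circle} {U : Opens Circle} (hx : x ∈ U) :
    ∃ K : ℝ, 0 < K ∧ ∀ γ δ, (∀ y ∈ U, leAt y (P.μ γ) 0) → (∀ y ∈ U, leAt y (P.μ δ) 0) →
      P.len γ + P.len δ ≤ K * P.len (γ + δ) := by
  obtain ⟨κ, hκ, hcone⟩ := cone_bound hx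
  obtain ⟨R, hR, hlen⟩ := P.len_bound
  obtain ⟨K, hK, hup⟩ := P.exists_upper_bound
  refine ⟨(κ * R)⁻¹ * K, by positivity, fun γ δ hγ hδ => ?_⟩
  have e1 := hcone _ hγ
  have e2 := hcone _ hδ
  have e3 : -‖P.μ (γ + δ)‖ ≤ ((x : ℂ)⁻¹ * P.μ (γ + δ)).re := by
    have h := Complex.abs_re_le_norm ((x : ℂ)⁻¹ * P.μ (γ + δ))
    rw [norm_mul, norm_inv, Circle.norm_coe, inv_one, one_mul] at h
    exact (abs_le.1 h).1
  rw [map_add, mul_add, Complex.add_re, ← map_add] at e3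
  have e4 := hup (γ + δ)
  have e5 := hlen γ
  have e6 := hlen δ
  rw [mul_assoc, ← div_eq_inv_mul, le_div_iff₀ (by positivity)]
  nlinarith

theorem summable_exp {x : Circle} {U : Opens Circle} (hx : x ∈ U) {a : L → ℂ}
    (ha : ∀ γ, a γ ≠ 0 → ∀ y ∈ U, leAt y (P.μ γ) 0) {ρ : ℝ} (hρ : 0 < ρ)
    (hs : Summable fun γ => ‖a γ‖ * ρ ^ P.len γ) :
    ∀ᶠ z in sectorFilter x, Summable fun γ => ‖a γ * Complex.exp (P.μ γ / z)‖ := by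
  filter_upwards [P.exp_bound hx hρ] with z hz
  refine Summable.of_nonneg_of_le (fun _ => norm_nonneg _) (fun γ => ?_) hs
  rw [norm_mul]
  by_cases h : a γ = 0
  · simp [h]
  · exact mul_le_mul_of_nonneg_left (hz γ (ha γ h)) (norm_nonneg _)

theorem seriesStalk_mul [Module.Finite ℤ L] {x : Circle} {g h : FunGerm x}
    (hg : g ∈ P.seriesStalk x) (hh : h ∈ P.seriesStalk x) : g * h ∈ P.seriesStalk x := by
  obtain ⟨U, hxU, f, ⟨a, ha, ⟨ρ, hρ, hsa⟩, hf⟩, rfl⟩ := hg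
  obtain ⟨V, hxV, f', ⟨b, hb, ⟨σ, hσ, hsb⟩, hf'⟩, rfl⟩ := hh
  set W : Opens Circle := U ⊓ V with hW
  have hxW : x ∈ W := ⟨hxU, hxV⟩
  have ha' : ∀ γ, a γ ≠ 0 → ∀ y ∈ W, leAt y (P.μ γ) 0 := fun γ h y hy => ha γ h y hy.1
  have hb' : ∀ γ, b γ ≠ 0 → ∀ y ∈ W, leAt y (P.μ γ) 0 := fun γ h y hy => hb γ h y hy.2
  set τ : ℝ := min (min ρ σ) 1 with hτ
  have hτ0 : 0 < τ := by positivity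
  have hτ1 : τ ≤ 1 := min_le_right _ _
  have hsa' : Summable fun γ => ‖a γ‖ * τ ^ P.len γ := by
    refine Summable.of_nonneg_of_le (fun γ => by positivity) (fun γ => ?_) hsa
    gcongr
    · exact P.len_nonneg γ
    · exact (min_le_left _ _).trans (min_le_left _ _)
  have hsb' : Summable fun γ => ‖b γ‖ * τ ^ P.len γ := by
    refine Summable.of_nonneg_of_le (fun γ => by positivity) (fun γ => ?_) hsb
    gcongr
    · exact P.len_nonneg γ
    · exact (min_le_left _ _).trans (min_le_right _ _)
  obtain ⟨K, hK, hKl⟩ := P.len_add_le hxW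
  set ω : ℝ := τ ^ K with hω
  have hω0 : 0 < ω := Real.rpow_pos_of_pos hτ0 _
  -- the shear equivalence
  let e : L × L ≃ L × L :=
    { toFun := fun p => (p.1 + p.2, p.1)
      invFun := fun p => (p.2, p.1 - p.2)
      left_inv := fun p => by simp
      right_inv := fun p => by simp }
  have hprod : Summable fun p : L × L => ‖a p.1 * b p.2‖ * ω ^ P.len (p.1 + p.2) := by
    have hs2 : Summable fun p : L × L => (‖a p.1‖ * τ ^ P.len p.1) * (‖b p.2‖ * τ ^ P.len p.2) :=
      hsa'.mul_of_nonneg hsb' (fun γ => by positivity) (fun γ => by positivity)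
    refine Summable.of_nonneg_of_le (fun γ => by positivity) (fun p => ?_) hs2
    by_cases h1 : a p.1 = 0
    · simp [h1]
    by_cases h2 : b p.2 = 0
    · simp [h2]
    have h3 := hKl p.1 p.2 (ha' _ h1) (hb' _ h2)
    have h4 : ω ^ P.len (p.1 + p.2) ≤ τ ^ P.len p.1 * τ ^ P.len p.2 := by
      rw [hω, ← Real.rpow_mul hτ0.le, ← Real.rpow_add hτ0]
      exact Real.rpow_le_rpow_of_exponent_ge hτ0 hτ1 h3
    rw [norm_mul]
    calc ‖a p.1‖ * ‖b p.2‖ * ω ^ P.len (p.1 + p.2)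
        ≤ ‖a p.1‖ * ‖b p.2‖ * (τ ^ P.len p.1 * τ ^ P.len p.2) := by gcongr
      _ = _ := by ring
  have hprod' : Summable fun p : L × L => ‖a p.2 * b (p.1 - p.2)‖ * ω ^ P.len p.1 := by
    have := (Equiv.summable_iff e.symm).2 hprod
    refine this.congr fun p => ?_
    simp [e]
  refine ⟨W, hxW, fun z => ∑' ε, (∑' γ, a γ * b (ε - γ)) * Complex.exp (P.μ ε / z),
    ⟨fun ε => ∑' γ, a γ * b (ε - γ), ?_, ⟨ω, hω0, ?_⟩, fun z => rfl⟩, ?_⟩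
  · intro ε hε y hy
    obtain ⟨γ, hγ⟩ : ∃ γ, a γ * b (ε - γ) ≠ 0 := by
      by_contra hcon
      push Not at hcon
      exact hε (by simp [hcon])
    have h1 := ha' γ (left_ne_zero_of_mul hγ) y hy
    have h2 := hb' _ (right_ne_zero_of_mul hγ) y hy
    have := leAt_add h1 h2
    rwa [← map_add, add_sub_cancel, add_zero] at this
  · have hsig := hprod'.prod
    refine Summable.of_nonneg_of_le (fun γ => by positivity) (fun ε => ?_) hsig
    have hfib : Summable fun γ => ‖a γ * b (ε - γ)‖ * ω ^ P.len ε := hprod'.prod_factor ε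
    have hfib' : Summable fun γ => ‖a γ * b (ε - γ)‖ := by
      have hne : ω ^ P.len ε ≠ 0 := (Real.rpow_pos_of_pos hω0 _).ne'
      exact (summable_mul_right_iff hne).1 hfib
    show ‖∑' γ, a γ * b (ε - γ)‖ * ω ^ P.len ε ≤ ∑' γ, ‖a γ * b (ε - γ)‖ * ω ^ P.len ε
    rw [tsum_mul_right]
    gcongr
    exact norm_tsum_le_tsum_norm hfib'
  · rw [← Germ.coe_mul]
    apply Germ.coe_eq.2
    filter_upwards [P.summable_exp hxW ha' hτ0 hsa', P.summable_exp hxW hb' hτ0 hsb']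
      with z hz1 hz2
    show f z * f' z = _
    rw [hf, hf', tsum_mul_tsum_of_summable_norm hz1 hz2]
    have hsm := summable_mul_of_summable_norm hz1 hz2
    rw [← Equiv.tsum_eq e.symm]
    have hsm' := (Equiv.summable_iff e.symm).2 hsm
    rw [Summable.tsum_prod (f := fun p : L × L => (fun x : L × L => a x.1 * Complex.exp (P.μ x.1 / z) *
      (b x.2 * Complex.exp (P.μ x.2 / z))) (e.symm p)) hsm']
    refine tsum_congr fun ε => ?_
    rw [← tsum_mul_right]
    refine tsum_congr fun γ => ?_
    simp only [e, Equiv.coe_fn_symm_mk]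
    have : P.μ ε / z = P.μ γ / z + P.μ (ε - γ) / z := by rw [← add_div, ← map_add, add_sub_cancel]
    rw [this, Complex.exp_add]
    ring


theorem one_mem_seriesStalk (x : Circle) : (1 : FunGerm x) ∈ P.seriesStalk x := by
  classical
  refine ⟨⊤, trivial, fun _ => 1, ⟨fun γ => if γ = 0 then 1 else 0, ?_, ⟨1, one_pos, ?_⟩, ?_⟩, rfl⟩
  · intro γ hγ y _
    have : γ = 0 := by by_contra h; simp [h] at hγ
    right; simp [this]
  · apply summable_of_ne_finset_zero (s := {0})
    intro γ hγ
    have : γ ≠ 0 := by simpa using hγ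
    simp [this]
  · intro z
    rw [tsum_eq_single 0]
    · simp
    · intro γ hγ; simp [hγ]

theorem expGerm_add (x : Circle) (γ δ : L) :
    P.expGerm x (γ + δ) = P.expGerm x γ * P.expGerm x δ := by
  unfold expGerm
  rw [← Germ.coe_mul]
  congr 1
  funext z
  simp [add_div, Complex.exp_add]

theorem expGerm_zero (x : Circle) : P.expGerm x 0 = 1 := by
  unfold expGerm
  rw [← Germ.coe_one]
  congr 1
  funext z
  simp

theorem seriesStalk_eventually {x : Circle} {g : FunGerm x} (hg : g ∈ P.seriesStalk x) :
    ∃ f : ℂ → ℂ, g = (f : FunGerm x) ∧ ∀ᶠ y in 𝓝 x, (f : FunGerm y) ∈ P.seriesStalk y := by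
  obtain ⟨U, hx, f, hf, rfl⟩ := hg
  refine ⟨f, rfl, ?_⟩
  filter_upwards [U.isOpen.mem_nhds hx] with y hy using ⟨U, hy, f, hf, rfl⟩

variable [Module.Finite ℤ L]

/-- The stalk at `x` of the sheaf of rings `𝒜_μ = ∑_γ exp(μ(γ)/z) 𝒜_μ^{≤ 0}`. -/
def Amu (x : Circle) : Subalgebra ℂ (FunGerm x) :=
  (P.stalkSpan x).toSubalgebra
    (Submodule.subset_span ⟨0, 1, P.one_mem_seriesStalk x, by rw [expGerm_zero, one_mul]⟩)
    (fun a b ha hb => by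
      unfold stalkSpan at ha hb ⊢
      have h := Submodule.mul_mem_mul ha hb
      rw [Submodule.span_mul_span] at h
      refine Submodule.span_mono ?_ h
      rintro _ ⟨_, ⟨γ, f, hf, rfl⟩, _, ⟨δ, g, hg, rfl⟩, rfl⟩
      refine ⟨γ + δ, f * g, P.seriesStalk_mul hf hg, ?_⟩
      simp only [expGerm_add]
      ring)

theorem mem_Amu {x : Circle} {g : FunGerm x} : g ∈ P.Amu x ↔ g ∈ P.stalkSpan x := Iff.rfl

end PeriodMap

end coefficients

/-- Germs of moderate growth: `|f(z)| ≤ K |z|^{-N}` on a small sector around `x`. -/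
def Moderate (x : Circle) (g : FunGerm x) : Prop :=
  ∃ f : ℂ → ℂ, g = (f : FunGerm x) ∧
    ∃ (K : ℝ) (N : ℕ), ∀ᶠ z in sectorFilter x, ‖f z‖ ≤ K / ‖z‖ ^ N

theorem Moderate.add {x : Circle} {g h : FunGerm x} (hg : Moderate x g) (hh : Moderate x h) :
    Moderate x (g + h) := by
  obtain ⟨f, rfl, K, N, hf⟩ := hg
  obtain ⟨f', rfl, K', N', hf'⟩ := hh
  refine ⟨f + f', rfl, |K| + |K'|, N + N', ?_⟩
  have h1 : ∀ᶠ z in sectorFilter x, ‖z‖ < 1 := by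
    apply mem_inf_of_left
    apply mem_nhdsWithin_of_mem_nhds
    have := Metric.ball_mem_nhds (0 : ℂ) one_pos
    simpa [Metric.ball] using this
  have h2 : ∀ᶠ z in sectorFilter x, z ≠ 0 :=
    mem_inf_of_left self_mem_nhdsWithin
  filter_upwards [hf, hf', h1, h2] with z e1 e2 e3 e4
  have hz : 0 < ‖z‖ := norm_pos_iff.2 e4
  have e5 : K / ‖z‖ ^ N ≤ |K| / ‖z‖ ^ (N + N') := by
    have : ‖z‖ ^ (N + N') ≤ ‖z‖ ^ N := pow_le_pow_of_le_one hz.le e3.le (Nat.le_add_right _ _)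
    calc K / ‖z‖ ^ N ≤ |K| / ‖z‖ ^ N := by gcongr; exact le_abs_self K
      _ ≤ _ := by gcongr
  have e6 : K' / ‖z‖ ^ N' ≤ |K'| / ‖z‖ ^ (N + N') := by
    have : ‖z‖ ^ (N + N') ≤ ‖z‖ ^ N' := pow_le_pow_of_le_one hz.le e3.le (Nat.le_add_left _ _)
    calc K' / ‖z‖ ^ N' ≤ |K'| / ‖z‖ ^ N' := by gcongr; exact le_abs_self K'
      _ ≤ _ := by gcongr
  calc ‖(f + f') z‖ ≤ ‖f z‖ + ‖f' z‖ := norm_add_le _ _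
    _ ≤ _ := by rw [add_div]; linarith

theorem Moderate.mul {x : Circle} {g h : FunGerm x} (hg : Moderate x g) (hh : Moderate x h) :
    Moderate x (g * h) := by
  obtain ⟨f, rfl, K, N, hf⟩ := hg
  obtain ⟨f', rfl, K', N', hf'⟩ := hh
  refine ⟨f * f', rfl, |K| * |K'|, N + N', ?_⟩
  filter_upwards [hf, hf'] with z e1 e2
  have e3 : ‖f z‖ ≤ |K| / ‖z‖ ^ N := e1.trans (by gcongr; exact le_abs_self K)
  have e4 : ‖f' z‖ ≤ |K'| / ‖z‖ ^ N' := e2.trans (by gcongr; exact le_abs_self K')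
  calc ‖(f * f') z‖ = ‖f z‖ * ‖f' z‖ := norm_mul _ _
    _ ≤ (|K| / ‖z‖ ^ N) * (|K'| / ‖z‖ ^ N') := by gcongr
    _ = _ := by rw [pow_add]; field_simp

theorem moderate_const (x : Circle) (r : ℂ) : Moderate x ((fun _ => r : ℂ → ℂ) : FunGerm x) :=
  ⟨fun _ => r, rfl, ‖r‖, 0, by simp⟩

/-- The germ of `exp(c/z)`. -/
def expC (x : Circle) (c : ℂ) : FunGerm x := ((fun z => Complex.exp (c / z) : ℂ → ℂ) : FunGerm x)

theorem expC_add (x : Circle) (c d : ℂ) : expC x (c + d) = expC x c * expC x d := by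
  unfold expC
  rw [← Germ.coe_mul]
  congr 1
  funext z
  simp [add_div, Complex.exp_add]

theorem expC_zero (x : Circle) : expC x 0 = 1 := by
  unfold expC
  rw [← Germ.coe_one]
  congr 1
  funext z
  simp

/-- The germs in `exp(c/z) · (moderate growth)`, i.e. the growth condition defining
`𝒜^{≤ c} = exp(c/z) 𝒜^{≤ 0}`. -/
def growthLE (x : Circle) (c : ℂ) : Submodule ℂ (FunGerm x) where
  carrier := {g | ∃ h, Moderate x h ∧ g = expC x c * h}
  add_mem' := by
    rintro _ _ ⟨h, hh, rfl⟩ ⟨h', hh', rfl⟩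
    exact ⟨h + h', hh.add hh', by ring⟩
  zero_mem' := ⟨0, moderate_const x 0, by simp⟩
  smul_mem' := by
    rintro r _ ⟨h, hh, rfl⟩
    exact ⟨((fun _ => r : ℂ → ℂ) : FunGerm x) * h, (moderate_const x r).mul hh, by
      have : r • (expC x c * h) = ((fun _ => r : ℂ → ℂ) : FunGerm x) * (expC x c * h) := by
        induction h using Germ.inductionOn with | _ h =>
        rfl
      rw [this]; ring⟩

theorem growthLE_mul {x : Circle} {c d : ℂ} {g h : FunGerm x} (hg : g ∈ growthLE x c)
    (hh : h ∈ growthLE x d) : g * h ∈ growthLE x (c + d) := by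
  obtain ⟨g, hg, rfl⟩ := hg
  obtain ⟨h, hh, rfl⟩ := hh
  exact ⟨g * h, hg.mul hh, by rw [expC_add]; ring⟩

theorem eventually_sectorFilter {x : Circle} {p : ℂ → Prop} (h : ∀ᶠ z in sectorFilter x, p z) :
    ∀ᶠ y in 𝓝 x, ∀ᶠ z in sectorFilter y, p z := by
  obtain ⟨A, hA, B, ⟨B', hB', hBB⟩, hS⟩ := mem_inf_iff_superset.1 h
  have h1 : ∀ᶠ w in 𝓝 (x : ℂ), B' ∈ 𝓝 w := eventually_mem_nhds_iff.2 hB'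
  have h2 : ∀ᶠ y : Circle in 𝓝 x, B' ∈ 𝓝 (y : ℂ) :=
    (show Continuous (fun y : Circle => (y : ℂ)) by fun_prop).continuousAt.eventually h1
  filter_upwards [h2] with y hy
  exact mem_inf_iff_superset.2 ⟨A, hA, _, preimage_mem_comap hy, (Set.inter_subset_inter_right _ hBB).trans hS⟩

theorem growthLE_eventually {x : Circle} {c : ℂ} {f : ℂ → ℂ} (h : (f : FunGerm x) ∈ growthLE x c) :
    ∀ᶠ y in 𝓝 x, (f : FunGerm y) ∈ growthLE y c := by
  obtain ⟨_, ⟨h, rfl, K, N, hK⟩, hf⟩ := h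
  have hf' : ∀ᶠ z in sectorFilter x, f z = Complex.exp (c / z) * h z := Germ.coe_eq.1 hf
  filter_upwards [eventually_sectorFilter hK, eventually_sectorFilter hf'] with y h1 h2
  exact ⟨_, ⟨h, rfl, K, N, h1⟩, Germ.coe_eq.2 h2⟩

theorem ltAt_eventually {x : Circle} {c c' : ℂ} (h : ltAt x c c') : ∀ᶠ y in 𝓝 x, ltAt y c c' := by
  have hc : Continuous fun y : Circle => ((y : ℂ)⁻¹ * (c - c')).re := by
    apply Complex.continuous_re.comp
    apply Continuous.mul _ continuous_const
    exact Continuous.inv₀ (by fun_prop) (fun y => Circle.coe_ne_zero y)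
  exact hc.continuousAt.eventually_lt continuousAt_const h

theorem leAt_eventually {x : Circle} {c c' : ℂ} (h : leAt x c c') : ∀ᶠ y in 𝓝 x, leAt y c c' := by
  rcases h with h | rfl
  · exact (ltAt_eventually h).mono fun _ h => Or.inl h
  · exact Eventually.of_forall fun _ => Or.inr rfl

theorem leAt_refl (x : Circle) (c : ℂ) : leAt x c c := Or.inr rfl

theorem leAt_trans {x : Circle} {a b c : ℂ} (h : leAt x a b) (h' : leAt x b c) : leAt x a c := by
  rcases h with h | rfl
  · rcases h' with h' | rfl
    · left
      unfold ltAt at *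
      have : (x : ℂ)⁻¹ * (a - c) = (x : ℂ)⁻¹ * (a - b) + (x : ℂ)⁻¹ * (b - c) := by ring
      rw [this, Complex.add_re]; linarith
    · exact Or.inl h
  · exact h'

/-! ### sheaves -/

/-- A sheaf of abelian groups on the circle with family of stalks `F`, presented by its étalé space:
`IsSec s x` says that the family `s` of elements of the stalks is a continuous section of the étalé
space on a neighbourhood of `x`. So `s` is a section over an open set `U` iff `IsSec s x` for all
`x ∈ U`; only the values of `s` near `x` matter (`isSec_congr`), every element of a stalk extends to a
section, and two sections which agree at `x` agree near `x`. The sheaf axioms are automatic. -/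
structure StalkSheaf (F : Circle → Type) [∀ x, AddCommGroup (F x)] where
  IsSec : (∀ y, F y) → Circle → Prop
  isSec_congr : ∀ {s t : ∀ y, F y} {x : Circle},
    (∀ᶠ y in 𝓝 x, s y = t y) → IsSec s x → IsSec t x
  isSec_eventually : ∀ {s : ∀ y, F y} {x : Circle}, IsSec s x → ∀ᶠ y in 𝓝 x, IsSec s y
  exists_isSec : ∀ (x : Circle) (m : F x), ∃ s : ∀ y, F y, IsSec s x ∧ s x = m
  eventually_eq : ∀ {s t : ∀ y, F y} {x : Circle},
    IsSec s x → IsSec t x → s x = t x → ∀ᶠ y in 𝓝 x, s y = t y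
  isSec_add : ∀ {s t : ∀ y, F y} {x : Circle}, IsSec s x → IsSec t x → IsSec (s + t) x
  isSec_neg : ∀ {s : ∀ y, F y} {x : Circle}, IsSec s x → IsSec (-s) x

section germs

variable (F : Circle → Type) [∀ x, AddCommGroup (F x)]

/-- The families which vanish near `x`. -/
def eventuallyZero (x : Circle) : AddSubgroup (∀ y, F y) where
  carrier := {s | ∀ᶠ y in 𝓝 x, s y = 0}
  add_mem' := fun {a b} ha hb => by
    filter_upwards [ha, hb] with y h1 h2
    simp [h1, h2]
  zero_mem' := Eventually.of_forall fun _ => rfl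
  neg_mem' := fun {a} ha => by
    filter_upwards [ha] with y h1
    simp [h1]

/-- Germs at `x` of arbitrary families of elements of the stalks. -/
def FamilyGerm (x : Circle) : Type := (∀ y, F y) ⧸ eventuallyZero F x

instance (x : Circle) : AddCommGroup (FamilyGerm F x) :=
  QuotientAddGroup.Quotient.addCommGroup (eventuallyZero F x)

variable {F}

/-- The germ of a family. -/
def FamilyGerm.mk (x : Circle) (s : ∀ y, F y) : FamilyGerm F x := QuotientAddGroup.mk s

theorem FamilyGerm.mk_eq {x : Circle} {s t : ∀ y, F y} :
    FamilyGerm.mk x s = FamilyGerm.mk x t ↔ ∀ᶠ y in 𝓝 x, s y = t y := by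
  refine (QuotientAddGroup.eq (s := eventuallyZero F x)).trans ?_
  show (∀ᶠ y in 𝓝 x, (-s + t) y = 0) ↔ _
  refine eventually_congr (Eventually.of_forall fun y => ?_)
  simp only [Pi.add_apply, Pi.neg_apply]
  rw [neg_add_eq_zero]

theorem FamilyGerm.mk_add {x : Circle} (s t : ∀ y, F y) :
    FamilyGerm.mk x (s + t) = FamilyGerm.mk x s + FamilyGerm.mk x t := rfl

theorem FamilyGerm.mk_zero (x : Circle) : FamilyGerm.mk x (0 : ∀ y, F y) = 0 := rfl

theorem FamilyGerm.mk_neg {x : Circle} (s : ∀ y, F y) :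
    FamilyGerm.mk x (-s) = -FamilyGerm.mk x s := rfl

/-- Pushing forward germs of families along a family of homomorphisms. -/
def FamilyGerm.map {F' : Circle → Type} [∀ x, AddCommGroup (F' x)] (x : Circle)
    (φ : ∀ y, F y →+ F' y) : FamilyGerm F x →+ FamilyGerm F' x :=
  QuotientAddGroup.map _ _
    { toFun := fun s y => φ y (s y)
      map_zero' := funext fun y => map_zero _
      map_add' := fun s t => funext fun y => map_add _ _ _ }
    (fun s hs => by
      have hs' : ∀ᶠ y in 𝓝 x, s y = 0 := hs
      show ∀ᶠ y in 𝓝 x, φ y (s y) = 0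
      filter_upwards [hs'] with y h
      rw [h, map_zero])

theorem FamilyGerm.map_mk {F' : Circle → Type} [∀ x, AddCommGroup (F' x)] (x : Circle)
    (φ : ∀ y, F y →+ F' y) (s : ∀ y, F y) :
    FamilyGerm.map x φ (FamilyGerm.mk x s) = FamilyGerm.mk x (fun y => φ y (s y)) := rfl

end germs

namespace StalkSheaf

variable {F : Circle → Type} [∀ x, AddCommGroup (F x)] (S : StalkSheaf F)

theorem isSec_zero (x : Circle) : S.IsSec 0 x := by
  obtain ⟨s, hs, -⟩ := S.exists_isSec x 0
  simpa using S.isSec_add hs (S.isSec_neg hs)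

/-- A section near `x` through a given element of the stalk. -/
def ext (x : Circle) (m : F x) : ∀ y, F y := (S.exists_isSec x m).choose

theorem ext_isSec (x : Circle) (m : F x) : S.IsSec (S.ext x m) x := (S.exists_isSec x m).choose_spec.1

theorem ext_self (x : Circle) (m : F x) : S.ext x m x = m := (S.exists_isSec x m).choose_spec.2

theorem mk_ext {x : Circle} {s : ∀ y, F y} (hs : S.IsSec s x) :
    FamilyGerm.mk x (S.ext x (s x)) = FamilyGerm.mk x s :=
  FamilyGerm.mk_eq.2 (S.eventually_eq (S.ext_isSec _ _) hs (S.ext_self _ _))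

/-- The germ of section through a given element of the stalk. -/
def germ (x : Circle) : F x →+ FamilyGerm F x :=
  AddMonoidHom.mk' (fun m => FamilyGerm.mk x (S.ext x m)) (fun m n => by
    rw [← FamilyGerm.mk_add, ← S.mk_ext (S.isSec_add (S.ext_isSec x m) (S.ext_isSec x n))]
    simp [ext_self])

theorem germ_apply {x : Circle} {s : ∀ y, F y} (hs : S.IsSec s x) :
    S.germ x (s x) = FamilyGerm.mk x s := S.mk_ext hs

/-- The sheaf whose sections are, locally, finite sums of (plus or minus) the given generating local
sections `Gen`; `h_germ` ensures that such sums which agree at a point agree nearby. -/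
def generate (Gen : (∀ y, F y) → Circle → Prop)
    (h_open : ∀ s x, Gen s x → ∀ᶠ y in 𝓝 x, Gen s y)
    (h_stalk : ∀ x, ∀ m : F x, m ∈ AddSubgroup.closure {m | ∃ s, Gen s x ∧ s x = m})
    (h_germ : ∀ x, ∃ E : F x →+ FamilyGerm F x, ∀ s, Gen s x → E (s x) = FamilyGerm.mk x s) :
    StalkSheaf F where
  IsSec s x := ∃ t ∈ AddSubgroup.closure {t | Gen t x}, ∀ᶠ y in 𝓝 x, s y = t y
  isSec_congr := by
    rintro s s' x h ⟨t, ht, hst⟩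
    refine ⟨t, ht, ?_⟩
    filter_upwards [h, hst] with y h1 h2
    rw [← h1, h2]
  isSec_eventually := by
    rintro s x ⟨t, ht, hst⟩
    have h1 : ∀ᶠ y in 𝓝 x, t ∈ AddSubgroup.closure {t | Gen t y} := by
      clear hst
      induction ht using AddSubgroup.closure_induction with
      | mem t ht => exact (h_open t x ht).mono fun y h => AddSubgroup.subset_closure h
      | zero => exact Eventually.of_forall fun y => zero_mem _
      | add a b _ _ ha hb => filter_upwards [ha, hb] with y h1 h2 using add_mem h1 h2
      | neg a _ ha => filter_upwards [ha] with y h1 using neg_mem h1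
    filter_upwards [h1, hst.eventually_nhds] with y h2 h3 using ⟨t, h2, h3⟩
  exists_isSec := by
    intro x m
    have h := h_stalk x m
    suffices H : ∃ t ∈ AddSubgroup.closure {t | Gen t x}, t x = m by
      obtain ⟨t, ht, rfl⟩ := H
      exact ⟨t, ⟨t, ht, Eventually.of_forall fun _ => rfl⟩, rfl⟩
    induction h using AddSubgroup.closure_induction with
    | mem m hm =>
      obtain ⟨s, hs, rfl⟩ := hm
      exact ⟨s, AddSubgroup.subset_closure hs, rfl⟩
    | zero => exact ⟨0, zero_mem _, rfl⟩
    | add a b _ _ ha hb =>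
      obtain ⟨s, hs, rfl⟩ := ha
      obtain ⟨t, ht, rfl⟩ := hb
      exact ⟨s + t, add_mem hs ht, rfl⟩
    | neg a _ ha =>
      obtain ⟨s, hs, rfl⟩ := ha
      exact ⟨-s, neg_mem hs, rfl⟩
  eventually_eq := by
    rintro s s' x ⟨t, ht, hst⟩ ⟨t', ht', hst'⟩ hx
    obtain ⟨E, hE⟩ := h_germ x
    have key : ∀ t ∈ AddSubgroup.closure {t | Gen t x}, E (t x) = FamilyGerm.mk x t := by
      intro t ht
      induction ht using AddSubgroup.closure_induction with
      | mem t ht => exact hE t ht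
      | zero => simp [FamilyGerm.mk_zero]
      | add a b _ _ ha hb => rw [Pi.add_apply, map_add, ha, hb, FamilyGerm.mk_add]
      | neg a _ ha => rw [Pi.neg_apply, map_neg, ha, FamilyGerm.mk_neg]
    have h1 : t x = t' x := by rw [← hst.self_of_nhds, ← hst'.self_of_nhds, hx]
    have h2 := FamilyGerm.mk_eq.1 ((key t ht).symm.trans ((congrArg E h1).trans (key t' ht')))
    filter_upwards [hst, hst', h2] with y e1 e2 e3
    rw [e1, e2, e3]
  isSec_add := by
    rintro s s' x ⟨t, ht, hst⟩ ⟨t', ht', hst'⟩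
    refine ⟨t + t', add_mem ht ht', ?_⟩
    filter_upwards [hst, hst'] with y e1 e2
    simp [e1, e2]
  isSec_neg := by
    rintro s x ⟨t, ht, hst⟩
    refine ⟨-t, neg_mem ht, ?_⟩
    filter_upwards [hst] with y e1
    simp [e1]

end StalkSheaf

section modules

variable {L : Type} [AddCommGroup L] [Module.Finite ℤ L] (P : PeriodMap L)

namespace PeriodMap

theorem Amu_eventually {x : Circle} {g : FunGerm x} (hg : g ∈ P.Amu x) :
    ∃ f : ℂ → ℂ, g = (f : FunGerm x) ∧ ∀ᶠ y in 𝓝 x, (f : FunGerm y) ∈ P.Amu y := by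
  rw [mem_Amu] at hg
  unfold stalkSpan at hg
  induction hg using Submodule.span_induction with
  | mem g hg =>
    obtain ⟨γ, h, hh, rfl⟩ := hg
    obtain ⟨f, rfl, hf⟩ := P.seriesStalk_eventually hh
    refine ⟨fun z => Complex.exp (P.μ γ / z) * f z, rfl, ?_⟩
    filter_upwards [hf] with y hy
    exact Submodule.subset_span ⟨γ, _, hy, rfl⟩
  | zero => exact ⟨0, rfl, Eventually.of_forall fun y => zero_mem (P.Amu y)⟩
  | add a b _ _ ha hb =>
    obtain ⟨f, rfl, hf⟩ := ha
    obtain ⟨f', rfl, hf'⟩ := hb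
    refine ⟨f + f', rfl, ?_⟩
    filter_upwards [hf, hf'] with y h1 h2 using add_mem h1 h2
  | smul r a _ ha =>
    obtain ⟨f, rfl, hf⟩ := ha
    refine ⟨r • f, rfl, ?_⟩
    filter_upwards [hf] with y h1 using (P.Amu y).smul_mem h1 r

/-- The sheaf of rings `𝒜_μ`: the sections are the families of germs which are locally the germs of
one function. -/
def AmuSheaf : StalkSheaf (fun x => P.Amu x) where
  IsSec a x := ∃ f : ℂ → ℂ, ∀ᶠ y in 𝓝 x, (a y : FunGerm y) = (f : FunGerm y)
  isSec_congr := by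
    rintro s t x h ⟨f, hf⟩
    refine ⟨f, ?_⟩
    filter_upwards [h, hf] with y h1 h2
    rw [← h1, h2]
  isSec_eventually := by
    rintro s x ⟨f, hf⟩
    filter_upwards [hf.eventually_nhds] with y hy using ⟨f, hy⟩
  exists_isSec := by
    classical
    intro x m
    obtain ⟨f, hf, hf'⟩ := P.Amu_eventually m.2
    refine ⟨fun y => if h : (f : FunGerm y) ∈ P.Amu y then ⟨_, h⟩ else 0, ⟨f, ?_⟩, ?_⟩
    · filter_upwards [hf'] with y hy
      rw [dif_pos hy]
    · have h := hf'.self_of_nhds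
      simp only [dif_pos h]
      exact Subtype.ext hf.symm
  eventually_eq := by
    rintro s t x ⟨f, hf⟩ ⟨g, hg⟩ hx
    have h1 : (f : FunGerm x) = (g : FunGerm x) := by
      rw [← hf.self_of_nhds, ← hg.self_of_nhds, hx]
    filter_upwards [hf, hg, eventually_sectorFilter (Germ.coe_eq.1 h1)] with y e1 e2 e3
    apply Subtype.ext
    rw [e1, e2]
    exact Germ.coe_eq.2 e3
  isSec_add := by
    rintro s t x ⟨f, hf⟩ ⟨g, hg⟩
    refine ⟨f + g, ?_⟩
    filter_upwards [hf, hg] with y e1 e2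
    show (s y : FunGerm y) + (t y : FunGerm y) = _
    rw [e1, e2]; rfl
  isSec_neg := by
    rintro s x ⟨f, hf⟩
    refine ⟨-f, ?_⟩
    filter_upwards [hf] with y e1
    show -(s y : FunGerm y) = _
    rw [e1]; rfl

theorem isSec_mul {a b : ∀ y, P.Amu y} {x : Circle} (ha : P.AmuSheaf.IsSec a x)
    (hb : P.AmuSheaf.IsSec b x) : P.AmuSheaf.IsSec (fun y => a y * b y) x := by
  obtain ⟨f, hf⟩ := ha
  obtain ⟨g, hg⟩ := hb
  refine ⟨f * g, ?_⟩
  filter_upwards [hf, hg] with y e1 e2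
  show (a y : FunGerm y) * (b y : FunGerm y) = _
  rw [e1, e2]; rfl

theorem isSec_algebraMap (r : ℂ) (x : Circle) :
    P.AmuSheaf.IsSec (fun y => algebraMap ℂ (P.Amu y) r) x :=
  ⟨fun _ => r, Eventually.of_forall fun y => by
    show algebraMap ℂ (FunGerm y) r = _
    rw [Algebra.algebraMap_eq_smul_one]
    exact congrArg (Germ.ofFun (l := sectorFilter y)) (funext fun z => by simp)⟩

/-- The stalk at `x` of `𝒜_μ^{≤ c} = 𝒜_μ ∩ 𝒜^{≤ c}`. -/
def AmuLE (c : ℂ) (x : Circle) : Submodule ℂ (P.Amu x) :=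
  (growthLE x c).comap (P.Amu x).val.toLinearMap

theorem AmuLE_mul {c d : ℂ} {x : Circle} {a b : P.Amu x} (ha : a ∈ P.AmuLE c x)
    (hb : b ∈ P.AmuLE d x) : a * b ∈ P.AmuLE (c + d) x := growthLE_mul ha hb

theorem AmuLE_eventually {c : ℂ} {x : Circle} {a : ∀ y, P.Amu y} (hs : P.AmuSheaf.IsSec a x)
    (ha : a x ∈ P.AmuLE c x) : ∀ᶠ y in 𝓝 x, a y ∈ P.AmuLE c y := by
  obtain ⟨f, hf⟩ := hs
  have h1 : (f : FunGerm x) ∈ growthLE x c := by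
    rw [← hf.self_of_nhds]; exact ha
  filter_upwards [hf, growthLE_eventually h1] with y e1 e2
  show (a y : FunGerm y) ∈ growthLE y c
  rw [e1]; exact e2

/-- `u^γ = exp(μ(γ)/z)` as an element of the stalk of `𝒜_μ`. -/
def u (x : Circle) (γ : L) : P.Amu x :=
  ⟨P.expGerm x γ, Submodule.subset_span ⟨γ, 1, P.one_mem_seriesStalk x, (mul_one _).symm⟩⟩

theorem u_zero (x : Circle) : P.u x 0 = 1 := Subtype.ext (P.expGerm_zero x)

theorem u_add (x : Circle) (γ δ : L) : P.u x (γ + δ) = P.u x γ * P.u x δ :=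
  Subtype.ext (P.expGerm_add x γ δ)

theorem isSec_u (γ : L) (x : Circle) : P.AmuSheaf.IsSec (fun y => P.u y γ) x :=
  ⟨_, Eventually.of_forall fun _ => rfl⟩

theorem u_mem (x : Circle) (γ : L) : P.u x γ ∈ P.AmuLE (P.μ γ) x :=
  ⟨1, moderate_const x 1, (mul_one _).symm⟩

/-- `𝒜_μ` is an algebra over `ℂ[L]`, `γ` acting as `u^γ`. -/
instance (x : Circle) : Algebra (AddMonoidAlgebra ℂ L) (P.Amu x) :=
  (AddMonoidAlgebra.lift ℂ (P.Amu x) L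
    { toFun := fun γ => P.u x γ.toAdd
      map_one' := P.u_zero x
      map_mul' := fun γ δ => P.u_add x γ.toAdd δ.toAdd }).toRingHom.toAlgebra

theorem single_smul (x : Circle) (γ : L) (r : ℂ) (a : P.Amu x) :
    (AddMonoidAlgebra.single γ r : AddMonoidAlgebra ℂ L) • a = r • (P.u x γ * a) := by
  rw [Algebra.smul_def]
  show AddMonoidAlgebra.lift ℂ (P.Amu x) L _ (AddMonoidAlgebra.single γ r) * a = _
  rw [AddMonoidAlgebra.lift_single, smul_mul_assoc]
  rfl

end PeriodMap

/-- A sheaf of `𝒜_μ`-modules. -/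
structure AmuModule where
  stalk : Circle → Type
  [addCommGroup : ∀ x, AddCommGroup (stalk x)]
  [module : ∀ x, Module (P.Amu x) (stalk x)]
  sheaf : StalkSheaf stalk
  isSec_smul : ∀ {a : ∀ y, P.Amu y} {s : ∀ y, stalk y} {x : Circle},
    P.AmuSheaf.IsSec a x → sheaf.IsSec s x → sheaf.IsSec (fun y => a y • s y) x

attribute [instance] AmuModule.addCommGroup AmuModule.module

variable {P}

instance (M : AmuModule P) (x : Circle) : Module ℂ (M.stalk x) :=
  Module.compHom _ (algebraMap ℂ (P.Amu x))

instance (M : AmuModule P) (x : Circle) : IsScalarTower ℂ (P.Amu x) (M.stalk x) :=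
  IsScalarTower.of_algebraMap_smul fun _ _ => rfl

variable (P) in
/-- A filtered `𝒜_μ`-module indexed by `ℂ`: a sheaf of `𝒜_μ`-modules `ℒ` with subsheaves `ℒ_{≤ c}`
(given by their stalks, `le_eventually` being the openness of a subsheaf), which are
`𝒜_μ^{≤ 0}`-submodules, with `(ℒ_{≤ c})_x ⊆ (ℒ_{≤ c'})_x` for `c ≤_θ c'`, and with
`u^γ ℒ_{≤ c} = ℒ_{≤ c + μ(γ)}`. -/
structure FilteredModule where
  toModule : AmuModule P
  le : ℂ → ∀ x : Circle, Submodule ℂ (toModule.stalk x)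
  le_eventually : ∀ {c : ℂ} {s : ∀ y, toModule.stalk y} {x : Circle},
    toModule.sheaf.IsSec s x → s x ∈ le c x → ∀ᶠ y in 𝓝 x, s y ∈ le c y
  smul_mem : ∀ {c : ℂ} {x : Circle} {a : P.Amu x} {m : toModule.stalk x},
    a ∈ P.AmuLE 0 x → m ∈ le c x → a • m ∈ le c x
  mono : ∀ {c c' : ℂ} {x : Circle}, leAt x c c' → le c x ≤ le c' x
  shift : ∀ (γ : L) (c : ℂ) (x : Circle) (m : toModule.stalk x),
    m ∈ le (c + P.μ γ) x ↔ ∃ m' ∈ le c x, m = P.u x γ • m'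

end modules

section betti

variable {L : Type} [AddCommGroup L] [Module.Finite ℤ L] {P : PeriodMap L}

namespace FilteredModule

variable (M : FilteredModule P)

abbrev stalk (x : Circle) : Type := M.toModule.stalk x

abbrev sheaf : StalkSheaf M.stalk := M.toModule.sheaf

/-- The stalk at `x` of `ℒ_{< c}`: the sum of the stalks of `ℒ_{≤ c'}` for `c' <_θ c`. -/
def lt (c : ℂ) (x : Circle) : Submodule ℂ (M.stalk x) := ⨆ (c' : ℂ) (_ : ltAt x c' c), M.le c' x

theorem lt_le (c : ℂ) (x : Circle) : M.lt c x ≤ M.le c x :=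
  iSup₂_le fun _ h => M.mono (Or.inl h)

theorem le_le_lt {c' c : ℂ} {x : Circle} (h : ltAt x c' c) : M.le c' x ≤ M.lt c x :=
  le_iSup₂_of_le c' h le_rfl

/-- The stalk at `x` of `gr_c ℒ = ℒ_{≤ c} / ℒ_{< c}`. -/
abbrev gr (c : ℂ) (x : Circle) : Type := M.le c x ⧸ (M.lt c x).submoduleOf (M.le c x)

/-- The class in `gr_c ℒ` of an element of `ℒ_{≤ c}`. -/
def grMk (c : ℂ) (x : Circle) (m : M.le c x) : M.gr c x := Submodule.Quotient.mk m

theorem grMk_eq {c : ℂ} {x : Circle} {m n : M.le c x} :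
    M.grMk c x m = M.grMk c x n ↔ (m : M.stalk x) - n ∈ M.lt c x := by
  unfold grMk
  rw [Submodule.Quotient.eq]
  rfl

theorem lt_eventually {c : ℂ} {s : ∀ y, M.stalk y} {x : Circle}
    (hs : M.sheaf.IsSec s x) (h : s x ∈ M.lt c x) : ∀ᶠ y in 𝓝 x, s y ∈ M.lt c y := by
  suffices H : ∀ m ∈ M.lt c x, ∃ t, M.sheaf.IsSec t x ∧ t x = m ∧ ∀ᶠ y in 𝓝 x, t y ∈ M.lt c y by
    obtain ⟨t, ht, htx, h2⟩ := H _ h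
    filter_upwards [h2, M.sheaf.eventually_eq ht hs htx] with y h3 h4
    rwa [← h4]
  intro m hm
  unfold lt at hm
  simp only [iSup_subtype'] at hm
  induction hm using Submodule.iSup_induction' with
  | mem c' m hm =>
    obtain ⟨t, ht, rfl⟩ := M.sheaf.exists_isSec x m
    refine ⟨t, ht, rfl, ?_⟩
    filter_upwards [M.le_eventually ht hm, ltAt_eventually c'.2] with y h1 h2 using M.le_le_lt h2 h1
  | zero => exact ⟨0, M.sheaf.isSec_zero x, rfl, Eventually.of_forall fun y => zero_mem _⟩
  | add a b _ _ ha hb =>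
    obtain ⟨s, hs, rfl, h1⟩ := ha
    obtain ⟨t, ht, rfl, h2⟩ := hb
    refine ⟨s + t, M.sheaf.isSec_add hs ht, rfl, ?_⟩
    filter_upwards [h1, h2] with y e1 e2 using add_mem e1 e2

/-- The quotient sheaf `gr_c ℒ`: the sections are locally classes of sections of `ℒ_{≤ c}`. -/
def grSheaf (c : ℂ) : StalkSheaf (M.gr c) where
  IsSec s x := ∃ m : ∀ y, M.stalk y, M.sheaf.IsSec m x ∧
    ∀ᶠ y in 𝓝 x, ∃ h : m y ∈ M.le c y, s y = M.grMk c y ⟨m y, h⟩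
  isSec_congr := by
    rintro s t x h ⟨m, hm, hs⟩
    refine ⟨m, hm, ?_⟩
    filter_upwards [h, hs] with y h1 h2
    rwa [← h1]
  isSec_eventually := by
    rintro s x ⟨m, hm, hs⟩
    filter_upwards [M.sheaf.isSec_eventually hm, hs.eventually_nhds] with y h1 h2 using ⟨m, h1, h2⟩
  exists_isSec := by
    classical
    intro x m
    obtain ⟨⟨m, hm⟩, rfl⟩ := Submodule.Quotient.mk_surjective _ m
    obtain ⟨t, ht, rfl⟩ := M.sheaf.exists_isSec x m
    refine ⟨fun y => if h : t y ∈ M.le c y then M.grMk c y ⟨t y, h⟩ else 0, ⟨t, ht, ?_⟩, ?_⟩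
    · filter_upwards [M.le_eventually ht hm] with y hy
      exact ⟨hy, dif_pos hy⟩
    · simp only [dif_pos hm]; rfl
  eventually_eq := by
    rintro s s' x ⟨m, hm, hs⟩ ⟨m', hm', hs'⟩ hx
    obtain ⟨h1, h2⟩ := hs.self_of_nhds
    obtain ⟨h1', h2'⟩ := hs'.self_of_nhds
    rw [h2, h2', grMk_eq] at hx
    have h3 := M.sheaf.isSec_add hm (M.sheaf.isSec_neg hm')
    have h4 := M.lt_eventually (c := c) h3 (by simpa [sub_eq_add_neg] using hx)
    filter_upwards [hs, hs', h4] with y ⟨e1, e2⟩ ⟨e1', e2'⟩ e3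
    rw [e2, e2', grMk_eq]
    simpa [sub_eq_add_neg] using e3
  isSec_add := by
    rintro s s' x ⟨m, hm, hs⟩ ⟨m', hm', hs'⟩
    refine ⟨m + m', M.sheaf.isSec_add hm hm', ?_⟩
    filter_upwards [hs, hs'] with y ⟨e1, e2⟩ ⟨e1', e2'⟩
    exact ⟨add_mem e1 e1', by rw [Pi.add_apply, e2, e2']; rfl⟩
  isSec_neg := by
    rintro s x ⟨m, hm, hs⟩
    refine ⟨-m, M.sheaf.isSec_neg hm, ?_⟩
    filter_upwards [hs] with y ⟨e1, e2⟩
    exact ⟨neg_mem e1, by rw [Pi.neg_apply, e2]; rfl⟩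

/-- The stalk at `x` of `gr ℒ = ⨁_c gr_c ℒ`. -/
abbrev Gr (x : Circle) : Type := ⨁ c : ℂ, M.gr c x

/-- The inclusion of `gr_c ℒ` in `gr ℒ`. -/
def grIncl (c : ℂ) (x : Circle) : M.gr c x →ₗ[ℂ] M.Gr x := DirectSum.lof ℂ ℂ (fun c => M.gr c x) c

/-- Multiplication by `u^γ` as a map `gr_c ℒ → gr_{c + μ(γ)} ℒ`. -/
def grShift (γ : L) (c : ℂ) (x : Circle) : M.gr c x →ₗ[ℂ] M.gr (c + P.μ γ) x :=
  Submodule.mapQ _ _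
    ((Algebra.lsmul ℂ ℂ (M.stalk x) (P.u x γ)).restrict
      (p := M.le c x) (q := M.le (c + P.μ γ) x) fun m hm => (M.shift γ c x _).2 ⟨m, hm, rfl⟩)
    (by
      intro m hm
      show P.u x γ • (m : M.stalk x) ∈ M.lt (c + P.μ γ) x
      have h : (m : M.stalk x) ∈ M.lt c x := hm
      have h2 : M.lt c x ≤ (M.lt (c + P.μ γ) x).comap (Algebra.lsmul ℂ ℂ (M.stalk x) (P.u x γ)) := by
        refine iSup₂_le fun c' hc' => ?_
        intro n hn
        have : ltAt x (c' + P.μ γ) (c + P.μ γ) := by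
          unfold ltAt at hc' ⊢
          rwa [add_sub_add_right_eq_sub]
        exact M.le_le_lt this ((M.shift γ c' x _).2 ⟨n, hn, rfl⟩)
      exact h2 h)

theorem grShift_mk (γ : L) (c : ℂ) (x : Circle) (m : M.le c x) :
    M.grShift γ c x (M.grMk c x m) =
      M.grMk (c + P.μ γ) x ⟨P.u x γ • (m : M.stalk x), (M.shift γ c x _).2 ⟨m, m.2, rfl⟩⟩ := rfl

theorem grIncl_congr {c c' : ℂ} {x : Circle} (h : c = c') (m : M.le c x) (m' : M.le c' x)
    (hm : (m : M.stalk x) = m') :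
    M.grIncl c x (M.grMk c x m) = M.grIncl c' x (M.grMk c' x m') := by
  subst h
  rw [Subtype.ext hm]

/-- The operator `u^γ` on `gr ℒ`. -/
def GrShift (x : Circle) (γ : L) : M.Gr x →ₗ[ℂ] M.Gr x :=
  DirectSum.toModule ℂ ℂ (M.Gr x) fun c => (M.grIncl (c + P.μ γ) x).comp (M.grShift γ c x)

theorem GrShift_grIncl (x : Circle) (γ : L) (c : ℂ) (m : M.gr c x) :
    M.GrShift x γ (M.grIncl c x m) = M.grIncl (c + P.μ γ) x (M.grShift γ c x m) :=
  DirectSum.toModule_lof (M := fun c => M.gr c x) (N := M.Gr x) ℂ c m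

theorem Gr_hom_ext {x : Circle} {A : Type} [AddCommMonoid A] [Module ℂ A] {f g : M.Gr x →ₗ[ℂ] A}
    (h : ∀ c (m : M.le c x), f (M.grIncl c x (M.grMk c x m)) = g (M.grIncl c x (M.grMk c x m))) :
    f = g := by
  refine DirectSum.linearMap_ext ℂ fun c => LinearMap.ext fun m => ?_
  obtain ⟨m, rfl⟩ := Submodule.Quotient.mk_surjective _ m
  exact h c m

/-- The action of `L` on `gr ℒ`. -/
def grAction (x : Circle) : Multiplicative L →* Module.End ℂ (M.Gr x) where
  toFun γ := M.GrShift x γ.toAdd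
  map_one' := M.Gr_hom_ext fun c m => by
    rw [GrShift_grIncl, grShift_mk]
    exact M.grIncl_congr (by simp) _ _ (by simp [P.u_zero])
  map_mul' γ δ := M.Gr_hom_ext fun c m => by
    rw [Module.End.mul_apply, GrShift_grIncl, grShift_mk, GrShift_grIncl, grShift_mk,
      GrShift_grIncl, grShift_mk]
    exact M.grIncl_congr (by rw [toAdd_mul, map_add]; ring) _ _
      (by show P.u x _ • _ = P.u x _ • (P.u x _ • _); rw [toAdd_mul, P.u_add, mul_smul])

/-- `gr ℒ` is a `ℂ[L]`-module. -/
instance (x : Circle) : Module (AddMonoidAlgebra ℂ L) (M.Gr x) :=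
  Module.compHom (M.Gr x) (AddMonoidAlgebra.lift ℂ (Module.End ℂ (M.Gr x)) L (M.grAction x)).toRingHom

theorem single_smul_Gr (x : Circle) (γ : L) (r : ℂ) (m : M.Gr x) :
    (AddMonoidAlgebra.single γ r : AddMonoidAlgebra ℂ L) • m = r • M.GrShift x γ m := by
  show AddMonoidAlgebra.lift ℂ (Module.End ℂ (M.Gr x)) L (M.grAction x)
    (AddMonoidAlgebra.single γ r) m = _
  rw [AddMonoidAlgebra.lift_single, LinearMap.smul_apply]
  rfl

/-- The direct sum sheaf `gr ℒ = ⨁_c gr_c ℒ`: the sections are locally finite sums of sections of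
the summands. -/
def GrSheaf : StalkSheaf M.Gr :=
  StalkSheaf.generate
    (fun t x => ∃ (c : ℂ) (s : ∀ y, M.gr c y), (M.grSheaf c).IsSec s x ∧
      t = fun y => M.grIncl c y (s y))
    (by
      rintro _ x ⟨c, s, hs, rfl⟩
      filter_upwards [(M.grSheaf c).isSec_eventually hs] with y hy using ⟨c, s, hy, rfl⟩)
    (by
      intro x m
      induction m using DirectSum.induction_on with
      | zero => exact zero_mem _
      | of c m =>
        obtain ⟨s, hs, rfl⟩ := (M.grSheaf c).exists_isSec x m
        exact AddSubgroup.subset_closure ⟨_, ⟨c, s, hs, rfl⟩, rfl⟩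
      | add a b ha hb => exact add_mem ha hb)
    (by
      intro x
      refine ⟨DirectSum.toAddMonoid fun c =>
        (FamilyGerm.map x fun y => (M.grIncl c y).toAddMonoidHom).comp ((M.grSheaf c).germ x), ?_⟩
      rintro _ ⟨c, s, hs, rfl⟩
      refine (DirectSum.toAddMonoid_of _ _ _).trans ?_
      show FamilyGerm.map x _ ((M.grSheaf c).germ x (s x)) = _
      rw [(M.grSheaf c).germ_apply hs, FamilyGerm.map_mk]
      rfl)

end FilteredModule

theorem PeriodMap.isSec_smul_algebra (r : AddMonoidAlgebra ℂ L) {a : ∀ y, P.Amu y} {x : Circle}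
    (ha : P.AmuSheaf.IsSec a x) : P.AmuSheaf.IsSec (fun y => r • a y) x := by
  induction r using AddMonoidAlgebra.induction_linear with
  | zero => exact P.AmuSheaf.isSec_congr (Eventually.of_forall fun y => by simp []) (P.AmuSheaf.isSec_zero x)
  | add f g hf hg => exact P.AmuSheaf.isSec_congr (Eventually.of_forall fun y => by simp [add_smul]) (P.AmuSheaf.isSec_add hf hg)
  | single γ r =>
    have := P.isSec_mul (P.isSec_algebraMap r x) (P.isSec_mul (P.isSec_u γ x) ha)
    simpa only [P.single_smul, Algebra.smul_def] using this

namespace FilteredModule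

variable (M : FilteredModule P)

theorem isSec_grIncl {c : ℂ} {s : ∀ y, M.gr c y} {x : Circle} (hs : (M.grSheaf c).IsSec s x) :
    M.GrSheaf.IsSec (fun y => M.grIncl c y (s y)) x :=
  ⟨_, AddSubgroup.subset_closure ⟨c, s, hs, rfl⟩, Eventually.of_forall fun _ => rfl⟩

theorem isSec_smul_Gr (r : AddMonoidAlgebra ℂ L) {m : ∀ y, M.Gr y} {x : Circle}
    (hm : M.GrSheaf.IsSec m x) : M.GrSheaf.IsSec (fun y => r • m y) x := by
  induction r using AddMonoidAlgebra.induction_linear with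
  | zero => exact M.GrSheaf.isSec_congr (Eventually.of_forall fun y => by simp []) (M.GrSheaf.isSec_zero x)
  | add f g hf hg => exact M.GrSheaf.isSec_congr (Eventually.of_forall fun y => by simp [add_smul]) (M.GrSheaf.isSec_add hf hg)
  | single γ r =>
    obtain ⟨t, ht, hmt⟩ := hm
    suffices H : M.GrSheaf.IsSec
        (fun y => (AddMonoidAlgebra.single γ r : AddMonoidAlgebra ℂ L) • t y) x by
      refine M.GrSheaf.isSec_congr ?_ H
      filter_upwards [hmt] with y hy
      rw [hy]
    clear hmt
    induction ht using AddSubgroup.closure_induction with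
    | zero => exact M.GrSheaf.isSec_congr (Eventually.of_forall fun y => by simp []) (M.GrSheaf.isSec_zero x)
    | add a b _ _ ha hb => exact M.GrSheaf.isSec_congr (Eventually.of_forall fun y => by simp [smul_add]) (M.GrSheaf.isSec_add ha hb)
    | neg a _ ha => exact M.GrSheaf.isSec_congr (Eventually.of_forall fun y => by simp [smul_neg]) (M.GrSheaf.isSec_neg ha)
    | mem t ht =>
      obtain ⟨c, s, ⟨n, hn, hsn⟩, rfl⟩ := ht
      have h1 : (M.grSheaf (c + P.μ γ)).IsSec (fun y => r • M.grShift γ c y (s y)) x := by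
        refine ⟨fun y => algebraMap ℂ (P.Amu y) r • P.u y γ • n y,
          M.toModule.isSec_smul (P.isSec_algebraMap r x)
            (M.toModule.isSec_smul (P.isSec_u γ x) hn), ?_⟩
        filter_upwards [hsn] with y ⟨e1, e2⟩
        have e3 : P.u y γ • n y ∈ M.le (c + P.μ γ) y := (M.shift γ c y _).2 ⟨_, e1, rfl⟩
        refine ⟨?_, ?_⟩
        · rw [algebraMap_smul]; exact (M.le _ _).smul_mem r e3
        · rw [e2, grShift_mk]
          show M.grMk _ _ (r • _) = _
          exact congrArg _ (Subtype.ext (algebraMap_smul (P.Amu y) r (P.u y γ • n y)).symm)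
      have h2 := M.isSec_grIncl h1
      refine M.GrSheaf.isSec_congr (Eventually.of_forall fun y => ?_) h2
      simp only [single_smul_Gr, GrShift_grIncl, map_smul]

/-- The stalk at `x` of `𝒜_μ ⊗_{ℂ[L]} gr ℒ`. -/
abbrev tensStalk (x : Circle) : Type := P.Amu x ⊗[AddMonoidAlgebra ℂ L] M.Gr x

theorem tens_congr {a a' : ∀ y, P.Amu y} {m m' : ∀ y, M.Gr y} {x : Circle}
    (ha : P.AmuSheaf.IsSec a x) (ha' : P.AmuSheaf.IsSec a' x)
    (hm : M.GrSheaf.IsSec m x) (hm' : M.GrSheaf.IsSec m' x) (h : a x = a' x) (h' : m x = m' x) :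
    FamilyGerm.mk (F := M.tensStalk) x (fun y => a y ⊗ₜ m y) =
      FamilyGerm.mk x (fun y => a' y ⊗ₜ m' y) := by
  rw [FamilyGerm.mk_eq]
  filter_upwards [P.AmuSheaf.eventually_eq ha ha' h, M.GrSheaf.eventually_eq hm hm' h'] with y e1 e2
  rw [e1, e2]

/-- Auxiliary for `tensGerm`. -/
def tensGerm₁ (x : Circle) (a : P.Amu x) : M.Gr x →+ FamilyGerm M.tensStalk x :=
  AddMonoidHom.mk'
    (fun m => FamilyGerm.mk x (fun y => P.AmuSheaf.ext x a y ⊗ₜ M.GrSheaf.ext x m y))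
    (fun m n => by
      rw [← FamilyGerm.mk_add]
      refine (M.tens_congr (P.AmuSheaf.ext_isSec x a) (P.AmuSheaf.ext_isSec x a)
        (M.GrSheaf.ext_isSec x _)
        (M.GrSheaf.isSec_add (M.GrSheaf.ext_isSec x m) (M.GrSheaf.ext_isSec x n)) rfl
        (by simp [StalkSheaf.ext_self])).trans ?_
      congr 1
      funext y
      exact TensorProduct.tmul_add _ _ _)

theorem tensGerm₁_apply {x : Circle} {a : ∀ y, P.Amu y} {m : ∀ y, M.Gr y}
    (ha : P.AmuSheaf.IsSec a x) (hm : M.GrSheaf.IsSec m x) :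
    M.tensGerm₁ x (a x) (m x) = FamilyGerm.mk x (fun y => a y ⊗ₜ m y) :=
  M.tens_congr (P.AmuSheaf.ext_isSec x _) ha (M.GrSheaf.ext_isSec x _) hm
    (P.AmuSheaf.ext_self _ _) (M.GrSheaf.ext_self _ _)

/-- Auxiliary for `tensGerm`. -/
def tensGerm₂ (x : Circle) : P.Amu x →+ M.Gr x →+ FamilyGerm M.tensStalk x :=
  AddMonoidHom.mk' (M.tensGerm₁ x) (fun a b => by
    refine AddMonoidHom.ext fun m => ?_
    obtain ⟨s, hs, rfl⟩ := P.AmuSheaf.exists_isSec x a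
    obtain ⟨t, ht, rfl⟩ := P.AmuSheaf.exists_isSec x b
    obtain ⟨m, hm, rfl⟩ := M.GrSheaf.exists_isSec x m
    rw [AddMonoidHom.add_apply, M.tensGerm₁_apply hs hm, M.tensGerm₁_apply ht hm,
      ← Pi.add_apply, M.tensGerm₁_apply (P.AmuSheaf.isSec_add hs ht) hm, ← FamilyGerm.mk_add]
    congr 1
    funext y
    exact TensorProduct.add_tmul _ _ _)

/-- The germ of family `y ↦ ∑ a_i(y) ⊗ m_i(y)` defined by an element `∑ a_i ⊗ m_i` of the stalk. -/
def tensGerm (x : Circle) : M.tensStalk x →+ FamilyGerm M.tensStalk x :=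
  TensorProduct.liftAddHom (M.tensGerm₂ x) (fun r a m => by
    obtain ⟨s, hs, rfl⟩ := P.AmuSheaf.exists_isSec x a
    obtain ⟨m, hm, rfl⟩ := M.GrSheaf.exists_isSec x m
    show M.tensGerm₁ x (r • s x) (m x) = M.tensGerm₁ x (s x) (r • m x)
    refine (M.tensGerm₁_apply (P.isSec_smul_algebra r hs) hm).trans
      (Eq.trans ?_ (M.tensGerm₁_apply hs (M.isSec_smul_Gr r hm)).symm)
    congr 1
    funext y
    exact TensorProduct.smul_tmul _ _ _)

/-- The sheaf `𝒜_μ ⊗_{ℂ[L]} gr ℒ`: the sections are locally finite sums of `a ⊗ m` for sections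
`a` of `𝒜_μ` and `m` of `gr ℒ`. -/
def tensSheaf : StalkSheaf M.tensStalk :=
  StalkSheaf.generate
    (fun t x => ∃ (a : ∀ y, P.Amu y) (m : ∀ y, M.Gr y),
      P.AmuSheaf.IsSec a x ∧ M.GrSheaf.IsSec m x ∧ t = fun y => a y ⊗ₜ m y)
    (by
      rintro _ x ⟨a, m, ha, hm, rfl⟩
      filter_upwards [P.AmuSheaf.isSec_eventually ha, M.GrSheaf.isSec_eventually hm] with y h1 h2
      exact ⟨a, m, h1, h2, rfl⟩)
    (by
      intro x t
      induction t using TensorProduct.induction_on with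
      | zero => exact zero_mem _
      | add a b ha hb => exact add_mem ha hb
      | tmul a m =>
        obtain ⟨s, hs, rfl⟩ := P.AmuSheaf.exists_isSec x a
        obtain ⟨m, hm, rfl⟩ := M.GrSheaf.exists_isSec x m
        exact AddSubgroup.subset_closure ⟨_, ⟨s, m, hs, hm, rfl⟩, rfl⟩)
    (by
      intro x
      refine ⟨M.tensGerm x, ?_⟩
      rintro _ ⟨a, m, ha, hm, rfl⟩
      exact M.tensGerm₁_apply ha hm)

theorem isSec_tmul {a : ∀ y, P.Amu y} {m : ∀ y, M.Gr y} {x : Circle}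
    (ha : P.AmuSheaf.IsSec a x) (hm : M.GrSheaf.IsSec m x) :
    M.tensSheaf.IsSec (fun y => a y ⊗ₜ m y) x :=
  ⟨_, AddSubgroup.subset_closure ⟨a, m, ha, hm, rfl⟩, Eventually.of_forall fun _ => rfl⟩

/-- `𝒜_μ ⊗_{ℂ[L]} gr ℒ` as a sheaf of `𝒜_μ`-modules. -/
def tensModule : AmuModule P where
  stalk := M.tensStalk
  sheaf := M.tensSheaf
  isSec_smul := by
    rintro a s x ha ⟨t, ht, hst⟩
    suffices H : M.tensSheaf.IsSec (fun y => a y • t y) x by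
      refine M.tensSheaf.isSec_congr ?_ H
      filter_upwards [hst] with y hy
      rw [hy]
    clear hst
    induction ht using AddSubgroup.closure_induction with
    | zero => exact M.tensSheaf.isSec_congr (Eventually.of_forall fun y => by simp []) (M.tensSheaf.isSec_zero x)
    | add p q _ _ hp hq => exact M.tensSheaf.isSec_congr (Eventually.of_forall fun y => by simp [smul_add]) (M.tensSheaf.isSec_add hp hq)
    | neg p _ hp => exact M.tensSheaf.isSec_congr (Eventually.of_forall fun y => by simp [smul_neg]) (M.tensSheaf.isSec_neg hp)
    | mem t ht =>
      obtain ⟨b, m, hb, hm, rfl⟩ := ht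
      exact M.isSec_tmul (P.isSec_mul ha hb) hm

/-- The pure tensor `a ⊗ m`. -/
def tmul {x : Circle} (a : P.Amu x) (m : M.Gr x) : M.tensModule.stalk x :=
  (a ⊗ₜ[AddMonoidAlgebra ℂ L] m : M.tensStalk x)

theorem smul_tmul' {x : Circle} (a b : P.Amu x) (m : M.Gr x) :
    a • M.tmul b m = M.tmul (a * b) m := rfl

/-- The filtration `(𝒜_μ ⊗ gr ℒ)_{≤ c} = ∑_{c' + c'' ≤ c} 𝒜_μ^{≤ c'} ⊗ gr_{c''} ℒ`, stalkwise. -/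
def tensLE (c : ℂ) (x : Circle) : Submodule ℂ (M.tensModule.stalk x) :=
  Submodule.span ℂ {t | ∃ (c' c'' : ℂ) (a : P.Amu x) (m : M.gr c'' x),
    leAt x (c' + c'') c ∧ a ∈ P.AmuLE c' x ∧ t = M.tmul a (M.grIncl c'' x m)}

theorem tensLE_smul {c d : ℂ} {x : Circle} {a : P.Amu x} {t : M.tensModule.stalk x}
    (ha : a ∈ P.AmuLE d x) (ht : t ∈ M.tensLE c x) : a • t ∈ M.tensLE (c + d) x := by
  unfold tensLE at ht
  induction ht using Submodule.span_induction with
  | zero => rw [smul_zero]; exact zero_mem _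
  | add p q _ _ hp hq => rw [smul_add]; exact add_mem hp hq
  | smul r p _ hp => rw [smul_comm]; exact Submodule.smul_mem _ r hp
  | mem t ht =>
    obtain ⟨c', c'', b, m, hc, hb, rfl⟩ := ht
    refine Submodule.subset_span ⟨d + c', c'', a * b, m, ?_, P.AmuLE_mul ha hb, rfl⟩
    have : d + c' + c'' = c' + c'' + d := by ring
    rw [this]
    exact PeriodMap.leAt_add hc (leAt_refl x d)

/-- The filtered module `𝒜_μ ⊗_{ℂ[L]} gr ℒ`. -/
def tens : FilteredModule P where
  toModule := M.tensModule
  le := M.tensLE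
  le_eventually := by
    intro c s x hs h
    suffices H : ∀ m ∈ M.tensLE c x, ∃ t : ∀ y, M.tensModule.stalk y, M.tensModule.sheaf.IsSec t x ∧
        t x = m ∧ ∀ᶠ y in 𝓝 x, t y ∈ M.tensLE c y by
      obtain ⟨t, ht, htx, h2⟩ := H _ h
      filter_upwards [h2, M.tensModule.sheaf.eventually_eq ht hs htx] with y h3 h4
      rwa [← h4]
    intro m hm
    unfold tensLE at hm
    induction hm using Submodule.span_induction with
    | zero => exact ⟨0, M.tensSheaf.isSec_zero x, rfl, Eventually.of_forall fun y => zero_mem _⟩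
    | add p q _ _ hp hq =>
      obtain ⟨s, hs, rfl, h1⟩ := hp
      obtain ⟨t, ht, rfl, h2⟩ := hq
      refine ⟨s + t, M.tensModule.sheaf.isSec_add hs ht, rfl, ?_⟩
      filter_upwards [h1, h2] with y e1 e2 using add_mem e1 e2
    | smul r p _ hp =>
      obtain ⟨s, hs, rfl, h1⟩ := hp
      refine ⟨fun y => algebraMap ℂ (P.Amu y) r • s y,
        M.tensModule.isSec_smul (P.isSec_algebraMap r x) hs, rfl, ?_⟩
      filter_upwards [h1] with y e1
      rw [algebraMap_smul]
      exact Submodule.smul_mem _ r e1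
    | mem t ht =>
      obtain ⟨c', c'', a, m, hc, ha, rfl⟩ := ht
      obtain ⟨b, hb, rfl⟩ := P.AmuSheaf.exists_isSec x a
      obtain ⟨n, hn, rfl⟩ := (M.grSheaf c'').exists_isSec x m
      refine ⟨fun y => M.tmul (b y) (M.grIncl c'' y (n y)), M.isSec_tmul hb (M.isSec_grIncl hn), rfl, ?_⟩
      filter_upwards [leAt_eventually hc, P.AmuLE_eventually hb ha] with y e1 e2
      exact Submodule.subset_span ⟨c', c'', _, _, e1, e2, rfl⟩
  smul_mem := fun {c x a m} ha hm => by
    have := M.tensLE_smul ha hm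
    rwa [add_zero] at this
  mono := fun {c c' x} h => by
    refine Submodule.span_mono ?_
    rintro _ ⟨d, d', a, m, hc, ha, rfl⟩
    exact ⟨d, d', a, m, leAt_trans hc h, ha, rfl⟩
  shift := fun γ c x m => by
    constructor
    · intro hm
      refine ⟨P.u x (-γ) • m, ?_, ?_⟩
      · have := M.tensLE_smul (P.u_mem x (-γ)) hm
        rwa [map_neg, add_neg_cancel_right] at this
      · rw [smul_smul, ← P.u_add, add_neg_cancel, P.u_zero, one_smul]
    · rintro ⟨m', hm', rfl⟩
      exact M.tensLE_smul (P.u_mem x γ) hm'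

end FilteredModule

end betti

/-! ### Nonabelian cohomology -/

section H1

variable {X : Type} [TopologicalSpace X] (𝒢 : (Opens X)ᵒᵖ ⥤ GrpCat.{0})

/-- A Čech 1-cocycle with values in `𝒢`, on some open cover of `X`. -/
structure CechCocycle where
  ι : Type
  U : ι → Opens X
  cover : ∀ x, ∃ i, x ∈ U i
  cocycle : PresheafOfGroups.OneCocycle 𝒢 U

variable {𝒢}

/-- Restriction of a cocycle along a refinement `W k ≤ U (a k)`. -/
def refineCocycle {ι κ : Type} {U : ι → Opens X} (g : PresheafOfGroups.OneCocycle 𝒢 U)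
    {W : κ → Opens X} (a : κ → ι) (h : ∀ k, W k ≤ U (a k)) :
    PresheafOfGroups.OneCocycle 𝒢 W where
  ev k l _ p q := g.ev (a k) (a l) (p ≫ homOfLE (h k)) (q ≫ homOfLE (h l))
  ev_precomp k l _ _ φ p q := by simp
  ev_trans k l m _ p q r := g.ev_trans _ _ _ _ _ _

/-- Two cocycles on open covers are cohomologous if they become so, through an explicit 0-cochain,
on a common refinement of the covers. -/
def CechCocycle.Cohomologous (c d : CechCocycle 𝒢) : Prop :=
  ∃ (κ : Type) (W : κ → Opens X) (a : κ → c.ι) (b : κ → d.ι)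
    (ha : ∀ k, W k ≤ c.U (a k)) (hb : ∀ k, W k ≤ d.U (b k)),
    (∀ x, ∃ k, x ∈ W k) ∧
    (refineCocycle c.cocycle a ha).IsCohomologous (refineCocycle d.cocycle b hb)

theorem CechCocycle.cohomologous_equivalence :
    _root_.Equivalence (CechCocycle.Cohomologous (𝒢 := 𝒢)) where
  refl c := ⟨c.ι, c.U, id, id, fun _ => le_rfl, fun _ => le_rfl, c.cover,
    (PresheafOfGroups.OneCocycle.equivalence_isCohomologous 𝒢 c.U).refl _⟩
  symm := by
    rintro c d ⟨κ, W, a, b, ha, hb, hW, h⟩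
    exact ⟨κ, W, b, a, hb, ha, hW,
      (PresheafOfGroups.OneCocycle.equivalence_isCohomologous 𝒢 W).symm h⟩
  trans := by
    rintro c d e ⟨κ, W, a, b, ha, hb, hW, α, h⟩ ⟨κ', W', b', f, hb', hf, hW', β, h'⟩
    let V : κ × κ' → Opens X := fun p => W p.1 ⊓ W' p.2
    refine ⟨κ × κ', V, fun p => a p.1, fun p => f p.2, fun p => inf_le_left.trans (ha _),
      fun p => inf_le_right.trans (hf _), ?_, ?_⟩
    · intro x
      obtain ⟨k, hk⟩ := hW x
      obtain ⟨l, hl⟩ := hW' x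
      exact ⟨(k, l), hk, hl⟩
    · let i1 : ∀ p, V p ⟶ W p.1 := fun p => homOfLE inf_le_left
      let i2 : ∀ p, V p ⟶ W' p.2 := fun p => homOfLE inf_le_right
      refine ⟨fun p => 𝒢.map (i2 p).op (β p.2) *
        d.cocycle.ev (b' p.2) (b p.1) (i2 p ≫ homOfLE (hb' _)) (i1 p ≫ homOfLE (hb _)) *
        𝒢.map (i1 p).op (α p.1), ?_⟩
      intro p q T s t
      have e1 := h p.1 q.1 (s ≫ i1 p) (t ≫ i1 q)
      have e2 := h' p.2 q.2 (s ≫ i2 p) (t ≫ i2 q)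
      have e3 := d.cocycle.ev_trans (b' p.2) (b p.1) (b q.1)
        (s ≫ i2 p ≫ homOfLE (hb' _)) (s ≫ i1 p ≫ homOfLE (hb _)) (t ≫ i1 q ≫ homOfLE (hb _))
      have e4 := d.cocycle.ev_trans (b' p.2) (b' q.2) (b q.1)
        (s ≫ i2 p ≫ homOfLE (hb' _)) (t ≫ i2 q ≫ homOfLE (hb' _)) (t ≫ i1 q ≫ homOfLE (hb _))
      simp only [refineCocycle, op_comp, Functor.map_comp, GrpCat.comp_apply, Category.assoc] at e1 e2
      simp only [map_mul, PresheafOfGroups.OneCochain.ev_precomp]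
      simp only [mul_assoc]
      have e1' : (𝒢.map s.op) ((𝒢.map (i1 p).op) (α p.1)) *
          c.cocycle.ev (a p.1) (a q.1) (s ≫ homOfLE (inf_le_left.trans (ha _)))
            (t ≫ homOfLE (inf_le_left.trans (ha _))) = _ := e1
      have e2' : (𝒢.map s.op) ((𝒢.map (i2 p).op) (β p.2)) *
          d.cocycle.ev (b' p.2) (b' q.2) (s ≫ i2 p ≫ homOfLE (hb' _)) (t ≫ i2 q ≫ homOfLE (hb' _)) =
          e.cocycle.ev (f p.2) (f q.2) (s ≫ homOfLE (inf_le_right.trans (hf _)))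
            (t ≫ homOfLE (inf_le_right.trans (hf _))) *
            (𝒢.map t.op) ((𝒢.map (i2 q).op) (β q.2)) := e2
      show _ * (_ * (_ * c.cocycle.ev (a p.1) (a q.1) (s ≫ homOfLE (inf_le_left.trans (ha _)))
            (t ≫ homOfLE (inf_le_left.trans (ha _))))) = e.cocycle.ev (f p.2) (f q.2) (s ≫ homOfLE (inf_le_right.trans (hf _)))
            (t ≫ homOfLE (inf_le_right.trans (hf _))) * _
      rw [e1', ← mul_assoc (d.cocycle.ev _ _ _ _), e3, ← e4]
      simp only [← mul_assoc]
      rw [e2']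

variable (𝒢)

instance CechCocycle.setoid : Setoid (CechCocycle 𝒢) :=
  ⟨CechCocycle.Cohomologous, CechCocycle.cohomologous_equivalence⟩

/-- The first (nonabelian) cohomology set of a sheaf of groups: the colimit over the open covers of
the Čech cohomology sets in degree 1. -/
def CechH1 : Type 1 := Quotient (CechCocycle.setoid 𝒢)

variable {𝒢}

/-- The cohomology class of a cocycle. -/
def CechCocycle.class (c : CechCocycle 𝒢) : CechH1 𝒢 := Quotient.mk _ c

end H1

section betti2

variable {L : Type} [AddCommGroup L] [Module.Finite ℤ L] {P : PeriodMap L}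


/-- A family of `𝒜_μ`-linear maps between the stalks is a morphism of sheaves over `U` if it maps
local sections to local sections. -/
def IsMorphism {U : Opens Circle} {M N : FilteredModule P}
    (φ : ∀ x : U, M.stalk x →ₗ[P.Amu x] N.stalk x) : Prop :=
  ∀ (x : U) (s : ∀ y, M.stalk y) (t : ∀ y, N.stalk y), M.sheaf.IsSec s x →
    (∀ᶠ y in 𝓝 (x : Circle), ∀ hy : y ∈ U, t y = φ ⟨y, hy⟩ (s y)) → N.sheaf.IsSec t x

/-- Isomorphisms of filtered `𝒜_μ`-modules over the open set `U`. -/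
structure FilteredIso (U : Opens Circle) (M N : FilteredModule P) where
  equiv : ∀ x : U, M.stalk x ≃ₗ[P.Amu x] N.stalk x
  isMorphism : IsMorphism fun x => (equiv x).toLinearMap
  isMorphism_symm : IsMorphism fun x => (equiv x).symm.toLinearMap
  mem_le : ∀ (x : U) (c : ℂ) (m : M.stalk x), equiv x m ∈ N.le c x ↔ m ∈ M.le c x

namespace FilteredIso

variable {U : Opens Circle} {M N K : FilteredModule P}

/-- The identity. -/
def refl (U : Opens Circle) (M : FilteredModule P) : FilteredIso U M M where
  equiv x := LinearEquiv.refl _ _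
  isMorphism x s t hs h := by
    refine M.sheaf.isSec_congr ?_ hs
    filter_upwards [h, U.isOpen.mem_nhds x.2] with y h1 h2 using (h1 h2).symm
  isMorphism_symm x s t hs h := by
    refine M.sheaf.isSec_congr ?_ hs
    filter_upwards [h, U.isOpen.mem_nhds x.2] with y h1 h2 using (h1 h2).symm
  mem_le _ _ _ := Iff.rfl

/-- The inverse of an isomorphism. -/
def symm (e : FilteredIso U M N) : FilteredIso U N M where
  equiv x := (e.equiv x).symm
  isMorphism := e.isMorphism_symm
  isMorphism_symm := e.isMorphism
  mem_le x c m := by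
    rw [← e.mem_le, LinearEquiv.apply_symm_apply]

theorem isMorphism_comp {φ : ∀ x : U, M.stalk x →ₗ[P.Amu x] N.stalk x}
    {ψ : ∀ x : U, N.stalk x →ₗ[P.Amu x] K.stalk x} (hφ : IsMorphism φ) (hψ : IsMorphism ψ) :
    IsMorphism fun x => (ψ x).comp (φ x) := by
  classical
  intro x s t hs h
  refine hψ x (fun y => if hy : y ∈ U then φ ⟨y, hy⟩ (s y) else 0) t
    (hφ x s _ hs (Eventually.of_forall fun y hy => dif_pos hy)) ?_
  filter_upwards [h] with y h1 hy
  rw [h1 hy, dif_pos hy]; rfl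

/-- The composition of isomorphisms. -/
def trans (e : FilteredIso U M N) (f : FilteredIso U N K) : FilteredIso U M K where
  equiv x := (e.equiv x).trans (f.equiv x)
  isMorphism := isMorphism_comp e.isMorphism f.isMorphism
  isMorphism_symm := isMorphism_comp f.isMorphism_symm e.isMorphism_symm
  mem_le x c m := by
    rw [LinearEquiv.trans_apply, f.mem_le, e.mem_le]

theorem mem_lt (e : FilteredIso U M N) {x : U} {c : ℂ} {m : M.stalk x} (hm : m ∈ M.lt c x) :
    e.equiv x m ∈ N.lt c x := by
  have : M.lt c x ≤ (N.lt c x).comap ((e.equiv x).toLinearMap.restrictScalars ℂ) :=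
    iSup₂_le fun c' hc' n hn => N.le_le_lt hc' ((e.mem_le x c' n).2 hn)
  exact this hm

/-- The map `gr_c` induced by a filtered isomorphism. -/
def gr (e : FilteredIso U M N) (x : U) (c : ℂ) : M.gr c x →ₗ[ℂ] N.gr c x :=
  Submodule.mapQ _ _
    (((e.equiv x).toLinearMap.restrictScalars ℂ).restrict fun m hm => (e.mem_le x c m).2 hm)
    (fun _ hm => e.mem_lt hm)

theorem gr_grMk (e : FilteredIso U M N) (x : U) (c : ℂ) (m : M.le c x) :
    e.gr x c (M.grMk c x m) = N.grMk c x ⟨e.equiv x m, (e.mem_le x c m).2 m.2⟩ := rfl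

theorem gr_refl (x : U) (c : ℂ) (m : M.gr c x) : (refl U M).gr x c m = m := by
  obtain ⟨m, rfl⟩ := Submodule.Quotient.mk_surjective _ m
  rfl

theorem gr_trans (e : FilteredIso U M N) (f : FilteredIso U N K) (x : U) (c : ℂ) (m : M.gr c x) :
    (e.trans f).gr x c m = f.gr x c (e.gr x c m) := by
  obtain ⟨m, rfl⟩ := Submodule.Quotient.mk_surjective _ m
  rfl

theorem gr_gr_symm (e : FilteredIso U M N) (x : U) (c : ℂ) (m : N.gr c x) :
    e.gr x c (e.symm.gr x c m) = m := by
  obtain ⟨m, rfl⟩ := Submodule.Quotient.mk_surjective _ m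
  show N.grMk c x ⟨e.equiv x ((e.equiv x).symm m), _⟩ = N.grMk c x m
  congr 1
  exact Subtype.ext (LinearEquiv.apply_symm_apply _ _)

end FilteredIso

namespace FilteredModule

variable (M : FilteredModule P)

theorem unitTensor_mem (c : ℂ) (x : Circle) (m : M.gr c x) :
    M.tmul 1 (M.grIncl c x m) ∈ M.tensLE c x :=
  Submodule.subset_span
    ⟨0, c, 1, m, by rw [zero_add]; exact leAt_refl x c,
      by simpa [P.u_zero] using P.u_mem x 0, rfl⟩

/-- The element `1 ⊗ m` of `(𝒜_μ ⊗ gr ℒ)_{≤ c}`, for `m` in `gr_c ℒ`. -/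
def unitTensor (c : ℂ) (x : Circle) (m : M.gr c x) : M.tens.le c x :=
  ⟨M.tmul 1 (M.grIncl c x m), M.unitTensor_mem c x m⟩

/-- The canonical map `gr_c ℒ → gr_c (𝒜_μ ⊗ gr ℒ)`, sending `m` to the class of `1 ⊗ m`. -/
def grUnit (c : ℂ) (x : Circle) (m : M.gr c x) : M.tens.gr c x :=
  M.tens.grMk c x (M.unitTensor c x m)

variable {M} in
/-- `gr(η) = id` for a filtered isomorphism `η : 𝒜_μ ⊗ gr ℒ ≅ ℒ` over `U`, under the canonical
identification of `gr_c ℒ` with `gr_c (𝒜_μ ⊗ gr ℒ)`. -/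
def IsSplitting {U : Opens Circle} (η : FilteredIso U M.tens M) : Prop :=
  ∀ (x : U) (c : ℂ) (m : M.gr c x), η.gr x c (M.grUnit c x m) = m

/-- `gr_c ℒ` is a local system of (finite dimensional) complex vector spaces: it is locally
isomorphic to a constant sheaf `ℂ^n`. -/
def GrIsLocalSystem (c : ℂ) : Prop :=
  ∀ x : Circle, ∃ (n : ℕ) (φ : ∀ y, (Fin n → ℂ) →ₗ[ℂ] M.gr c y), ∀ᶠ y in 𝓝 x,
    Function.Bijective (φ y) ∧ ∀ v, (M.grSheaf c).IsSec (fun y' => φ y' v) y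

/-- The objects of the category `Be_{C,μ}`. -/
structure IsBetti (C : Finset ℂ) : Prop where
  isLocalSystem : ∀ c, M.GrIsLocalSystem c
  exponents : ∀ c x, Nontrivial (M.gr c x) → ∃ k ∈ C, ∃ γ : L, c = -k + P.μ γ
  splitting : ∀ x : Circle, ∃ U : Opens Circle, x ∈ U ∧
    ∃ η : FilteredIso U M.tens M, IsSplitting η

/-- `𝒢` is graded: it is isomorphic to `𝒜_μ ⊗ gr 𝒢` as a filtered `𝒜_μ`-module. -/
def IsGraded : Prop := Nonempty (FilteredIso ⊤ M M.tens)

/-! ### The sheaf of groups -/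

/-- Families over `U` of `𝒜_μ`-linear endomorphisms of the stalks. -/
abbrev EndFamily (U : Opens Circle) : Type := ∀ x : U, Module.End (P.Amu x) (M.stalk x)

/-- The sections over `U` of `ℋom(ℒ, ℒ)_{≤ c}`: the endomorphisms of the sheaf of `𝒜_μ`-modules `ℒ`
over `U` which map `ℒ_{≤ b}` to `ℒ_{≤ b + c}` for all `b`. -/
def endLE (U : Opens Circle) (c : ℂ) : AddSubgroup (M.EndFamily U) where
  carrier := {φ | IsMorphism φ ∧ ∀ (x : U) (b : ℂ) (m : M.stalk x), m ∈ M.le b x → φ x m ∈ M.le (b + c) x}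
  add_mem' := by
    classical
    rintro φ ψ ⟨h1, h2⟩ ⟨h1', h2'⟩
    refine ⟨fun x s t hs h => ?_, fun x b m hm => add_mem (h2 x b m hm) (h2' x b m hm)⟩
    have e1 := h1 x s (fun y => if hy : y ∈ U then φ ⟨y, hy⟩ (s y) else 0) hs
      (Eventually.of_forall fun y hy => dif_pos hy)
    have e2 := h1' x s (fun y => if hy : y ∈ U then ψ ⟨y, hy⟩ (s y) else 0) hs
      (Eventually.of_forall fun y hy => dif_pos hy)
    refine M.sheaf.isSec_congr ?_ (M.sheaf.isSec_add e1 e2)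
    filter_upwards [h, U.isOpen.mem_nhds x.2] with y h3 hy
    rw [h3 hy, Pi.add_apply, dif_pos (show y ∈ U from hy), dif_pos (show y ∈ U from hy)]; rfl
  zero_mem' := by
    refine ⟨fun x s t hs h => ?_, fun x b m hm => zero_mem _⟩
    refine M.sheaf.isSec_congr ?_ (M.sheaf.isSec_zero x)
    filter_upwards [h, U.isOpen.mem_nhds x.2] with y h3 hy
    rw [h3 hy]; rfl
  neg_mem' := by
    classical
    rintro φ ⟨h1, h2⟩
    refine ⟨fun x s t hs h => ?_, fun x b m hm => neg_mem (h2 x b m hm)⟩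
    have e1 := h1 x s (fun y => if hy : y ∈ U then φ ⟨y, hy⟩ (s y) else 0) hs
      (Eventually.of_forall fun y hy => dif_pos hy)
    refine M.sheaf.isSec_congr ?_ (M.sheaf.isSec_neg e1)
    filter_upwards [h, U.isOpen.mem_nhds x.2] with y h3 hy
    rw [h3 hy, Pi.neg_apply, dif_pos (show y ∈ U from hy)]; rfl

variable {M}

/-- Restriction to a smaller open set. -/
def EndFamily.res {U V : Opens Circle} (h : V ≤ U) : M.EndFamily U →+* M.EndFamily V :=
  RingHom.pi fun x => Pi.evalRingHom _ (⟨x, h x.2⟩ : U)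

/-- The sections over `U` of `ℰnd^{<0}(ℒ) = ℋom(ℒ, ℒ)_{<0}`: the germ at every `x ∈ U` lies in the
sum of the stalks of `ℋom(ℒ, ℒ)_{≤ c}` over the `c <_θ 0`. -/
def EndLTZero {U : Opens Circle} (φ : M.EndFamily U) : Prop :=
  ∀ x : U, ∃ (V : Opens Circle) (h : V ≤ U), (x : Circle) ∈ V ∧
    EndFamily.res h φ ∈ ⨆ (c : ℂ) (_ : ltAt x c 0), M.endLE V c

theorem res_mem_endLE {U V : Opens Circle} (h : V ≤ U) {φ : M.EndFamily U} {c : ℂ}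
    (hφ : φ ∈ M.endLE U c) : EndFamily.res h φ ∈ M.endLE V c := by
  refine ⟨fun x s t hs ht => hφ.1 ⟨x, h x.2⟩ s t hs ?_, fun x b m hm => hφ.2 ⟨x, h x.2⟩ b m hm⟩
  filter_upwards [ht, V.isOpen.mem_nhds x.2] with y h1 h2 hy using h1 h2

theorem endLE_mono {U : Opens Circle} {c c' : ℂ} (h : ∀ x ∈ U, leAt x c c') :
    M.endLE U c ≤ M.endLE U c' := fun _ hφ =>
  ⟨hφ.1, fun x b m hm => M.mono (PeriodMap.leAt_add (leAt_refl _ b) (h x x.2)) (hφ.2 x b m hm)⟩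

theorem endLE_mul {U : Opens Circle} {c c' : ℂ} {φ ψ : M.EndFamily U} (hφ : φ ∈ M.endLE U c)
    (hψ : ψ ∈ M.endLE U c') : φ * ψ ∈ M.endLE U (c + c') :=
  ⟨FilteredIso.isMorphism_comp hψ.1 hφ.1, fun x b m hm => by
    have := hφ.2 x _ _ (hψ.2 x b m hm)
    rw [add_assoc, add_comm c' c] at this
    exact this⟩

theorem exists_ltAt_between (x : Circle) (c c' : ℂ) (h : ltAt x c 0) (h' : ltAt x c' 0) :
    ∃ d, ltAt x c d ∧ ltAt x c' d ∧ ltAt x d 0 := by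
  unfold ltAt at *
  rw [sub_zero] at h h'
  set r := max ((x : ℂ)⁻¹ * c).re ((x : ℂ)⁻¹ * c').re / 2 with hr
  have hx : (x : ℂ) ≠ 0 := Circle.coe_ne_zero x
  have hd : (x : ℂ)⁻¹ * (x * (r : ℂ)) = (r : ℂ) := by field_simp
  have hm : max ((x : ℂ)⁻¹ * c).re ((x : ℂ)⁻¹ * c').re < 0 := max_lt h h'
  have h1 := le_max_left ((x : ℂ)⁻¹ * c).re ((x : ℂ)⁻¹ * c').re
  have h2 := le_max_right ((x : ℂ)⁻¹ * c).re ((x : ℂ)⁻¹ * c').re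
  refine ⟨x * (r : ℂ), ?_, ?_, ?_⟩
  · rw [mul_sub, hd, Complex.sub_re, Complex.ofReal_re]; linarith
  · rw [mul_sub, hd, Complex.sub_re, Complex.ofReal_re]; linarith
  · rw [sub_zero, hd, Complex.ofReal_re]; linarith

/-- germ of a section of `ℰnd^{<0}` is in `ℰnd_{≤ c}` for one `c < 0`. -/
theorem endLTZero_iff {U : Opens Circle} {φ : M.EndFamily U} :
    EndLTZero φ ↔ ∀ x : U, ∃ c, ltAt x c 0 ∧ ∃ (V : Opens Circle) (h : V ≤ U), (x : Circle) ∈ V ∧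
      EndFamily.res h φ ∈ M.endLE V c := by
  constructor
  · intro H x
    obtain ⟨V, hV, hx, hm⟩ := H x
    suffices G : ∀ ψ ∈ ⨆ (c : ℂ) (_ : ltAt x c 0), M.endLE V c, ∃ c, ltAt x c 0 ∧
        ∃ (W : Opens Circle) (h : W ≤ V), (x : Circle) ∈ W ∧ EndFamily.res h ψ ∈ M.endLE W c by
      obtain ⟨c, hc, W, hW, hxW, h⟩ := G _ hm
      exact ⟨c, hc, W, hW.trans hV, hxW, h⟩
    intro ψ hψ
    rw [iSup_subtype'] at hψ
    induction hψ using AddSubgroup.iSup_induction' with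
    | hp c ψ hψ => exact ⟨c, c.2, V, le_rfl, hx, hψ⟩
    | h1 =>
      exact ⟨-x, by unfold ltAt; rw [sub_zero, mul_neg, inv_mul_cancel₀ (Circle.coe_ne_zero _)]; simp,
        V, le_rfl, hx, zero_mem _⟩
    | hadd φ ψ _ _ h1 h2 =>
      obtain ⟨c, hc, W, hW, hxW, h1⟩ := h1
      obtain ⟨c', hc', W', hW', hxW', h2⟩ := h2
      obtain ⟨d, hd, hd', hd0⟩ := exists_ltAt_between _ _ _ hc hc'
      obtain ⟨T, hT, hTo, hxT⟩ := mem_nhds_iff.1 ((ltAt_eventually hd).and (ltAt_eventually hd'))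
      let T' : Opens Circle := ⟨T, hTo⟩
      have k1 : W ⊓ W' ⊓ T' ≤ W := inf_le_left.trans inf_le_left
      have k2 : W ⊓ W' ⊓ T' ≤ W' := inf_le_left.trans inf_le_right
      refine ⟨d, hd0, W ⊓ W' ⊓ T', k1.trans hW, ⟨⟨hxW, hxW'⟩, hxT⟩, ?_⟩
      rw [map_add]
      exact add_mem (endLE_mono (fun y (hy : y ∈ W ⊓ W' ⊓ T') => Or.inl (hT hy.2).1) (res_mem_endLE k1 h1))
        (endLE_mono (fun y (hy : y ∈ W ⊓ W' ⊓ T') => Or.inl (hT hy.2).2) (res_mem_endLE k2 h2))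
  · intro H x
    obtain ⟨c, hc, V, hV, hx, h⟩ := H x
    exact ⟨V, hV, hx, (le_iSup₂ (f := fun (c : ℂ) (_ : ltAt x c 0) => M.endLE V c) c hc) h⟩

theorem EndLTZero.res {U V : Opens Circle} (h : V ≤ U) {φ : M.EndFamily U} (hφ : EndLTZero φ) :
    EndLTZero (EndFamily.res h φ) := by
  rw [endLTZero_iff] at hφ ⊢
  intro x
  obtain ⟨c, hc, W, hW, hx, h1⟩ := hφ ⟨x, h x.2⟩
  exact ⟨c, hc, W ⊓ V, inf_le_right, ⟨hx, x.2⟩, res_mem_endLE (inf_le_left (a := W) (b := V)) h1⟩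

theorem EndLTZero.zero {U : Opens Circle} : EndLTZero (0 : M.EndFamily U) := fun x =>
  ⟨U, le_rfl, x.2, by rw [map_zero]; exact zero_mem _⟩

theorem EndLTZero.add {U : Opens Circle} {φ ψ : M.EndFamily U} (hφ : EndLTZero φ)
    (hψ : EndLTZero ψ) : EndLTZero (φ + ψ) := by
  rw [endLTZero_iff] at hφ hψ ⊢
  intro x
  obtain ⟨c, hc, W, hW, hxW, h1⟩ := hφ x
  obtain ⟨c', hc', W', hW', hxW', h2⟩ := hψ x
  obtain ⟨d, hd, hd', hd0⟩ := exists_ltAt_between _ _ _ hc hc'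
  obtain ⟨T, hT, hTo, hxT⟩ := mem_nhds_iff.1 ((ltAt_eventually hd).and (ltAt_eventually hd'))
  let T' : Opens Circle := ⟨T, hTo⟩
  have k1 : W ⊓ W' ⊓ T' ≤ W := inf_le_left.trans inf_le_left
  have k2 : W ⊓ W' ⊓ T' ≤ W' := inf_le_left.trans inf_le_right
  refine ⟨d, hd0, W ⊓ W' ⊓ T', k1.trans hW, ⟨⟨hxW, hxW'⟩, hxT⟩, ?_⟩
  rw [map_add]
  exact add_mem (endLE_mono (fun y (hy : y ∈ W ⊓ W' ⊓ T') => Or.inl (hT hy.2).1) (res_mem_endLE k1 h1))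
    (endLE_mono (fun y (hy : y ∈ W ⊓ W' ⊓ T') => Or.inl (hT hy.2).2) (res_mem_endLE k2 h2))

theorem EndLTZero.mul {U : Opens Circle} {φ ψ : M.EndFamily U} (hφ : EndLTZero φ)
    (hψ : EndLTZero ψ) : EndLTZero (φ * ψ) := by
  rw [endLTZero_iff] at hφ hψ ⊢
  intro x
  obtain ⟨c, hc, W, hW, hxW, h1⟩ := hφ x
  obtain ⟨c', hc', W', hW', hxW', h2⟩ := hψ x
  have k1 : W ⊓ W' ≤ W := inf_le_left
  have k2 : W ⊓ W' ≤ W' := inf_le_right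
  refine ⟨c + c', ?_, W ⊓ W', k1.trans hW, ⟨hxW, hxW'⟩, ?_⟩
  · unfold ltAt at *
    rw [sub_zero] at *
    rw [mul_add, Complex.add_re]; linarith
  · rw [map_mul]
    exact endLE_mul (res_mem_endLE k1 h1) (res_mem_endLE k2 h2)

variable (M)

/-- Families over `U` of `𝒜_μ`-linear automorphisms of the stalks. -/
abbrev AutFamily (U : Opens Circle) : Type := ∀ x : U, M.stalk x ≃ₗ[P.Amu x] M.stalk x

variable {M} in
/-- An automorphism as an endomorphism. -/
def AutFamily.toEnd {U : Opens Circle} : M.AutFamily U →* M.EndFamily U where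
  toFun g x := (g x).toLinearMap
  map_one' := rfl
  map_mul' _ _ := rfl

/-- The sections over `U` of the sheaf of groups `𝒜ut^{<0}(ℒ) = id + ℰnd^{<0}(ℒ)`, written as the
group of units of the monoid `id + ℰnd^{<0}(ℒ)`. For `ℒ` in `Be_{C,μ}` all its elements are units. -/
def autLTZero (U : Opens Circle) : Subgroup (M.AutFamily U) where
  carrier := {g | EndLTZero (AutFamily.toEnd g - 1) ∧ EndLTZero (AutFamily.toEnd g⁻¹ - 1)}
  one_mem' := by
    refine ⟨?_, ?_⟩ <;> simpa using EndLTZero.zero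
  mul_mem' := by
    have key : ∀ g h : M.EndFamily U, EndLTZero (g - 1) → EndLTZero (h - 1) →
        EndLTZero (g * h - 1) := fun g h hg hh => by
      have : g * h - 1 = (g - 1) * (h - 1) + ((g - 1) + (h - 1)) := by noncomm_ring
      rw [this]
      exact (hg.mul hh).add (hg.add hh)
    rintro g h ⟨h1, h2⟩ ⟨h1', h2'⟩
    refine ⟨?_, ?_⟩
    · rw [map_mul]; exact key _ _ h1 h1'
    · rw [mul_inv_rev, map_mul]; exact key _ _ h2' h2
  inv_mem' := by
    rintro g ⟨h1, h2⟩
    exact ⟨h2, by rwa [inv_inv]⟩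

/-- Restriction of sections. -/
def autRes {U V : Opens Circle} (h : V ≤ U) : M.autLTZero U →* M.autLTZero V where
  toFun g := ⟨fun x => g.1 ⟨x, h x.2⟩, g.2.1.res h, g.2.2.res h⟩
  map_one' := rfl
  map_mul' _ _ := rfl

/-- The sheaf of groups `𝒜ut^{<0}(ℒ)`. -/
def autSheaf : (Opens Circle)ᵒᵖ ⥤ GrpCat.{0} where
  obj U := GrpCat.of (M.autLTZero U.unop)
  map f := GrpCat.ofHom (M.autRes f.unop.le)
  map_id _ := rfl
  map_comp _ _ := rfl

variable {M} in
/-- The automorphism of the stalk at `x` defined by a section of `𝒜ut^{<0}(ℒ)`. -/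
def autEval {U : Opens Circle} (g : M.autSheaf.obj (Opposite.op U)) (x : U) :
    M.stalk x ≃ₗ[P.Amu x] M.stalk x :=
  (show M.autLTZero U from g).1 x

end FilteredModule

/-! ### pairs -/

/-- Pairs `(ℒ, ξ)` of an object `ℒ` of `Be_{C,μ}` and an isomorphism `ξ : 𝒜_μ ⊗ gr ℒ ≅ 𝒢` of
filtered `𝒜_μ`-modules. -/
structure GradedPair (C : Finset ℂ) (G : FilteredModule P) where
  obj : FilteredModule P
  isBetti : obj.IsBetti C
  ξ : FilteredIso ⊤ obj.tens G

namespace GradedPair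

variable {C : Finset ℂ} {G : FilteredModule P}

/-- `(ℒ, ξ) ≅ (ℒ', ξ')`: there is a filtered isomorphism `f : ℒ ≅ ℒ'` with
`ξ' ∘ (id ⊗ gr f) = ξ`, an equality which it is enough to write on the `1 ⊗ m` with `m` in
`gr_c ℒ` since these generate `𝒜_μ ⊗ gr ℒ`. -/
def Isomorphic (p q : GradedPair C G) : Prop :=
  ∃ f : FilteredIso ⊤ p.obj q.obj, ∀ (x : (⊤ : Opens Circle)) (c : ℂ) (m : p.obj.gr c x),
    q.ξ.equiv x (q.obj.unitTensor c x (f.gr x c m)) = p.ξ.equiv x (p.obj.unitTensor c x m)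

instance setoid (C : Finset ℂ) (G : FilteredModule P) : Setoid (GradedPair C G) where
  r := Isomorphic
  iseqv :=
    { refl := fun p => ⟨FilteredIso.refl _ _, fun x c m => by rw [FilteredIso.gr_refl]⟩
      symm := by
        rintro p q ⟨f, hf⟩
        exact ⟨f.symm, fun x c m => by rw [← hf, FilteredIso.gr_gr_symm]⟩
      trans := by
        rintro p q r ⟨f, hf⟩ ⟨g, hg⟩
        exact ⟨f.trans g, fun x c m => by rw [FilteredIso.gr_trans, hg, hf]⟩ }

end GradedPair

/-- The set of isomorphism classes of pairs. -/
def GradedPairClass (C : Finset ℂ) (G : FilteredModule P) : Type 1 :=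
  Quotient (GradedPair.setoid C G)

end betti2

end BettiStokes

end

namespace BettiStokes

noncomputable section

/-! ### Real parts along varying directions -/

section rotation

/-! An object of the category is locally isomorphic to its graded module, and two local splittings
differ by an automorphism inducing the identity on the graded pieces. The theorem is the usual
classification of such twisted forms by nonabelian cohomology. Three points go beyond formal gluing.

(1) An automorphism trivial on the graded pieces must lie in `id + End^{<0}`, that is, lower the
filtration by one common amount near each direction. This holds because a splitting and the
finiteness of `C` give finitely many local generators over `𝒜_μ`; each is lowered by some amount,
and a single small amount serves all of them (`endLTZero_of_grTrivial`).

(2) Cohomologous cocycles give a global filtered isomorphism `f`, by gluing the local isomorphisms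
`η' ξ'⁻¹ α ξ η⁻¹` (`exists_filteredIso_of_class_eq`). Its graded part agrees with `ξ'⁻¹ ξ` only
modulo lower degree, whereas an isomorphism of pairs asks for equality. The difference maps the
local system `gr_c ℒ` into `(𝒜_μ ⊗ gr ℒ')_{<c}` over the whole circle, and every such map is zero
(`eq_zero_of_mem_lt`). Indeed its component in `gr_d` is a map of local systems, so it vanishes
everywhere or nowhere; where it is nonzero one has `d <_θ c`, and this cannot hold at two opposite
directions.

To speak of components one needs elements of `𝒜_μ` to have unique coefficients, locally constant
along sections and with exponents bounded by the growth of the function. This is the analytic core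
(`Admissible.leAt_of_growthLE`, `HasExpansion.unique`): in a generic direction the exponents have
distinct real parts, so one term dominates the series and its coefficient is recovered as a limit
along a ray. The condition on `C` keeps the degrees `-k + μ(γ)` for different `k` apart, so that the
components determine the tensor (`eq_zero_of_component_eq_zero`).

(3) For surjectivity, a cocycle is refined until `𝒢` splits on the cover. The module `𝒢` is then
twisted without touching its stalks or filtration: only the notion of section changes, through stalk
automorphisms `τ_a` trivial on the graded pieces (`TwistData`, `twistAut`). The associated graded
sheaf is therefore unchanged, and the global isomorphism `𝒢 ≅ 𝒜_μ ⊗ gr 𝒢` supplies `ξ`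
(`exists_isCocycleOf`). -/

theorem re_inv_mul_exp (x : Circle) (t : ℝ) (m : ℂ) :
    (((x * Circle.exp t : Circle) : ℂ)⁻¹ * m).re =
      ((x : ℂ)⁻¹ * m).re * Real.cos t + ((x : ℂ)⁻¹ * m).im * Real.sin t := by
  have h : ((x * Circle.exp t : Circle) : ℂ)⁻¹ * m
      = Complex.exp (((-t : ℝ) : ℂ) * Complex.I) * ((x : ℂ)⁻¹ * m) := by
    rw [Circle.coe_mul, Circle.coe_exp, mul_inv, ← Complex.exp_neg]
    push_cast
    ring_nf
  rw [h, Complex.mul_re, Complex.exp_ofReal_mul_I_re, Complex.exp_ofReal_mul_I_im, Real.cos_neg,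
    Real.sin_neg]
  ring

/-- Two zeros `t`, `t'` give a homogeneous linear system for the real and imaginary parts of `x⁻¹
m`, with determinant `sin (t' - t)` up to sign. The determinant must vanish, and `|t' - t| < 2 < π`.
-/
theorem subsingleton_re_eq_zero (x : Circle) {m : ℂ} (hm : m ≠ 0) :
    {t : ℝ | t ∈ Set.Ioo (-1 : ℝ) 1 ∧ (((x * Circle.exp t : Circle) : ℂ)⁻¹ * m).re = 0}.Subsingleton := by
  rintro t ⟨ht, h⟩ t' ⟨ht', h'⟩
  rw [re_inv_mul_exp] at h h'
  set a := ((x : ℂ)⁻¹ * m).re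
  set b := ((x : ℂ)⁻¹ * m).im
  have hw : (x : ℂ)⁻¹ * m ≠ 0 := mul_ne_zero (inv_ne_zero (Circle.coe_ne_zero x)) hm
  have hs : Real.sin (t' - t) = 0 := by
    rw [Real.sin_sub]
    by_contra hne
    have ha : a * (Real.sin t' * Real.cos t - Real.cos t' * Real.sin t) = 0 := by
      linear_combination Real.sin t' * h - Real.sin t * h'
    have hb : b * (Real.sin t' * Real.cos t - Real.cos t' * Real.sin t) = 0 := by
      linear_combination -Real.cos t' * h + Real.cos t * h'
    exact hw (Complex.ext ((mul_eq_zero.1 ha).resolve_right hne) ((mul_eq_zero.1 hb).resolve_right hne))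
  have hpi := Real.pi_gt_three
  have := (Real.sin_eq_zero_iff_of_lt_of_lt (by linarith [ht.1, ht.2, ht'.1, ht'.2])
    (by linarith [ht.1, ht.2, ht'.1, ht'.2])).1 hs
  linarith

/-- Near `x` there are directions in which `m` grows and which avoid the zeros of the real parts of
countably many given nonzero complex numbers. -/
theorem exists_generic_direction {x : Circle} {m : ℂ} (hm : m ≠ 0) (hx : 0 ≤ ((x : ℂ)⁻¹ * m).re)
    {W : Set ℂ} (hW : W.Countable) (hW0 : (0 : ℂ) ∉ W) {p : Circle → Prop} (hp : ∀ᶠ y in 𝓝 x, p y) :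
    ∃ y : Circle, p y ∧ 0 < ((y : ℂ)⁻¹ * m).re ∧ ∀ w ∈ W, ((y : ℂ)⁻¹ * w).re ≠ 0 := by
  have hcont : Continuous (fun t : ℝ => x * Circle.exp t) := by fun_prop
  have hp' : ∀ᶠ t in 𝓝 (0 : ℝ), p (x * Circle.exp t) := by
    apply hcont.continuousAt.eventually
    simpa using hp
  obtain ⟨ε, hε, hball⟩ := Metric.eventually_nhds_iff.1 hp'
  set δ : ℝ := min ε 1
  have hδ : 0 < δ := by positivity
  have hδε : δ ≤ ε := min_le_left _ _
  have hδ1 : δ ≤ 1 := min_le_right _ _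
  -- The real part of `x⁻¹ m` may vanish at `x`. It is then positive on one side of `x` only, where
  -- the sine has the sign of the imaginary part; the interval is taken on that side.
  obtain ⟨l, r, hlr, hI⟩ : ∃ l r : ℝ, l < r ∧ ∀ t ∈ Set.Ioo l r, t ∈ Set.Ioo (-δ) δ ∧
      0 < (((x * Circle.exp t : Circle) : ℂ)⁻¹ * m).re := by
    have hw : (x : ℂ)⁻¹ * m ≠ 0 := mul_ne_zero (inv_ne_zero (Circle.coe_ne_zero x)) hm
    have key : ∀ t ∈ Set.Ioo (-δ) δ, t ≠ 0 → 0 ≤ ((x : ℂ)⁻¹ * m).im * Real.sin t →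
        0 < (((x * Circle.exp t : Circle) : ℂ)⁻¹ * m).re := by
      intro t ht ht0 h
      rw [re_inv_mul_exp]
      have hpi := Real.pi_gt_three
      have hc : 0 < Real.cos t := Real.cos_pos_of_mem_Ioo ⟨by linarith [ht.1], by linarith [ht.2]⟩
      have hs : Real.sin t ≠ 0 := fun h0 =>
        ht0 ((Real.sin_eq_zero_iff_of_lt_of_lt (by linarith [ht.1]) (by linarith [ht.2])).1 h0)
      rcases hx.lt_or_eq with h1 | h1
      · have := mul_pos h1 hc
        linarith
      · have him : ((x : ℂ)⁻¹ * m).im ≠ 0 := fun h0 => hw (Complex.ext h1.symm h0)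
        rw [← h1, zero_mul, zero_add]
        exact lt_of_le_of_ne h (mul_ne_zero him hs).symm
    have hpi := Real.pi_gt_three
    rcases le_total 0 ((x : ℂ)⁻¹ * m).im with h | h
    · refine ⟨0, δ, hδ, fun t ht => ⟨⟨by linarith [ht.1], ht.2⟩, key t ⟨by linarith [ht.1], ht.2⟩ ht.1.ne' ?_⟩⟩
      exact mul_nonneg h (Real.sin_pos_of_pos_of_lt_pi ht.1 (by linarith [ht.2])).le
    · refine ⟨-δ, 0, by linarith, fun t ht => ⟨⟨ht.1, by linarith [ht.2]⟩, key t ⟨ht.1, by linarith [ht.2]⟩ ht.2.ne ?_⟩⟩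
      exact mul_nonneg_of_nonpos_of_nonpos h (Real.sin_neg_of_neg_of_neg_pi_lt ht.2 (by linarith [ht.1])).le
  -- Each `w` forbids at most one angle in `(-1, 1)`, so the forbidden angles are countable and
  -- their complement meets every interval.
  have hB : (⋃ w ∈ W, {t : ℝ | t ∈ Set.Ioo (-1 : ℝ) 1 ∧
      (((x * Circle.exp t : Circle) : ℂ)⁻¹ * w).re = 0}).Countable :=
    hW.biUnion fun w hw => (subsingleton_re_eq_zero x (fun h => hW0 (h ▸ hw))).countable
  obtain ⟨t, ht, htI⟩ := (hB.dense_compl ℝ).exists_mem_open isOpen_Ioo (Set.nonempty_Ioo.2 hlr)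
  obtain ⟨h1, h2⟩ := hI t htI
  refine ⟨x * Circle.exp t, hball ?_, h2, fun w hw h0 => ht ?_⟩
  · rw [Real.dist_eq, sub_zero, abs_lt]
    exact ⟨by linarith [h1.1], by linarith [h1.2]⟩
  · exact Set.mem_biUnion hw ⟨⟨by linarith [h1.1], by linarith [h1.2]⟩, h0⟩

/-- Restriction to this ray turns estimates on sectors into limits in one real variable. -/
theorem tendsto_ray (y : Circle) : Tendsto (fun t : ℝ => (t : ℂ) * y) (𝓝[>] 0) (sectorFilter y) := by
  refine tendsto_inf.2 ⟨tendsto_nhdsWithin_iff.2 ⟨?_, ?_⟩, tendsto_comap_iff.2 ?_⟩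
  · have : Continuous fun t : ℝ => (t : ℂ) * y := by fun_prop
    simpa using (this.tendsto 0).mono_left nhdsWithin_le_nhds
  · filter_upwards [self_mem_nhdsWithin] with t ht
    have : (t : ℂ) ≠ 0 := by exact_mod_cast (ne_of_gt ht)
    exact mul_ne_zero this (Circle.coe_ne_zero y)
  · refine tendsto_const_nhds.congr' ?_
    filter_upwards [self_mem_nhdsWithin] with t ht
    have ht' : (0 : ℝ) < t := ht
    have : (t : ℂ) ≠ 0 := by exact_mod_cast (ne_of_gt ht)
    have hn : ‖(t : ℂ) * y‖ = t := by
      rw [norm_mul, Circle.norm_coe, mul_one, Complex.norm_real, Real.norm_of_nonneg ht'.le]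
    simp only [Function.comp_apply]
    rw [hn, mul_div_cancel_left₀ _ this]

theorem ltAt_iff {x : Circle} {c c' : ℂ} : ltAt x c c' ↔ ((x : ℂ)⁻¹ * c).re < ((x : ℂ)⁻¹ * c').re := by
  unfold ltAt
  rw [mul_sub, Complex.sub_re, sub_neg]

end rotation

namespace PeriodMap

/-! ### The lattice inside its realification -/

section lattice

variable {L : Type} [AddCommGroup L] (P : PeriodMap L)

theorem len_sub_le (γ δ : L) : P.len γ - P.len δ ≤ P.len (γ - δ) := by
  unfold len
  rw [TensorProduct.tmul_sub, sub_le_iff_le_add]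
  calc P.nrm (1 ⊗ₜ[ℤ] γ) = P.nrm ((1 ⊗ₜ[ℤ] γ - 1 ⊗ₜ[ℤ] δ) + 1 ⊗ₜ[ℤ] δ) := by rw [sub_add_cancel]
    _ ≤ _ := map_add_le_add _ _ _

variable [Module.Free ℤ L]

theorem eq_zero_of_tmul_eq_zero {γ : L} (h : (1 : ℝ) ⊗ₜ[ℤ] γ = 0) : γ = 0 := by
  let b := Module.Free.chooseBasis ℤ L
  refine b.ext_elem fun i => ?_
  have := congrArg (fun v => (b.baseChange ℝ).repr v i) h
  simpa using this

/-- A zero period forces zero length by the support property, and a free lattice embeds in its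
realification. Injectivity is what separates the degrees `c + μ(γ)` for different `γ`. -/
theorem μ_injective : Function.Injective P.μ := by
  refine (injective_iff_map_eq_zero P.μ).2 fun γ h => ?_
  obtain ⟨R, hR, hlen⟩ := P.len_bound
  have h1 := hlen γ
  rw [h, norm_zero] at h1
  have h2 := P.len_nonneg γ
  have h3 : P.len γ = 0 := by nlinarith
  exact eq_zero_of_tmul_eq_zero (P.nrm_definite _ h3)

variable [Module.Finite ℤ L]

/-- Coordinates in a basis are continuous for the norm, hence bounded where the norm is bounded, and
a box contains finitely many integer vectors. -/
theorem finite_len_le (B : ℝ) : {γ : L | P.len γ ≤ B}.Finite := by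
  let N : NormedAddCommGroup (ℝ ⊗[ℤ] L) :=
    AddGroupNorm.toNormedAddCommGroup
      { toFun := P.nrm
        map_zero' := map_zero P.nrm
        add_le' := map_add_le_add P.nrm
        neg' := map_neg_eq_map P.nrm
        eq_zero_of_map_eq_zero' := P.nrm_definite }
  let S : NormedSpace ℝ (ℝ ⊗[ℤ] L) :=
    { norm_smul_le := fun a v => le_of_eq (map_smul_eq_mul P.nrm a v) }
  let b := Module.Free.chooseBasis ℤ L
  let F : (ℝ ⊗[ℤ] L) →ₗ[ℝ] (Module.Free.ChooseBasisIndex ℤ L → ℝ) := (b.baseChange ℝ).equivFun.toLinearMap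
  let F' : (ℝ ⊗[ℤ] L) →L[ℝ] (Module.Free.ChooseBasisIndex ℤ L → ℝ) := ⟨F, F.continuous_of_finiteDimensional⟩
  have hF : ∀ γ i, F' (1 ⊗ₜ[ℤ] γ) i = (b.repr γ i : ℝ) := fun γ i => by simp [F', F]
  set K : ℤ := ⌈‖F'‖ * |B|⌉
  have hfin : (Set.Icc (fun _ : Module.Free.ChooseBasisIndex ℤ L => -K) (fun _ => K)).Finite :=
    Set.finite_Icc _ _
  refine (hfin.preimage (f := fun γ : L => fun i => b.repr γ i) ?_).subset ?_
  · exact fun γ _ δ _ h => b.ext_elem fun i => congrFun h i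
  · intro γ hγ
    have h1 : ‖F' (1 ⊗ₜ[ℤ] γ)‖ ≤ ‖F'‖ * |B| := by
      refine (F'.le_opNorm _).trans ?_
      have h2 : ‖(1 ⊗ₜ[ℤ] γ : ℝ ⊗[ℤ] L)‖ = P.len γ := rfl
      rw [h2]
      have h3 : P.len γ ≤ B := hγ
      gcongr
      exact h3.trans (le_abs_self B)
    have h2 : ∀ i, |(b.repr γ i : ℝ)| ≤ (K : ℝ) := fun i => by
      have h3 := (norm_le_pi_norm (F' (1 ⊗ₜ[ℤ] γ)) i).trans h1
      rw [hF, Real.norm_eq_abs] at h3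
      exact h3.trans (Int.le_ceil _)
    refine ⟨fun i => ?_, fun i => ?_⟩
    · have := (abs_le.1 (h2 i)).1
      show -K ≤ b.repr γ i
      exact_mod_cast this
    · have := (abs_le.1 (h2 i)).2
      show b.repr γ i ≤ K
      exact_mod_cast this

end lattice

/-! ### Convergence and growth of exponential series -/

section expansions

variable {L : Type} [AddCommGroup L] (P : PeriodMap L)

/-- The function `∑_γ b_γ exp(μ(γ)/z)`. -/
def expSum (b : L → ℂ) (z : ℂ) : ℂ := ∑' γ, b γ * Complex.exp (P.μ γ / z)

/-- The support of `b` is, over `U`, bounded by finitely many elements, and `∑ |b_γ| ρ^‖γ‖ < ∞` for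
some `0 < ρ ≤ 1`. -/
def Admissible (U : Opens Circle) (b : L → ℂ) : Prop :=
  (∃ S : Finset L, ∀ γ, b γ ≠ 0 → ∃ σ ∈ S, ∀ y ∈ U, leAt y (P.μ (γ - σ)) 0) ∧
  ∃ ρ : ℝ, 0 < ρ ∧ ρ ≤ 1 ∧ Summable fun γ => ‖b γ‖ * ρ ^ P.len γ

variable {P}

theorem Admissible.mono {U V : Opens Circle} {b : L → ℂ} (h : P.Admissible U b) (hV : V ≤ U) :
    P.Admissible V b := by
  obtain ⟨⟨S, hS⟩, hρ⟩ := h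
  refine ⟨⟨S, fun γ hγ => ?_⟩, hρ⟩
  obtain ⟨σ, hσ, h⟩ := hS γ hγ
  exact ⟨σ, hσ, fun y hy => h y (hV hy)⟩

theorem summable_of_le {b : L → ℂ} {ρ σ : ℝ} (hσ : 0 < σ) (hσρ : σ ≤ ρ)
    (h : Summable fun γ => ‖b γ‖ * ρ ^ P.len γ) : Summable fun γ => ‖b γ‖ * σ ^ P.len γ := by
  refine Summable.of_nonneg_of_le (fun γ => by positivity) (fun γ => ?_) h
  gcongr
  exact P.len_nonneg γ

theorem Admissible.add {U : Opens Circle} {b b' : L → ℂ} (h : P.Admissible U b)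
    (h' : P.Admissible U b') : P.Admissible U (b + b') := by
  classical
  obtain ⟨⟨S, hS⟩, ρ, hρ, hρ1, hs⟩ := h
  obtain ⟨⟨S', hS'⟩, ρ', hρ', hρ1', hs'⟩ := h'
  refine ⟨⟨S ∪ S', fun γ hγ => ?_⟩, min ρ ρ', lt_min hρ hρ', (min_le_left _ _).trans hρ1, ?_⟩
  · by_cases h0 : b γ = 0
    · have h1 : b' γ ≠ 0 := fun h1 => hγ (by rw [Pi.add_apply, h0, h1, add_zero])
      obtain ⟨σ, hσ, h⟩ := hS' γ h1
      exact ⟨σ, Finset.mem_union_right _ hσ, h⟩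
    · obtain ⟨σ, hσ, h⟩ := hS γ h0
      exact ⟨σ, Finset.mem_union_left _ hσ, h⟩
  · have hm := lt_min hρ hρ'
    refine Summable.of_nonneg_of_le (fun γ => by positivity) (fun γ => ?_)
      ((summable_of_le hm (min_le_left _ _) hs).add (summable_of_le hm (min_le_right _ _) hs'))
    rw [← add_mul]
    gcongr
    exact norm_add_le _ _

theorem Admissible.smul {U : Opens Circle} {b : L → ℂ} (h : P.Admissible U b) (r : ℂ) :
    P.Admissible U (r • b) := by
  obtain ⟨⟨S, hS⟩, ρ, hρ, hρ1, hs⟩ := h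
  refine ⟨⟨S, fun γ hγ => hS γ fun h0 => hγ (by rw [Pi.smul_apply, h0, smul_zero])⟩, ρ, hρ, hρ1, ?_⟩
  refine (hs.mul_left ‖r‖).congr fun γ => ?_
  rw [Pi.smul_apply, norm_smul, mul_assoc]

theorem Admissible.zero (U : Opens Circle) : P.Admissible U 0 :=
  ⟨⟨∅, fun γ h => absurd rfl h⟩, 1, one_pos, le_rfl, by simp⟩

theorem Admissible.shift {U : Opens Circle} {b : L → ℂ} (h : P.Admissible U b) (δ : L) :
    P.Admissible U fun γ => b (γ - δ) := by
  classical
  obtain ⟨⟨S, hS⟩, ρ, hρ, hρ1, hs⟩ := h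
  refine ⟨⟨S.image (· + δ), fun γ hγ => ?_⟩, ρ, hρ, hρ1, ?_⟩
  · obtain ⟨σ, hσ, h⟩ := hS _ hγ
    refine ⟨σ + δ, Finset.mem_image_of_mem _ hσ, ?_⟩
    rwa [add_comm σ δ, ← sub_sub]
  -- After translating the index, the reverse triangle inequality and `ρ ≤ 1` bound the new weights
  -- by the old ones up to the constant `ρ ^ (-len δ)`.
  · refine (Equiv.addRight δ).summable_iff.1 ?_
    refine Summable.of_nonneg_of_le
      (fun γ => mul_nonneg (norm_nonneg _) (Real.rpow_nonneg hρ.le _)) (fun γ => ?_)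
      (hs.mul_right (ρ ^ (-P.len δ)))
    simp only [Function.comp_apply, Equiv.coe_addRight, add_sub_cancel_right]
    rw [mul_assoc, ← Real.rpow_add hρ]
    refine mul_le_mul_of_nonneg_left ?_ (norm_nonneg _)
    apply Real.rpow_le_rpow_of_exponent_ge hρ hρ1
    have h1 := P.len_sub_le γ (-δ)
    have h2 : P.len (-δ) = P.len δ := by
      unfold len
      rw [TensorProduct.tmul_neg, map_neg_eq_map]
    rw [sub_neg_eq_add, h2] at h1
    linarith

/-- Each exponent is one of finitely many `σ` plus an element of the negative cone. The cone part is
dominated by `exp_bound`; the finitely many factors `exp(μ(σ)/z)` go into a constant depending on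
`z`. -/
theorem Admissible.summable_exp {x : Circle} {U : Opens Circle} (hx : x ∈ U) {b : L → ℂ}
    (h : P.Admissible U b) :
    ∀ᶠ z in sectorFilter x, Summable fun γ => ‖b γ * Complex.exp (P.μ γ / z)‖ := by
  obtain ⟨⟨S, hS⟩, ρ, hρ, hρ1, hs⟩ := h
  filter_upwards [P.exp_bound hx hρ] with z hz
  set C : ℝ := ∑ σ ∈ S, ‖Complex.exp (P.μ σ / z)‖ * ρ ^ (-P.len σ)
  refine Summable.of_nonneg_of_le (fun γ => norm_nonneg _) (fun γ => ?_) (hs.mul_right C)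
  by_cases h0 : b γ = 0
  · simp [h0]
  obtain ⟨σ, hσ, h⟩ := hS γ h0
  have h1 := hz (γ - σ) h
  have h2 : P.μ γ / z = P.μ (γ - σ) / z + P.μ σ / z := by rw [← add_div, ← map_add, sub_add_cancel]
  rw [norm_mul, mul_assoc, h2, Complex.exp_add, norm_mul]
  refine mul_le_mul_of_nonneg_left ?_ (norm_nonneg _)
  have h3 : ρ ^ P.len (γ - σ) ≤ ρ ^ P.len γ * ρ ^ (-P.len σ) := by
    rw [← Real.rpow_add hρ]
    exact Real.rpow_le_rpow_of_exponent_ge hρ hρ1 (by linarith [P.len_sub_le γ σ])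
  have h4 : ‖Complex.exp (P.μ σ / z)‖ * ρ ^ (-P.len σ) ≤ C :=
    Finset.single_le_sum (f := fun σ => ‖Complex.exp (P.μ σ / z)‖ * ρ ^ (-P.len σ))
      (fun σ _ => by positivity) hσ
  calc _ ≤ ρ ^ P.len γ * ρ ^ (-P.len σ) * ‖Complex.exp (P.μ σ / z)‖ := by
        exact mul_le_mul_of_nonneg_right (h1.trans h3) (norm_nonneg _)
    _ = ρ ^ P.len γ * (‖Complex.exp (P.μ σ / z)‖ * ρ ^ (-P.len σ)) := by ring
    _ ≤ _ := mul_le_mul_of_nonneg_left h4 (Real.rpow_nonneg hρ.le _)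

/-- In the negative cone the real part is at most `-κ ‖μ‖`, hence at most `-κ R` times the length. A
lower bound on the real part therefore bounds the length of `γ - σ`, and boundedly many lattice
elements remain for each of the finitely many `σ`. -/
theorem Admissible.finite_support [Module.Free ℤ L] [Module.Finite ℤ L] {x : Circle}
    {U : Opens Circle} (hx : x ∈ U) {b : L → ℂ} (h : P.Admissible U b) (r : ℝ) :
    {γ | b γ ≠ 0 ∧ r ≤ ((x : ℂ)⁻¹ * P.μ γ).re}.Finite := by
  obtain ⟨⟨S, hS⟩, -⟩ := h
  obtain ⟨κ, hκ, hcone⟩ := cone_bound hx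
  obtain ⟨R, hR, hlen⟩ := P.len_bound
  refine (Set.Finite.biUnion S.finite_toSet fun σ _ =>
    (P.finite_len_le ((((x : ℂ)⁻¹ * P.μ σ).re - r) / (κ * R))).preimage
      (sub_left_injective (b := σ)).injOn).subset ?_
  rintro γ ⟨h0, hr⟩
  obtain ⟨σ, hσ, h⟩ := hS γ h0
  refine Set.mem_biUnion hσ ?_
  show P.len (γ - σ) ≤ _
  have h1 := hcone _ h
  have h2 := hlen (γ - σ)
  rw [map_sub, mul_sub, Complex.sub_re, ← map_sub] at h1
  rw [le_div_iff₀ (by positivity)]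
  nlinarith

theorem countable_lattice [Module.Free ℤ L] [Module.Finite ℤ L] : Countable L :=
  (Module.Free.chooseBasis ℤ L).equivFun.toEquiv.injective.countable

theorem tendsto_mul_exp_neg_div {m : ℝ} (hm : 0 < m) (K : ℝ) (N : ℕ) :
    Tendsto (fun t : ℝ => K / t ^ N * Real.exp (-(m / t))) (𝓝[>] 0) (𝓝 0) := by
  have h := ((Real.tendsto_pow_mul_exp_neg_atTop_nhds_zero N).comp
    ((tendsto_inv_nhdsGT_zero (𝕜 := ℝ)).const_mul_atTop hm)).const_mul (K * (m ^ N)⁻¹)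
  rw [mul_zero] at h
  refine h.congr' ?_
  filter_upwards [self_mem_nhdsWithin] with t ht
  have ht' : (t : ℝ) ≠ 0 := (ne_of_gt ht)
  simp only [Function.comp_apply]
  rw [mul_pow, div_eq_mul_inv m t, inv_pow]
  field_simp

/-- The growth of an exponential series bounds its exponents. -/
theorem Admissible.leAt_of_growthLE [Module.Free ℤ L] [Module.Finite ℤ L] {x : Circle}
    {U : Opens Circle} (hx : x ∈ U) {b : L → ℂ} (h : P.Admissible U b) {c : ℂ}
    (hc : (P.expSum b : FunGerm x) ∈ growthLE x c) {γ₀ : L} (hγ₀ : b γ₀ ≠ 0) :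
    leAt x (P.μ γ₀) c := by
  classical
  by_contra hcon
  have hm : P.μ γ₀ - c ≠ 0 := fun h0 => hcon (Or.inr (sub_eq_zero.1 h0))
  have hre : 0 ≤ ((x : ℂ)⁻¹ * (P.μ γ₀ - c)).re := not_lt.1 fun h0 => hcon (Or.inl h0)
  have := countable_lattice (L := L)
  -- The growth condition is open, so it persists at a nearby direction `y` chosen so that `μ γ₀`
  -- strictly exceeds `c` and distinct exponents have distinct real parts. Zero is removed from the
  -- differences because equal exponents cannot be separated.
  obtain ⟨y, ⟨hyU, hyc⟩, hypos, hygen⟩ := exists_generic_direction hm hre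
    (W := (Set.range fun p : L × L => P.μ (p.1 - p.2)) \ {0})
    ((Set.countable_range _).mono Set.sdiff_subset) (fun h0 => h0.2 rfl)
    (p := fun y => y ∈ U ∧ (P.expSum b : FunGerm y) ∈ growthLE y c)
    ((show ∀ᶠ y in 𝓝 x, y ∈ U from U.isOpen.mem_nhds hx).and (growthLE_eventually hc))
  have hinj : ∀ γ δ, ((y : ℂ)⁻¹ * P.μ γ).re = ((y : ℂ)⁻¹ * P.μ δ).re → γ = δ := by
    intro γ δ he
    by_contra hne
    refine hygen (P.μ (γ - δ)) ⟨⟨(γ, δ), rfl⟩, fun h0 => hne ?_⟩ ?_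
    · exact sub_eq_zero.1 (P.μ_injective (by rw [map_zero]; exact h0))
    · rw [map_sub, mul_sub, Complex.sub_re, he, sub_self]
  -- Only finitely many exponents lie above `γ₀` at `y`, so a maximal one exists, and genericity
  -- makes it strictly dominant.
  obtain ⟨γ₁, ⟨hγ₁, hle₁⟩, hmax'⟩ := Set.exists_max_image _ (fun γ => ((y : ℂ)⁻¹ * P.μ γ).re)
    (h.finite_support hyU ((y : ℂ)⁻¹ * P.μ γ₀).re) ⟨γ₀, hγ₀, le_rfl⟩
  have hmax : ∀ γ, b γ ≠ 0 → γ ≠ γ₁ → ((y : ℂ)⁻¹ * P.μ γ).re - ((y : ℂ)⁻¹ * P.μ γ₁).re < 0 := by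
    intro γ hγ hne
    rcases lt_or_ge ((y : ℂ)⁻¹ * P.μ γ).re ((y : ℂ)⁻¹ * P.μ γ₀).re with h1 | h1
    · linarith
    · exact sub_neg.2 (lt_of_le_of_ne (hmax' γ ⟨hγ, h1⟩) fun he => hne (hinj _ _ he))
  rw [mul_sub, Complex.sub_re] at hypos
  set m : ℝ := ((y : ℂ)⁻¹ * P.μ γ₁).re - ((y : ℂ)⁻¹ * c).re with hmdef
  have hmpos : 0 < m := by linarith
  have hexp : ∀ (t : ℝ) (w : ℂ), ‖Complex.exp (w / (t * y))‖ = Real.exp (((y : ℂ)⁻¹ * w).re / t) := by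
    intro t w
    have : w / (t * y) = ((y : ℂ)⁻¹ * w) / (t : ℂ) := by
      rw [div_eq_mul_inv, div_eq_mul_inv, mul_inv]; ring
    rw [Complex.norm_exp, this, Complex.div_ofReal_re]
  have hexp' : ∀ (t : ℝ) (γ : L), ‖Complex.exp ((P.μ γ - P.μ γ₁) / (t * y))‖ =
      Real.exp ((((y : ℂ)⁻¹ * P.μ γ).re - ((y : ℂ)⁻¹ * P.μ γ₁).re) / t) := by
    intro t γ
    rw [hexp, mul_sub, Complex.sub_re]
  -- the normalized series along the ray
  obtain ⟨t₀, ht₀s, ht₀⟩ := (((tendsto_ray y).eventually (h.summable_exp hyU)).and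
    (self_mem_nhdsWithin (s := Set.Ioi (0 : ℝ)))).exists
  have ht₀' : 0 < t₀ := ht₀
  have hlim : Tendsto (fun t : ℝ => ∑' γ, b γ * Complex.exp ((P.μ γ - P.μ γ₁) / (t * y))) (𝓝[>] 0)
      (𝓝 (∑' γ, if γ = γ₁ then b γ₁ else 0)) := by
    -- Divided by the dominant exponential, every other term has negative real exponent and so
    -- decreases as `t → 0`. The terms at one fixed `t₀` on the ray therefore dominate all later
    -- ones, and the limit is `b γ₁`.
    refine tendsto_tsum_of_dominated_convergence
      (bound := fun γ => ‖b γ * Complex.exp ((P.μ γ - P.μ γ₁) / (t₀ * y))‖) ?_ ?_ ?_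
    · refine (ht₀s.mul_right ‖Complex.exp (-P.μ γ₁ / (t₀ * y))‖).congr fun γ => ?_
      rw [← norm_mul, mul_assoc, ← Complex.exp_add, ← add_div, ← sub_eq_add_neg]
    · intro γ
      by_cases h1 : γ = γ₁
      · subst h1; simp
      rw [if_neg h1]
      by_cases h0 : b γ = 0
      · simp [h0]
      rw [tendsto_zero_iff_norm_tendsto_zero]
      have h2 := tendsto_mul_exp_neg_div (neg_pos.2 (hmax γ h0 h1)) ‖b γ‖ 0
      refine h2.congr fun t => ?_
      rw [norm_mul, hexp', pow_zero, div_one, neg_div, neg_neg]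
    · filter_upwards [Ioo_mem_nhdsGT ht₀'] with t ht γ
      by_cases h0 : b γ = 0
      · simp [h0]
      rw [norm_mul, norm_mul, hexp', hexp']
      gcongr 2
      by_cases h1 : γ = γ₁
      · subst h1; simp
      have h2 := hmax γ h0 h1
      rw [div_le_div_iff₀ ht.1 ht₀']
      nlinarith [ht.2]
  rw [tsum_ite_eq] at hlim
  obtain ⟨_, ⟨g, rfl, K, N, hg⟩, hfg⟩ := hyc
  have hfg' : ∀ᶠ z in sectorFilter y, P.expSum b z = Complex.exp (c / z) * g z := Germ.coe_eq.1 hfg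
  -- The growth bound by `exp(c/z)` forces the same quotient to tend to zero, because `μ γ₁` exceeds
  -- `c` by `m > 0` at `y`. The two limits together contradict `b γ₁ ≠ 0`.
  have hzero : Tendsto (fun t : ℝ => ∑' γ, b γ * Complex.exp ((P.μ γ - P.μ γ₁) / (t * y))) (𝓝[>] 0)
      (𝓝 0) := by
    refine squeeze_zero_norm' ?_ (tendsto_mul_exp_neg_div hmpos K N)
    filter_upwards [(tendsto_ray y).eventually hg, (tendsto_ray y).eventually hfg',
      self_mem_nhdsWithin] with t h1 h2 ht
    have ht' : (0 : ℝ) < t := ht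
    have h3 : ∑' γ, b γ * Complex.exp ((P.μ γ - P.μ γ₁) / (t * y)) =
        Complex.exp ((c - P.μ γ₁) / (t * y)) * g (t * y) := by
      calc _ = P.expSum b (t * y) * Complex.exp (-P.μ γ₁ / (t * y)) := by
            unfold expSum
            rw [← tsum_mul_right]
            refine tsum_congr fun γ => ?_
            rw [mul_assoc, ← Complex.exp_add, ← add_div, ← sub_eq_add_neg]
        _ = _ := by
            rw [h2, mul_right_comm, ← Complex.exp_add, ← add_div, ← sub_eq_add_neg]
    rw [h3, norm_mul, hexp, mul_sub, Complex.sub_re, mul_comm]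
    have h4 : ‖(t : ℂ) * y‖ = t := by
      rw [norm_mul, Circle.norm_coe, mul_one, Complex.norm_real, Real.norm_of_nonneg ht'.le]
    rw [h4] at h1
    have h5 : (((y : ℂ)⁻¹ * c).re - ((y : ℂ)⁻¹ * P.μ γ₁).re) / t = -(m / t) := by
      rw [hmdef]; ring
    rw [h5]
    gcongr
  exact hγ₁ (tendsto_nhds_unique hlim hzero)

end expansions

end PeriodMap

end

end BettiStokes

namespace BettiStokes

noncomputable section

namespace PeriodMap

/-! ### Unique coefficients of elements of `𝒜_μ` -/

section coefficients

variable {L : Type} [AddCommGroup L] (P : PeriodMap L)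

/-- `g` is the germ at `x` of the exponential series with coefficients `b`. -/
def HasExpansion (x : Circle) (b : L → ℂ) (g : FunGerm x) : Prop :=
  ∃ U : Opens Circle, x ∈ U ∧ P.Admissible U b ∧ g = (P.expSum b : FunGerm x)

variable {P} {x : Circle} {b b' : L → ℂ} {g g' : FunGerm x}

theorem HasExpansion.add (h : P.HasExpansion x b g) (h' : P.HasExpansion x b' g') :
    P.HasExpansion x (b + b') (g + g') := by
  obtain ⟨U, hU, hb, rfl⟩ := h
  obtain ⟨U', hU', hb', rfl⟩ := h'
  refine ⟨U ⊓ U', ⟨hU, hU'⟩, (hb.mono inf_le_left).add (hb'.mono inf_le_right), ?_⟩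
  rw [← Germ.coe_add]
  apply Germ.coe_eq.2
  filter_upwards [hb.summable_exp hU, hb'.summable_exp hU'] with z h1 h2
  show P.expSum b z + P.expSum b' z = P.expSum (b + b') z
  unfold expSum
  rw [← h1.of_norm.tsum_add h2.of_norm]
  exact tsum_congr fun γ => (add_mul _ _ _).symm

theorem HasExpansion.smul (h : P.HasExpansion x b g) (r : ℂ) :
    P.HasExpansion x (r • b) (r • g) := by
  obtain ⟨U, hU, hb, rfl⟩ := h
  refine ⟨U, hU, hb.smul r, ?_⟩
  rw [← Germ.coe_smul]
  congr 1
  funext z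
  show r * P.expSum b z = _
  unfold expSum
  rw [← tsum_mul_left]
  exact tsum_congr fun γ => (mul_assoc _ _ _).symm

theorem HasExpansion.zero : P.HasExpansion x 0 0 :=
  ⟨⊤, trivial, Admissible.zero _, by
    rw [← Germ.coe_zero]
    congr 1
    funext z
    simp [expSum]⟩

theorem HasExpansion.expGerm_mul (h : P.HasExpansion x b g) (δ : L) :
    P.HasExpansion x (fun γ => b (γ - δ)) (P.expGerm x δ * g) := by
  obtain ⟨U, hU, hb, rfl⟩ := h
  refine ⟨U, hU, hb.shift δ, ?_⟩
  unfold expGerm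
  rw [← Germ.coe_mul]
  congr 1
  funext z
  show Complex.exp (P.μ δ / z) * P.expSum b z = _
  unfold expSum
  rw [← tsum_mul_left,
    ← (Equiv.addRight δ).tsum_eq fun γ => b (γ - δ) * Complex.exp (P.μ γ / z)]
  refine tsum_congr fun γ => ?_
  rw [Equiv.coe_addRight]
  beta_reduce
  rw [add_sub_cancel_right, map_add, add_div, Complex.exp_add]
  ring

theorem exists_hasExpansion [Module.Finite ℤ L] (hg : g ∈ P.Amu x) :
    ∃ b, P.HasExpansion x b g := by
  rw [mem_Amu] at hg
  unfold stalkSpan at hg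
  induction hg using Submodule.span_induction with
  | zero => exact ⟨0, HasExpansion.zero⟩
  | add a b _ _ ha hb =>
    obtain ⟨_, h⟩ := ha
    obtain ⟨_, h'⟩ := hb
    exact ⟨_, h.add h'⟩
  | smul r a _ ha =>
    obtain ⟨_, h⟩ := ha
    exact ⟨_, h.smul r⟩
  | mem g hg =>
    obtain ⟨γ, h, ⟨U, hU, f, ⟨a, ha, ⟨ρ, hρ, hs⟩, hf⟩, rfl⟩, rfl⟩ := hg
    refine ⟨_, HasExpansion.expGerm_mul (b := a) ⟨U, hU, ⟨⟨{0}, fun γ hγ => ?_⟩, min ρ 1,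
      lt_min hρ one_pos, min_le_right _ _, summable_of_le (lt_min hρ one_pos) (min_le_left _ _) hs⟩, ?_⟩ γ⟩
    · exact ⟨0, Finset.mem_singleton_self 0, by simpa using ha γ hγ⟩
    · exact congrArg _ (funext hf)

theorem HasExpansion.eventually {f : ℂ → ℂ} (h : P.HasExpansion x b (f : FunGerm x)) :
    ∀ᶠ y in 𝓝 x, P.HasExpansion y b (f : FunGerm y) := by
  obtain ⟨U, hU, hb, hf⟩ := h
  filter_upwards [U.isOpen.mem_nhds hU, eventually_sectorFilter (Germ.coe_eq.1 hf)] with y h1 h2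
  exact ⟨U, h1, hb, Germ.coe_eq.2 h2⟩

variable [Module.Free ℤ L] [Module.Finite ℤ L]

theorem HasExpansion.leAt (h : P.HasExpansion x b g) {c : ℂ} (hg : g ∈ growthLE x c) {γ : L}
    (hγ : b γ ≠ 0) : leAt x (P.μ γ) c := by
  obtain ⟨U, hU, hb, rfl⟩ := h
  exact hb.leAt_of_growthLE hU hg hγ

/-- The difference of the two series represents the zero germ, which satisfies every growth
condition, so no exponent can carry a nonzero coefficient. -/
theorem HasExpansion.unique (h : P.HasExpansion x b g) (h' : P.HasExpansion x b' g) : b = b' := by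
  have h0 := h.add (h'.smul (-1))
  rw [neg_one_smul, neg_one_smul, add_neg_cancel] at h0
  funext γ
  by_contra hne
  have hγ : (b + -b') γ ≠ 0 := fun h1 => hne (by
    rwa [Pi.add_apply, Pi.neg_apply, ← sub_eq_add_neg, sub_eq_zero] at h1)
  -- The index `μ γ - x` is strictly below `μ γ` in the direction `x`.
  have h1 := h0.leAt (c := P.μ γ - x) (zero_mem _) hγ
  rcases h1 with h1 | h1
  · unfold ltAt at h1
    rw [sub_sub_cancel, inv_mul_cancel₀ (Circle.coe_ne_zero x), Complex.one_re] at h1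
    linarith
  · exact Circle.coe_ne_zero x (by linear_combination h1)

variable (P x) in
/-- The coefficients of an element of the stalk of `𝒜_μ`. -/
def coef : P.Amu x →ₗ[ℂ] L → ℂ where
  toFun a := (exists_hasExpansion a.2).choose
  map_add' a b := HasExpansion.unique (exists_hasExpansion (a + b).2).choose_spec
    ((exists_hasExpansion a.2).choose_spec.add (exists_hasExpansion b.2).choose_spec)
  map_smul' r a := HasExpansion.unique (exists_hasExpansion (r • a).2).choose_spec
    ((exists_hasExpansion a.2).choose_spec.smul r)

theorem hasExpansion_coef (a : P.Amu x) : P.HasExpansion x (P.coef x a) a :=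
  (exists_hasExpansion a.2).choose_spec

theorem coef_u_mul (a : P.Amu x) (δ γ : L) : P.coef x (P.u x δ * a) γ = P.coef x a (γ - δ) :=
  congrFun ((hasExpansion_coef (P.u x δ * a)).unique ((hasExpansion_coef a).expGerm_mul δ)) γ

theorem eq_zero_of_coef_eq_zero {a : P.Amu x} (h : ∀ γ, P.coef x a γ = 0) : a = 0 := by
  have h1 := hasExpansion_coef a
  rw [show P.coef x a = 0 from funext h] at h1
  obtain ⟨U, hU, hb, h2⟩ := h1
  obtain ⟨U', hU', hb', h3⟩ := HasExpansion.zero (P := P) (x := x)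
  exact Subtype.ext (h2.trans h3.symm)

theorem leAt_of_coef_ne_zero {a : P.Amu x} {c : ℂ} (ha : a ∈ P.AmuLE c x) {γ : L}
    (h : P.coef x a γ ≠ 0) : leAt x (P.μ γ) c := (hasExpansion_coef a).leAt ha h

/-- An expansion at a point is valid with the same coefficients at all nearby points, so uniqueness
makes the coefficients locally constant along a section. -/
theorem coef_eventually {a : ∀ y, P.Amu y} (ha : P.AmuSheaf.IsSec a x) :
    ∀ᶠ y in 𝓝 x, P.coef y (a y) = P.coef x (a x) := by
  obtain ⟨f, hf⟩ := ha
  have h1 := hasExpansion_coef (a x)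
  rw [hf.self_of_nhds] at h1
  filter_upwards [hf, h1.eventually] with y h2 h3
  refine (hasExpansion_coef (a y)).unique ?_
  rw [h2]
  exact h3

end coefficients

end PeriodMap

end

end BettiStokes

/-! ### Generators of the filtered modules and automorphisms trivial on the graded pieces -/

namespace BettiStokes

noncomputable section

variable {L : Type} [AddCommGroup L] [Module.Finite ℤ L] {P : PeriodMap L}

/-- Subtracting `r x` lowers the real part in the direction `x` by exactly `r`. This gives a
one-parameter family of smaller indices used throughout. -/
theorem ltAt_sub_mul (x : Circle) (c : ℂ) {r : ℝ} (hr : 0 < r) : ltAt x (c - r * x) c := by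
  unfold ltAt
  have : (x : ℂ)⁻¹ * (c - r * x - c) = ((-r : ℝ) : ℂ) := by
    have := Circle.coe_ne_zero x
    push_cast
    field_simp
    ring
  rw [this, Complex.ofReal_re]
  linarith

namespace IsMorphism

variable {U : Opens Circle} {M N : FilteredModule P}

theorem sub {φ ψ : ∀ x : U, M.stalk x →ₗ[P.Amu x] N.stalk x} (hφ : IsMorphism φ)
    (hψ : IsMorphism ψ) : IsMorphism fun x => φ x - ψ x := by
  classical
  intro x s t hs h
  have e1 := hφ x s (fun y => if hy : y ∈ U then φ ⟨y, hy⟩ (s y) else 0) hs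
    (Eventually.of_forall fun y hy => dif_pos hy)
  have e2 := hψ x s (fun y => if hy : y ∈ U then ψ ⟨y, hy⟩ (s y) else 0) hs
    (Eventually.of_forall fun y hy => dif_pos hy)
  refine N.sheaf.isSec_congr ?_ (N.sheaf.isSec_add e1 (N.sheaf.isSec_neg e2))
  filter_upwards [h, U.isOpen.mem_nhds x.2] with y h3 hy
  rw [h3 hy, Pi.add_apply, Pi.neg_apply, dif_pos (show y ∈ U from hy),
    dif_pos (show y ∈ U from hy), ← sub_eq_add_neg]
  rfl

theorem add {φ ψ : ∀ x : U, M.stalk x →ₗ[P.Amu x] N.stalk x} (hφ : IsMorphism φ)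
    (hψ : IsMorphism ψ) : IsMorphism fun x => φ x + ψ x := by
  classical
  intro x s t hs h
  have e1 := hφ x s (fun y => if hy : y ∈ U then φ ⟨y, hy⟩ (s y) else 0) hs
    (Eventually.of_forall fun y hy => dif_pos hy)
  have e2 := hψ x s (fun y => if hy : y ∈ U then ψ ⟨y, hy⟩ (s y) else 0) hs
    (Eventually.of_forall fun y hy => dif_pos hy)
  refine N.sheaf.isSec_congr ?_ (N.sheaf.isSec_add e1 e2)
  filter_upwards [h, U.isOpen.mem_nhds x.2] with y h3 hy
  rw [h3 hy, Pi.add_apply, dif_pos (show y ∈ U from hy), dif_pos (show y ∈ U from hy)]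
  rfl

theorem id (U : Opens Circle) (M : FilteredModule P) :
    IsMorphism fun x : U => (LinearMap.id : M.stalk x →ₗ[P.Amu x] M.stalk x) :=
  (FilteredIso.refl U M).isMorphism

theorem res {V : Opens Circle} (h : V ≤ U) {φ : ∀ x : U, M.stalk x →ₗ[P.Amu x] N.stalk x}
    (hφ : IsMorphism φ) : IsMorphism fun x : V => φ ⟨x, h x.2⟩ := by
  intro x s t hs ht
  refine hφ ⟨x, h x.2⟩ s t hs ?_
  filter_upwards [ht, V.isOpen.mem_nhds x.2] with y h1 h2 hy using h1 h2

/-- Being a morphism is a local property. -/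
theorem of_local {φ : ∀ x : U, M.stalk x →ₗ[P.Amu x] N.stalk x}
    (h : ∀ x : U, ∃ (V : Opens Circle) (hV : V ≤ U), (x : Circle) ∈ V ∧
      IsMorphism fun y : V => φ ⟨y, hV y.2⟩) : IsMorphism φ := by
  intro x s t hs ht
  obtain ⟨V, hV, hx, hφ⟩ := h x
  refine hφ ⟨x, hx⟩ s t hs ?_
  filter_upwards [ht] with y h1 hy using h1 (hV hy)

end IsMorphism

namespace FilteredModule

variable (M : FilteredModule P)

/-- The indices `c - r x` with `r` small lie above any given index that is strictly below `c` at
`x`. Having membership for all small `r` lets finitely many elements share one `r`. -/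
theorem eventually_mem_le {c : ℂ} {x : Circle} {m : M.stalk x} (h : m ∈ M.lt c x) :
    ∀ᶠ r : ℝ in 𝓝[>] 0, m ∈ M.le (c - r * x) x := by
  unfold lt at h
  rw [iSup_subtype'] at h
  induction h using Submodule.iSup_induction' with
  | zero => exact Eventually.of_forall fun _ => zero_mem _
  | add a b _ _ ha hb =>
    filter_upwards [ha, hb] with r h1 h2 using add_mem h1 h2
  | mem c' m hm =>
    have h1 : ltAt x c' c := c'.2
    unfold ltAt at h1
    filter_upwards [Ioo_mem_nhdsGT (neg_pos.2 h1)] with r hr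
    refine M.mono (Or.inl ?_) hm
    unfold ltAt
    have : (x : ℂ)⁻¹ * (c' - (c - r * x)) = (x : ℂ)⁻¹ * (c' - c) + (r : ℂ) := by
      have := Circle.coe_ne_zero x
      field_simp
      ring
    rw [this, Complex.add_re, Complex.ofReal_re]
    linarith [hr.2]

theorem exists_mem_le {c : ℂ} {x : Circle} {m : M.stalk x} (h : m ∈ M.lt c x) :
    ∃ c', ltAt x c' c ∧ m ∈ M.le c' x := by
  obtain ⟨r, h1, h2⟩ := ((M.eventually_mem_le h).and self_mem_nhdsWithin).exists
  exact ⟨_, ltAt_sub_mul x c h2, h1⟩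

/-! ### Tensors -/

theorem smul_Gr_eq (x : Circle) (r : ℂ) (m : M.Gr x) :
    r • m = (AddMonoidAlgebra.single 0 r : AddMonoidAlgebra ℂ L) • m := by
  have h : M.GrShift x 0 = LinearMap.id := (M.grAction x).map_one
  rw [single_smul_Gr, h, LinearMap.id_apply]

theorem tmul_algebra_smul {x : Circle} (a : P.Amu x) (r : AddMonoidAlgebra ℂ L) (m : M.Gr x) :
    M.tmul a (r • m) = M.tmul (r • a) m := (TensorProduct.smul_tmul r a m).symm

theorem tmul_smul {x : Circle} (a : P.Amu x) (r : ℂ) (m : M.Gr x) :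
    M.tmul a (r • m) = M.tmul (r • a) m := by
  rw [smul_Gr_eq, tmul_algebra_smul, P.single_smul, P.u_zero, one_mul]

theorem tmul_add {x : Circle} (a : P.Amu x) (m n : M.Gr x) :
    M.tmul a (m + n) = M.tmul a m + M.tmul a n := TensorProduct.tmul_add a m n

theorem tmul_zero {x : Circle} (a : P.Amu x) : M.tmul a (0 : M.Gr x) = 0 :=
  TensorProduct.tmul_zero _ a

theorem tmul_eq_smul {x : Circle} (a : P.Amu x) (m : M.Gr x) : M.tmul a m = a • M.tmul 1 m := by
  rw [smul_tmul', mul_one]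

theorem smul_tmul_complex {x : Circle} (r : ℂ) (a : P.Amu x) (m : M.Gr x) :
    r • M.tmul a m = M.tmul (r • a) m := by
  rw [← algebraMap_smul (P.Amu x) r (M.tmul a m), smul_tmul', Algebra.smul_def]

theorem exists_shift {x : Circle} {k : ℂ} {γ : L} (g : M.gr (k + P.μ γ) x) :
    ∃ g' : M.gr k x, g = M.grShift γ k x g' := by
  obtain ⟨⟨m, hm⟩, rfl⟩ := Submodule.Quotient.mk_surjective _ g
  obtain ⟨m', hm', rfl⟩ := (M.shift γ k x m).1 hm
  exact ⟨M.grMk k x ⟨m', hm'⟩, rfl⟩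

/-- This trades a shift of degree for a factor `u^γ` in the coefficient; with it every degree in `-C
+ μ(L)` is brought back to `-C`. -/
theorem tmul_grShift {x : Circle} (a : P.Amu x) (γ : L) (k : ℂ) (g : M.gr k x) :
    M.tmul a (M.grIncl _ x (M.grShift γ k x g)) = M.tmul (P.u x γ * a) (M.grIncl k x g) := by
  have : M.grIncl _ x (M.grShift γ k x g) =
      (AddMonoidAlgebra.single γ 1 : AddMonoidAlgebra ℂ L) • M.grIncl k x g := by
    rw [single_smul_Gr, one_smul, GrShift_grIncl]
  rw [this, tmul_algebra_smul, P.single_smul, one_smul]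

theorem tmul_frame {x : Circle} {n : ℕ} {k : ℂ} (φ : (Fin n → ℂ) →ₗ[ℂ] M.gr k x) (a : P.Amu x)
    (v : Fin n → ℂ) : M.tmul a (M.grIncl k x (φ v)) =
      ∑ i, (v i • a) • M.tmul 1 (M.grIncl k x (φ (Pi.single i 1))) := by
  have h : ∀ w : Fin n → ℂ, ∀ S : Finset (Fin n),
      M.tmul a (∑ i ∈ S, w i • M.grIncl k x (φ (Pi.single i 1))) =
        ∑ i ∈ S, (w i • a) • M.tmul 1 (M.grIncl k x (φ (Pi.single i 1))) := by
    classical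
    intro w S
    induction S using Finset.induction_on with
    | empty => exact M.tmul_zero a
    | insert i S hi ih => rw [Finset.sum_insert hi, Finset.sum_insert hi, tmul_add, ih, tmul_smul,
        tmul_eq_smul]
  rw [← h, LinearMap.pi_apply_eq_sum_univ φ v, map_sum]
  congr 1
  refine Finset.sum_congr rfl fun i _ => ?_
  rw [map_smul]
  congr 4
  funext j
  simp [Pi.single_apply, eq_comm]

theorem isSec_unit {c : ℂ} {s : ∀ y, M.gr c y} {x : Circle} (hs : (M.grSheaf c).IsSec s x) :
    M.tens.sheaf.IsSec (fun y => M.tmul 1 (M.grIncl c y (s y))) x := by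
  have h := M.isSec_tmul (P.isSec_u 0 x) (M.isSec_grIncl hs)
  simp only [P.u_zero] at h
  exact h

variable {M}

/-- In the stalk at `x` of an object of `Be_{C,μ}`, every tensor of degree at most `b` is a combination
of the `1 ⊗ m` with `m` homogeneous of degree `-k`, `k ∈ C`. -/
theorem tens_le_induction {C : Finset ℂ} (hM : M.IsBetti C) {x : Circle} {b : ℂ}
    {p : M.tensModule.stalk x → Prop} (h0 : p 0) (hadd : ∀ t t', p t → p t' → p (t + t'))
    (htmul : ∀ k ∈ C, ∀ (d : ℂ) (a : P.Amu x) (g : M.gr (-k) x), a ∈ P.AmuLE d x →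
      leAt x (d + -k) b → p (M.tmul a (M.grIncl (-k) x g)))
    {t : M.tensModule.stalk x} (ht : t ∈ M.tensLE b x) : p t := by
  -- The property `p` is not assumed stable under scalars, so the scalar is moved into the
  -- coefficient and only additive closure is needed.
  have hmem : ∀ (r : ℂ), ∀ t ∈ {t : M.tensModule.stalk x | ∃ (c' c'' : ℂ) (a : P.Amu x) (m : M.gr c'' x),
      leAt x (c' + c'') b ∧ a ∈ P.AmuLE c' x ∧ t = M.tmul a (M.grIncl c'' x m)}, p (r • t) := by
    rintro r _ ⟨c', c'', a, m, hc, ha, rfl⟩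
    rw [smul_tmul_complex]
    by_cases hm : m = 0
    · rw [hm, map_zero, tmul_zero]; exact h0
    obtain ⟨k, hk, γ, rfl⟩ := hM.exponents c'' x ⟨⟨m, 0, hm⟩⟩
    -- The degree is `-k + μ(γ)`; writing the homogeneous element as `u^γ g'` puts it in degree
    -- `-k`.
    obtain ⟨g', rfl⟩ := M.exists_shift m
    rw [tmul_grShift]
    refine htmul k hk (P.μ γ + c') _ g' (P.AmuLE_mul (P.u_mem x γ) (Submodule.smul_mem _ r ha)) ?_
    have : P.μ γ + c' + -k = c' + (-k + P.μ γ) := by ring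
    rw [this]
    exact hc
  refine Submodule.closure_induction (p := fun t _ => p t) h0 (fun t t' _ _ => hadd t t') hmem ht

/-- The axioms of a filtered module only give stability under `𝒜_μ^{≤ 0}`. For general degrees the
property is evident on the tensor model and is carried over by a local splitting. -/
theorem IsBetti.smul_mem_le {C : Finset ℂ} (hM : M.IsBetti C) {x : Circle} {c d : ℂ} {a : P.Amu x}
    {m : M.stalk x} (ha : a ∈ P.AmuLE d x) (hm : m ∈ M.le c x) : a • m ∈ M.le (c + d) x := by
  obtain ⟨V, hx, η, -⟩ := hM.splitting x
  have h : a • η.symm.equiv ⟨x, hx⟩ m ∈ M.tens.le (c + d) x := M.tensLE_smul ha ((η.symm.mem_le ⟨x, hx⟩ c m).2 hm)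
  have h1 := (η.mem_le ⟨x, hx⟩ (c + d) _).2 h
  rw [map_smul] at h1
  have h2 : η.equiv ⟨x, hx⟩ (η.symm.equiv ⟨x, hx⟩ m) = m := LinearEquiv.apply_symm_apply _ _
  rwa [h2] at h1

/-! ### Automorphisms acting trivially on the graded pieces -/

variable (M) in
/-- The automorphism `e` of the stalk at `x` acts as the identity on the graded pieces. -/
def GrTrivial {x : Circle} (e : M.stalk x ≃ₗ[P.Amu x] M.stalk x) : Prop :=
  ∀ (c : ℂ) (m : M.stalk x), m ∈ M.le c x → e m - m ∈ M.lt c x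

/-- Near `x` the module is generated by the images under a splitting of frames of `gr_{-k}`, `k ∈
C`, a finite set. On each generator `e - id` lowers the degree, so one `r` works for all of them at
`x`, then nearby by openness, and finally for every element by `𝒜_μ`-linearity. -/
theorem endLTZero_of_grTrivial {C : Finset ℂ} (hM : M.IsBetti C) {U : Opens Circle}
    (e : FilteredIso U M M) (he : ∀ x, M.GrTrivial (e.equiv x)) :
    EndLTZero (AutFamily.toEnd (M := M) e.equiv - 1) := by
  classical
  rw [endLTZero_iff]
  intro x
  obtain ⟨V, hxV, η, -⟩ := hM.splitting x
  choose n φ hφ using fun c => hM.isLocalSystem c x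
  -- The sections `E` are the generators and the sections `D` below are their images under `e - id`.
  let E : ∀ c, Fin (n c) → ∀ y, M.stalk y := fun c i y =>
    if hy : y ∈ V then η.equiv ⟨y, hy⟩ (M.tmul 1 (M.grIncl c y (φ c y (Pi.single i 1)))) else 0
  have hE : ∀ c i, M.sheaf.IsSec (E c i) x := fun c i =>
    η.isMorphism ⟨x, hxV⟩ _ _ (M.isSec_unit ((hφ c).self_of_nhds.2 (Pi.single i 1)))
      (Eventually.of_forall fun y hy => dif_pos hy)
  let D : ∀ c, Fin (n c) → ∀ y, M.stalk y := fun c i y =>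
    if hy : y ∈ U then e.equiv ⟨y, hy⟩ (E c i y) - E c i y else 0
  have hmor : IsMorphism fun x : U => (e.equiv x).toLinearMap - LinearMap.id :=
    e.isMorphism.sub (IsMorphism.id U M)
  have hD : ∀ c i, M.sheaf.IsSec (D c i) x := fun c i =>
    hmor x _ _ (hE c i) (Eventually.of_forall fun y hy => dif_pos hy)
  have hDlt : ∀ c i, D c i x ∈ M.lt c x := fun c i => by
    simp only [D, E, dif_pos x.2, dif_pos hxV]
    exact he x c _ ((η.mem_le ⟨x, hxV⟩ c _).2 (M.unitTensor_mem c x _))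
  -- Finiteness of `C` and of the frames allows a single `r` for all the generators.
  have hr : ∀ᶠ r : ℝ in 𝓝[>] 0, ∀ k ∈ C, ∀ i, D (-k) i x ∈ M.le (-k - r * x) x :=
    (Filter.eventually_all_finset C).2 fun k _ => eventually_all.2 fun i =>
      M.eventually_mem_le (hDlt (-k) i)
  obtain ⟨r, hr, hr0⟩ := (hr.and self_mem_nhdsWithin).exists
  have hy1 : ∀ᶠ y in 𝓝 (x : Circle), ∀ k ∈ C, ∀ i, D (-k) i y ∈ M.le (-k - r * x) y :=
    (Filter.eventually_all_finset C).2 fun k hk => eventually_all.2 fun i =>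
      M.le_eventually (hD (-k) i) (hr k hk i)
  have hy2 : ∀ᶠ y in 𝓝 (x : Circle), ∀ k ∈ C, Function.Bijective (φ (-k) y) :=
    (Filter.eventually_all_finset C).2 fun k _ => (hφ (-k)).mono fun y h => h.1
  obtain ⟨T, hT, hTo, hxT⟩ := mem_nhds_iff.1 ((hy1.and hy2).and
    ((show ∀ᶠ y in 𝓝 (x : Circle), y ∈ U from U.isOpen.mem_nhds x.2).and
      (show ∀ᶠ y in 𝓝 (x : Circle), y ∈ V from V.isOpen.mem_nhds hxV)))
  have hTU : (⟨T, hTo⟩ : Opens Circle) ≤ U := fun y hy => (hT hy).2.1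
  refine ⟨-(r * x), ?_, ⟨T, hTo⟩, hTU, hxT, hmor.res hTU, ?_⟩
  · have := ltAt_sub_mul x 0 hr0
    rwa [zero_sub] at this
  intro y b m hm
  obtain ⟨⟨h1, h2⟩, hyU, hyV⟩ := hT y.2
  -- Composing with the splitting reduces the claim to tensors, where `tens_le_induction` leaves
  -- only `a ⊗ g` with `g` in a degree `-k`.
  let ℓ : M.tensModule.stalk y →ₗ[P.Amu y] M.stalk y :=
    ((e.equiv ⟨y, hyU⟩).toLinearMap - LinearMap.id).comp (η.equiv ⟨y, hyV⟩).toLinearMap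
  suffices H : ∀ t ∈ M.tensLE b y, ℓ t ∈ M.le (b + -(r * x)) y by
    have h3 := H _ ((η.symm.mem_le ⟨y, hyV⟩ b m).2 hm)
    have h4 : η.equiv ⟨y, hyV⟩ (η.symm.equiv ⟨y, hyV⟩ m) = m := LinearEquiv.apply_symm_apply _ _
    have h5 : ℓ (η.symm.equiv ⟨y, hyV⟩ m) = e.equiv ⟨y, hyU⟩ m - m := by
      show e.equiv ⟨y, hyU⟩ (η.equiv ⟨y, hyV⟩ (η.symm.equiv ⟨y, hyV⟩ m)) - η.equiv ⟨y, hyV⟩ (η.symm.equiv ⟨y, hyV⟩ m) = _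
      rw [h4]
    rw [h5] at h3
    exact h3
  intro t ht
  refine tens_le_induction (p := fun t => ℓ t ∈ M.le (b + -(r * x)) y) hM ?_ ?_ ?_ ht
  · rw [map_zero]; exact zero_mem _
  · intro t t' h3 h4
    rw [map_add]; exact add_mem h3 h4
  · intro k hk d a g ha hd
    obtain ⟨v, rfl⟩ := (h2 k hk).2 g
    rw [tmul_frame, map_sum]
    refine sum_mem fun i _ => ?_
    rw [map_smul]
    have h3 : ℓ (M.tmul 1 (M.grIncl (-k) y (φ (-k) y (Pi.single i 1)))) = D (-k) i y := by
      simp only [D, E, dif_pos hyU, dif_pos hyV]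
      rfl
    rw [h3]
    refine M.mono ?_ (hM.smul_mem_le (Submodule.smul_mem _ (v i) ha) (h1 k hk i))
    have h4 : -k - r * x + d = d + -k + -(r * x) := by ring
    rw [h4]
    exact PeriodMap.leAt_add hd (leAt_refl _ _)

end FilteredModule

end

end BettiStokes

/-! ### Homogeneous components and rigidity over the whole circle -/

namespace BettiStokes

noncomputable section

variable {L : Type} [AddCommGroup L] [Module.Finite ℤ L] {P : PeriodMap L}

namespace FilteredModule

variable (M : FilteredModule P)

theorem grIncl_apply_self (c : ℂ) (x : Circle) (m : M.gr c x) : M.grIncl c x m c = m :=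
  DirectSum.of_eq_same (β := fun c => M.gr c x) c m

theorem grIncl_apply_ne {c d : ℂ} (h : c ≠ d) (x : Circle) (m : M.gr c x) :
    M.grIncl c x m d = 0 :=
  DirectSum.of_eq_of_ne (β := fun c => M.gr c x) c d m h.symm

theorem GrShift_add (x : Circle) (γ δ : L) (m : M.Gr x) :
    M.GrShift x (γ + δ) m = M.GrShift x γ (M.GrShift x δ m) :=
  LinearMap.congr_fun ((M.grAction x).map_mul (Multiplicative.ofAdd γ) (Multiplicative.ofAdd δ)) m

/-- Multiplication by `u^γ` on `gr ℒ` is inverted by `u^{-γ}`. -/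
theorem grShift_eq_zero {γ : L} {c : ℂ} {x : Circle} {m : M.gr c x} (h : M.grShift γ c x m = 0) :
    m = 0 := by
  have h1 : M.grIncl c x m = M.GrShift x (-γ) (M.GrShift x γ (M.grIncl c x m)) := by
    rw [← GrShift_add, neg_add_cancel]
    exact (LinearMap.congr_fun (M.grAction x).map_one _).symm
  rw [GrShift_grIncl, h, map_zero, map_zero] at h1
  rw [← M.grIncl_apply_self c x m, h1]
  rfl

theorem isSec_smul_grShift {c : ℂ} {s : ∀ y, M.gr c y} {x : Circle} (hs : (M.grSheaf c).IsSec s x)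
    (r : ℂ) (γ : L) : (M.grSheaf (c + P.μ γ)).IsSec (fun y => r • M.grShift γ c y (s y)) x := by
  obtain ⟨n, hn, hsn⟩ := hs
  refine ⟨fun y => algebraMap ℂ (P.Amu y) r • P.u y γ • n y,
    M.toModule.isSec_smul (P.isSec_algebraMap r x)
      (M.toModule.isSec_smul (P.isSec_u γ x) hn), ?_⟩
  filter_upwards [hsn] with y ⟨e1, e2⟩
  have e3 : P.u y γ • n y ∈ M.le (c + P.μ γ) y := (M.shift γ c y _).2 ⟨_, e1, rfl⟩
  refine ⟨?_, ?_⟩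
  · rw [algebraMap_smul]; exact (M.le _ _).smul_mem r e3
  · rw [e2, grShift_mk]
    show M.grMk _ _ (r • _) = _
    exact congrArg _ (Subtype.ext (algebraMap_smul (P.Amu y) r (P.u y γ • n y)).symm)

/-! ### Homogeneous components of tensors -/

variable [Module.Free ℤ L]

/-- A homogeneous element of degree `c` reaches degree `d` only when `c + μ(γ) = d`, and injectivity
of `μ` leaves at most one such `γ`. This makes the infinite sum over `γ` in a fixed degree a finite
one. -/
theorem finite_GrShift_ne_zero {x : Circle} (d : ℂ) (m : M.Gr x) :
    {γ | M.GrShift x γ m d ≠ 0}.Finite := by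
  induction m using DirectSum.induction_on with
  | zero =>
    refine Set.finite_empty.subset fun γ hγ => hγ ?_
    rw [map_zero]; rfl
  | of c m =>
    refine Set.Subsingleton.finite fun γ hγ δ hδ => P.μ_injective ?_
    have key : ∀ γ, M.GrShift x γ (M.grIncl c x m) d ≠ 0 → c + P.μ γ = d := fun γ hγ => by
      by_contra hne
      rw [GrShift_grIncl] at hγ
      exact hγ (M.grIncl_apply_ne hne x _)
    exact add_left_cancel ((key γ hγ).trans (key δ hδ).symm)
  | add a b ha hb =>
    refine (ha.union hb).subset fun γ hγ => ?_
    by_contra hne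
    simp only [Set.mem_union, Set.mem_ofPred_eq, not_or, not_not] at hne
    refine hγ ?_
    rw [map_add, DirectSum.add_apply, hne.1, hne.2, add_zero]

/-- The sum of `coef_γ(a) u^γ m` in degree `d`. -/
def gradedPairing (d : ℂ) (x : Circle) (a : P.Amu x) (m : M.Gr x) : M.gr d x :=
  ∑ᶠ γ, P.coef x a γ • M.GrShift x γ m d

theorem finite_support_pairing (d : ℂ) (x : Circle) (a : P.Amu x) (m : M.Gr x) :
    (Function.support fun γ => P.coef x a γ • M.GrShift x γ m d).Finite :=
  (M.finite_GrShift_ne_zero d m).subset fun γ hγ h0 => hγ (by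
    show P.coef x a γ • M.GrShift x γ m d = 0
    rw [h0, smul_zero])

theorem gradedPairing_add_right (d : ℂ) (x : Circle) (a : P.Amu x) (m n : M.Gr x) :
    M.gradedPairing d x a (m + n) = M.gradedPairing d x a m + M.gradedPairing d x a n := by
  unfold gradedPairing
  rw [← finsum_add_distrib (M.finite_support_pairing d x a m) (M.finite_support_pairing d x a n)]
  refine finsum_congr fun γ => ?_
  rw [map_add, DirectSum.add_apply, smul_add]

theorem gradedPairing_add_left (d : ℂ) (x : Circle) (a b : P.Amu x) (m : M.Gr x) :
    M.gradedPairing d x (a + b) m = M.gradedPairing d x a m + M.gradedPairing d x b m := by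
  unfold gradedPairing
  rw [← finsum_add_distrib (M.finite_support_pairing d x a m) (M.finite_support_pairing d x b m)]
  refine finsum_congr fun γ => ?_
  rw [map_add, Pi.add_apply, add_smul]

theorem gradedPairing_smul_left (d : ℂ) (x : Circle) (r : ℂ) (a : P.Amu x) (m : M.Gr x) :
    M.gradedPairing d x (r • a) m = r • M.gradedPairing d x a m := by
  unfold gradedPairing
  rw [smul_finsum' r (M.finite_support_pairing d x a m)]
  refine finsum_congr fun γ => ?_
  rw [map_smul, Pi.smul_apply, smul_assoc]

theorem gradedPairing_smul_right (d : ℂ) (x : Circle) (r : ℂ) (a : P.Amu x) (m : M.Gr x) :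
    M.gradedPairing d x a (r • m) = r • M.gradedPairing d x a m := by
  unfold gradedPairing
  rw [smul_finsum' r (M.finite_support_pairing d x a m)]
  refine finsum_congr fun γ => ?_
  rw [map_smul, DirectSum.smul_apply, smul_comm]

theorem gradedPairing_u_mul (d : ℂ) (x : Circle) (δ : L) (a : P.Amu x) (m : M.Gr x) :
    M.gradedPairing d x (P.u x δ * a) m = M.gradedPairing d x a (M.GrShift x δ m) := by
  unfold gradedPairing
  rw [← finsum_comp_equiv (Equiv.addRight δ)]
  refine finsum_congr fun γ => ?_
  rw [Equiv.coe_addRight]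
  beta_reduce
  rw [P.coef_u_mul, add_sub_cancel_right, GrShift_add]

theorem gradedPairing_zero_right (d : ℂ) (x : Circle) (a : P.Amu x) :
    M.gradedPairing d x a 0 = 0 := by
  simpa using M.gradedPairing_smul_right d x 0 a 0

theorem gradedPairing_zero_left (d : ℂ) (x : Circle) (m : M.Gr x) :
    M.gradedPairing d x 0 m = 0 := by
  simpa using M.gradedPairing_smul_left d x 0 0 m

/-- Translating the summation index moves `u^γ` from one factor to the other. This is what lets the
pairing descend to the tensor product over `ℂ[L]`. -/
theorem gradedPairing_balanced (d : ℂ) (x : Circle) (r : AddMonoidAlgebra ℂ L) (a : P.Amu x)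
    (m : M.Gr x) : M.gradedPairing d x (r • a) m = M.gradedPairing d x a (r • m) := by
  induction r using AddMonoidAlgebra.induction_linear with
  | zero => rw [zero_smul, zero_smul, gradedPairing_zero_left, gradedPairing_zero_right]
  | add f g hf hg =>
    rw [add_smul, add_smul, gradedPairing_add_left, gradedPairing_add_right, hf, hg]
  | single γ r =>
    rw [P.single_smul, single_smul_Gr, gradedPairing_smul_left, gradedPairing_smul_right,
      gradedPairing_u_mul]

/-- The component in `gr_d` of an element of the stalk of `𝒜_μ ⊗ gr ℒ`, through the expansions of
the elements of `𝒜_μ`. -/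
def component (d : ℂ) (x : Circle) : M.tensModule.stalk x →+ M.gr d x :=
  TensorProduct.liftAddHom (R := AddMonoidAlgebra ℂ L) (M := P.Amu x) (N := M.Gr x)
    (AddMonoidHom.mk' (fun a => AddMonoidHom.mk' (M.gradedPairing d x a)
      (M.gradedPairing_add_right d x a))
      (fun a b => AddMonoidHom.ext fun m => M.gradedPairing_add_left d x a b m))
    (fun r a m => M.gradedPairing_balanced d x r a m)

theorem component_tmul (d : ℂ) (x : Circle) (a : P.Amu x) (m : M.Gr x) :
    M.component d x (M.tmul a m) = M.gradedPairing d x a m := rfl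

theorem component_smul (d : ℂ) (x : Circle) (r : ℂ) (t : M.tensModule.stalk x) :
    M.component d x (r • t) = r • M.component d x t := by
  have hind : ∀ t : M.tensStalk x, M.component d x (r • (show M.tensModule.stalk x from t)) =
      r • M.component d x (show M.tensModule.stalk x from t) := by
    intro t
    induction t using TensorProduct.induction_on with
    | zero =>
      show M.component d x (r • (0 : M.tensModule.stalk x)) = r • M.component d x (0 : M.tensModule.stalk x)
      rw [smul_zero, map_zero, smul_zero]
    | tmul a m =>
      show M.component d x (r • M.tmul a m) = r • M.component d x (M.tmul a m)
      rw [smul_tmul_complex, component_tmul, component_tmul, gradedPairing_smul_left]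
    | add a b ha hb =>
      show M.component d x (r • ((show M.tensModule.stalk x from a) + (show M.tensModule.stalk x from b))) =
        r • M.component d x ((show M.tensModule.stalk x from a) + (show M.tensModule.stalk x from b))
      rw [smul_add, map_add, ha, hb, map_add, smul_add]
  exact hind t

theorem component_tmul_grIncl (x : Circle) (a : P.Amu x) (c : ℂ) (γ : L) (m : M.gr c x) :
    M.component (c + P.μ γ) x (M.tmul a (M.grIncl c x m)) = P.coef x a γ • M.grShift γ c x m := by
  rw [component_tmul]
  unfold gradedPairing
  rw [finsum_eq_single _ γ]
  · rw [GrShift_grIncl, grIncl_apply_self]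
  · intro δ hδ
    rw [GrShift_grIncl, grIncl_apply_ne, smul_zero]
    exact fun h => hδ (P.μ_injective (add_left_cancel h))

theorem component_tmul_grIncl_of_ne {c d : ℂ} (h : ∀ γ, c + P.μ γ ≠ d) (x : Circle) (a : P.Amu x)
    (m : M.gr c x) : M.component d x (M.tmul a (M.grIncl c x m)) = 0 := by
  rw [component_tmul]
  unfold gradedPairing
  refine finsum_eq_zero_of_forall_eq_zero fun γ => ?_
  rw [GrShift_grIncl, M.grIncl_apply_ne (h γ), smul_zero]

/-- Coefficients are locally constant, so on a generator `a ⊗ m` with `m` homogeneous the component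
is locally a constant multiple of the section `u^γ m`. -/
theorem isSec_component (d : ℂ) {t : ∀ y, M.tensModule.stalk y} {x : Circle}
    (ht : M.tensModule.sheaf.IsSec t x) : (M.grSheaf d).IsSec (fun y => M.component d y (t y)) x := by
  have hcl : ∀ t ∈ AddSubgroup.closure {t : ∀ y, M.tensModule.stalk y |
      ∃ (a : ∀ y, P.Amu y) (m : ∀ y, M.Gr y), P.AmuSheaf.IsSec a x ∧ M.GrSheaf.IsSec m x ∧
        t = fun y => M.tmul (a y) (m y)}, (M.grSheaf d).IsSec (fun y => M.component d y (t y)) x := by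
    intro t ht
    induction ht using AddSubgroup.closure_induction with
    | zero =>
      refine (M.grSheaf d).isSec_congr (Eventually.of_forall fun y => ?_) ((M.grSheaf d).isSec_zero x)
      exact (map_zero (M.component d y)).symm
    | add a b _ _ ha hb =>
      refine (M.grSheaf d).isSec_congr (Eventually.of_forall fun y => ?_) ((M.grSheaf d).isSec_add ha hb)
      exact (map_add (M.component d y) _ _).symm
    | neg a _ ha =>
      refine (M.grSheaf d).isSec_congr (Eventually.of_forall fun y => ?_) ((M.grSheaf d).isSec_neg ha)
      exact (map_neg (M.component d y) _).symm
    | mem t ht =>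
      obtain ⟨a, m, ha, ⟨m', hm', hmm⟩, rfl⟩ := ht
      suffices H : (M.grSheaf d).IsSec (fun y => M.component d y (M.tmul (a y) (m' y))) x by
        refine (M.grSheaf d).isSec_congr ?_ H
        filter_upwards [hmm] with y hy
        rw [hy]
      clear hmm
      induction hm' using AddSubgroup.closure_induction with
      | zero =>
        refine (M.grSheaf d).isSec_congr (Eventually.of_forall fun y => ?_) ((M.grSheaf d).isSec_zero x)
        rw [component_tmul, Pi.zero_apply, Pi.zero_apply, gradedPairing_zero_right]
      | add b b' _ _ hb hb' =>
        refine (M.grSheaf d).isSec_congr (Eventually.of_forall fun y => ?_) ((M.grSheaf d).isSec_add hb hb')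
        simp only [component_tmul, Pi.add_apply, gradedPairing_add_right]
      | neg b _ hb =>
        refine (M.grSheaf d).isSec_congr (Eventually.of_forall fun y => ?_) ((M.grSheaf d).isSec_neg hb)
        rw [component_tmul, Pi.neg_apply, Pi.neg_apply, ← neg_one_smul ℂ (b y),
          gradedPairing_smul_right, neg_one_smul, component_tmul]
      | mem m' hm' =>
        obtain ⟨c, s, hs, rfl⟩ := hm'
        by_cases h : ∃ γ, c + P.μ γ = d
        · obtain ⟨γ, rfl⟩ := h
          refine (M.grSheaf _).isSec_congr ?_ (M.isSec_smul_grShift hs (P.coef x (a x) γ) γ)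
          filter_upwards [P.coef_eventually ha] with y hy
          rw [component_tmul_grIncl, hy]
        · push Not at h
          refine (M.grSheaf d).isSec_congr (Eventually.of_forall fun y => ?_) ((M.grSheaf d).isSec_zero x)
          rw [M.component_tmul_grIncl_of_ne h]
          rfl
  obtain ⟨t', ht', htt⟩ := ht
  refine (M.grSheaf d).isSec_congr ?_ (hcl t' ht')
  filter_upwards [htt] with y hy
  rw [hy]

variable {M} {C : Finset ℂ}

/-- For `a ⊗ g` with `g` in degree `-k` a nonzero component comes from a nonzero coefficient of `a`,
and the growth of `a` bounds the corresponding exponent. -/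
theorem leAt_of_component_ne_zero (hM : M.IsBetti C) {x : Circle} {b d : ℂ}
    {t : M.tensModule.stalk x} (ht : t ∈ M.tensLE b x) (h : M.component d x t ≠ 0) :
    leAt x d b := by
  by_contra hcon
  refine h (tens_le_induction (p := fun t => M.component d x t = 0) hM (map_zero _)
    (fun t t' h1 h2 => by rw [map_add, h1, h2, add_zero]) ?_ ht)
  intro k hk e a g ha hle
  by_cases hγ : ∃ γ, -k + P.μ γ = d
  · obtain ⟨γ, rfl⟩ := hγ
    rw [component_tmul_grIncl]
    by_cases h0 : P.coef x a γ = 0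
    · rw [h0, zero_smul]
    · refine absurd (leAt_trans ?_ hle) hcon
      rw [add_comm]
      exact PeriodMap.leAt_add (P.leAt_of_coef_ne_zero ha h0) (leAt_refl x _)
  · push Not at hγ
    exact M.component_tmul_grIncl_of_ne hγ x a g

/-- In frames of the `gr_{-k}`, `k ∈ C`, the tensor has coordinates in `𝒜_μ`. The degrees `-k +
μ(γ)` attached to different `k` are disjoint, so each component reads off the coefficients at one
`γ` of the coordinates at one `k`; all of these vanish, hence so do the coordinates. -/
theorem eq_zero_of_component_eq_zero (hM : M.IsBetti C)
    (hC : ∀ c ∈ C, ∀ c' ∈ C, c ≠ c' → ∀ γ : L, c ≠ c' + P.μ γ) {x : Circle} {b : ℂ}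
    {t : M.tensModule.stalk x} (ht : t ∈ M.tensLE b x) (h : ∀ d, M.component d x t = 0) :
    t = 0 := by
  classical
  choose n φ hφ using fun c => hM.isLocalSystem c x
  have hbij : ∀ c, Function.Bijective (φ c x) := fun c => (hφ c).self_of_nhds.1
  obtain ⟨a, rfl⟩ : ∃ a : ∀ c, Fin (n c) → P.Amu x,
      t = ∑ k ∈ C, ∑ i, M.tmul (a (-k) i) (M.grIncl (-k) x (φ (-k) x (Pi.single i 1))) := by
    refine tens_le_induction (p := fun t => ∃ a : ∀ c, Fin (n c) → P.Amu x,
      t = ∑ k ∈ C, ∑ i, M.tmul (a (-k) i) (M.grIncl (-k) x (φ (-k) x (Pi.single i 1)))) hM ?_ ?_ ?_ ht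
    · refine ⟨0, (Finset.sum_eq_zero fun k _ => Finset.sum_eq_zero fun i _ => ?_).symm⟩
      exact TensorProduct.zero_tmul _ _
    · rintro _ _ ⟨a, rfl⟩ ⟨a', rfl⟩
      refine ⟨a + a', ?_⟩
      rw [← Finset.sum_add_distrib]
      refine Finset.sum_congr rfl fun k _ => ?_
      rw [← Finset.sum_add_distrib]
      refine Finset.sum_congr rfl fun i _ => ?_
      exact (TensorProduct.add_tmul _ _ _).symm
    · intro k hk d a g ha hle
      obtain ⟨v, rfl⟩ := (hbij (-k)).2 g
      refine ⟨Pi.single (-k) fun i => v i • a, ?_⟩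
      rw [Finset.sum_eq_single_of_mem k hk, Pi.single_eq_same, tmul_frame]
      · exact Finset.sum_congr rfl fun i _ => (M.tmul_eq_smul _ _).symm
      · intro k' _ hne
        rw [Pi.single_eq_of_ne (fun h => hne (neg_injective h))]
        exact Finset.sum_eq_zero fun i _ => TensorProduct.zero_tmul _ _
  have ha : ∀ k ∈ C, ∀ i, a (-k) i = 0 := by
    intro k hk i
    refine P.eq_zero_of_coef_eq_zero fun γ => ?_
    have h1 := h (-k + P.μ γ)
    rw [map_sum, Finset.sum_eq_single_of_mem k hk, map_sum] at h1
    · simp only [component_tmul_grIncl] at h1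
      -- The vector of the `γ`-coefficients is killed by the composite of the frame and `u^γ`, both
      -- of which are injective.
      have h2 : M.grShift γ (-k) x (φ (-k) x fun i => P.coef x (a (-k) i) γ) = 0 := by
        rw [← h1, LinearMap.pi_apply_eq_sum_univ (φ (-k) x), map_sum]
        refine Finset.sum_congr rfl fun i _ => ?_
        rw [map_smul]
        congr 3
        funext j
        simp [Pi.single_apply, eq_comm]
      exact congrFun ((map_eq_zero_iff _ (hbij (-k)).1).1 (M.grShift_eq_zero h2)) i
    · intro k' hk' hne
      rw [map_sum]
      refine Finset.sum_eq_zero fun i _ => M.component_tmul_grIncl_of_ne (fun γ' he => ?_) x _ _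
      refine hC k' hk' k hk hne (γ' - γ) ?_
      rw [map_sub]
      linear_combination -he
  refine Finset.sum_eq_zero fun k hk => Finset.sum_eq_zero fun i _ => ?_
  rw [ha k hk i]
  exact TensorProduct.zero_tmul _ _

/-- The real part of `x⁻¹ (d - c)` changes sign between the opposite points `1` and `-1`. -/
theorem exists_not_ltAt (c d : ℂ) : ∃ x : Circle, ¬ ltAt x d c := by
  by_contra! h
  have h1 := h 1
  have h2 := h (Circle.exp Real.pi)
  unfold ltAt at h1 h2
  rw [Circle.coe_exp, Complex.exp_pi_mul_I] at h2
  rw [Circle.coe_one] at h1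
  norm_num at h1 h2
  linarith

/-- A homomorphism from the local system `gr_c ℒ` to `(𝒜_μ ⊗ gr 𝒩)_{< c}` over the whole circle
vanishes. -/
theorem eq_zero_of_mem_lt {N : FilteredModule P} {c : ℂ} (hM : M.GrIsLocalSystem c)
    (hN : N.IsBetti C) (hC : ∀ c ∈ C, ∀ c' ∈ C, c ≠ c' → ∀ γ : L, c ≠ c' + P.μ γ)
    (D : ∀ x, M.gr c x →ₗ[ℂ] N.tensModule.stalk x)
    (hD : ∀ s x, (M.grSheaf c).IsSec s x → N.tensModule.sheaf.IsSec (fun y => D y (s y)) x)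
    (hlt : ∀ x m, D x m ∈ N.tens.lt c x) (x : Circle) (m : M.gr c x) : D x m = 0 := by
  refine eq_zero_of_component_eq_zero (b := c) hN hC (N.tens.lt_le c x (hlt x m)) fun d => ?_
  let T : ∀ y, M.gr c y →ₗ[ℂ] N.gr d y := fun y =>
    { toFun := fun m => N.component d y (D y m)
      map_add' := fun m m' => by rw [map_add, map_add]
      map_smul' := fun r m => by rw [map_smul, component_smul, RingHom.id_apply] }
  have hT : ∀ s y, (M.grSheaf c).IsSec s y → (N.grSheaf d).IsSec (fun y => T y (s y)) y :=
    fun s y hs => N.isSec_component d (hD s y hs)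
  -- Vanishing at `y` on a finite frame spreads to a neighbourhood, because sections agreeing at a
  -- point agree nearby.
  have hopen : IsOpen {y | T y = 0} := by
    rw [isOpen_iff_mem_nhds]
    intro y hy
    obtain ⟨n, φ, hφ⟩ := hM y
    have h1 : ∀ᶠ y' in 𝓝 y, ∀ i, T y' (φ y' (Pi.single i 1)) = 0 :=
      eventually_all.2 fun i => (N.grSheaf d).eventually_eq (hT _ _ (hφ.self_of_nhds.2 _))
        ((N.grSheaf d).isSec_zero y) (by rw [show T y = 0 from hy]; rfl)
    filter_upwards [h1, hφ] with y' h2 h3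
    refine LinearMap.ext fun m => ?_
    obtain ⟨v, rfl⟩ := h3.1.2 m
    have h4 : (T y').comp (φ y') = 0 := LinearMap.pi_ext' fun i => LinearMap.ext_ring (h2 i)
    exact LinearMap.congr_fun h4 v
  -- A nonzero value is the value at `y` of a nonzero constant section of `gr_d`, which stays
  -- nonzero nearby.
  have hclosed : IsClosed {y | T y = 0} := by
    rw [← isOpen_compl_iff, isOpen_iff_mem_nhds]
    intro y hy
    obtain ⟨m, hm⟩ : ∃ m, T y m ≠ 0 := by
      by_contra! h
      exact hy (LinearMap.ext h)
    obtain ⟨n, φ, hφ⟩ := hM y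
    obtain ⟨n', ψ, hψ⟩ := hN.isLocalSystem d y
    obtain ⟨v, rfl⟩ := hφ.self_of_nhds.1.2 m
    obtain ⟨w, hw⟩ := hψ.self_of_nhds.1.2 (T y (φ y v))
    have hw0 : w ≠ 0 := by
      rintro rfl
      rw [map_zero] at hw
      exact hm hw.symm
    have h1 := (N.grSheaf d).eventually_eq (hψ.self_of_nhds.2 w) (hT _ _ (hφ.self_of_nhds.2 v)) hw
    filter_upwards [h1, hψ] with y' h2 h3 h4
    have h5 : T y' = 0 := h4
    rw [h5, LinearMap.zero_apply] at h2
    exact hw0 ((map_eq_zero_iff _ h3.1.1).1 h2)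
  -- At a direction where `d` is not below `c`, the image lies in some `ℒ_{≤ c'}` with `c' <_θ c`,
  -- so it has no component in degree `d`. Connectedness of the circle then finishes the argument.
  obtain ⟨y, hy⟩ := exists_not_ltAt c d
  have hne : y ∈ {y | T y = 0} := by
    refine LinearMap.ext fun m => ?_
    by_contra hm
    obtain ⟨c', hc', hmem⟩ := N.tens.exists_mem_le (hlt y m)
    have h1 := leAt_of_component_ne_zero (d := d) hN hmem hm
    apply hy
    rcases h1 with h1 | rfl
    · rw [ltAt_iff] at h1 hc' ⊢
      exact h1.trans hc'
    · exact hc'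
  have huniv := IsClopen.eq_univ ⟨hclosed, hopen⟩ ⟨y, hne⟩
  have hx : x ∈ {y | T y = 0} := huniv ▸ Set.mem_univ x
  exact LinearMap.congr_fun hx m

end FilteredModule

end

end BettiStokes

/-! ### Splittings, their transition cocycles, and independence of choices -/

namespace BettiStokes

noncomputable section

variable {L : Type} [AddCommGroup L] [Module.Finite ℤ L] {P : PeriodMap L}

namespace FilteredIso

variable {U V : Opens Circle} {M N K : FilteredModule P}

/-- Restriction of an isomorphism to a smaller open set. -/
def res (h : V ≤ U) (e : FilteredIso U M N) : FilteredIso V M N where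
  equiv x := e.equiv ⟨x, h x.2⟩
  isMorphism := e.isMorphism.res h
  isMorphism_symm := e.isMorphism_symm.res h
  mem_le x c m := e.mem_le ⟨x, h x.2⟩ c m

theorem sub_mem_lt (e : FilteredIso U M N) {x : U} {c : ℂ} {m m' : M.stalk x}
    (h : m - m' ∈ M.lt c x) : e.equiv x m - e.equiv x m' ∈ N.lt c x := by
  rw [← map_sub]
  exact e.mem_lt h

theorem isSec_gr (e : FilteredIso U M N) {x : U} {c : ℂ} {s : ∀ y, M.gr c y} {t : ∀ y, N.gr c y}
    (hs : (M.grSheaf c).IsSec s x)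
    (ht : ∀ᶠ y in 𝓝 (x : Circle), ∀ hy : y ∈ U, t y = e.gr ⟨y, hy⟩ c (s y)) :
    (N.grSheaf c).IsSec t x := by
  classical
  obtain ⟨m, hm, hsm⟩ := hs
  refine ⟨fun y => if hy : y ∈ U then e.equiv ⟨y, hy⟩ (m y) else 0,
    e.isMorphism x m _ hm (Eventually.of_forall fun y hy => dif_pos hy), ?_⟩
  filter_upwards [hsm, ht, U.isOpen.mem_nhds x.2] with y ⟨h1, h2⟩ h3 hy
  have hy' : y ∈ U := hy
  have h4 : (if hy : y ∈ U then e.equiv ⟨y, hy⟩ (m y) else 0) ∈ N.le c y := by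
    rw [dif_pos hy']
    exact (e.mem_le ⟨y, hy'⟩ c _).2 h1
  refine ⟨h4, ?_⟩
  rw [h3 hy', h2, gr_grMk]
  congr 1
  refine Subtype.ext ?_
  show _ = dite _ _ _
  rw [dif_pos hy']

/-- Gluing of isomorphisms which agree on the overlaps. -/
theorem exists_glue {κ : Type} {W : κ → Opens Circle} (hW : ∀ x, ∃ k, x ∈ W k)
    (f : ∀ k, FilteredIso (W k) M N)
    (hf : ∀ k l (x : Circle) (hk : x ∈ W k) (hl : x ∈ W l),
      (f k).equiv ⟨x, hk⟩ = (f l).equiv ⟨x, hl⟩) :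
    ∃ e : FilteredIso ⊤ M N, ∀ k (x : Circle) (hk : x ∈ W k),
      e.equiv ⟨x, trivial⟩ = (f k).equiv ⟨x, hk⟩ := by
  choose k hk using hW
  have key : ∀ (l : κ) (y : Circle) (hy : y ∈ W l),
      (f (k y)).equiv ⟨y, hk y⟩ = (f l).equiv ⟨y, hy⟩ := fun l y hy => hf _ _ _ _ _
  refine ⟨{ equiv := fun x => (f (k x)).equiv ⟨x, hk x⟩
            isMorphism := IsMorphism.of_local fun x => ⟨W (k x), le_top, hk x, ?_⟩
            isMorphism_symm := IsMorphism.of_local fun x => ⟨W (k x), le_top, hk x, ?_⟩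
            mem_le := fun x c m => (f (k x)).mem_le ⟨x, hk x⟩ c m }, fun l x hl => key l x hl⟩
  · have h := (f (k x)).isMorphism
    convert h using 2 with y
    exact congrArg LinearEquiv.toLinearMap (key (k x) y y.2)
  · have h := (f (k x)).isMorphism_symm
    convert h using 2 with y
    exact congrArg (fun e => LinearEquiv.toLinearMap (LinearEquiv.symm e)) (key (k x) y y.2)

end FilteredIso

namespace FilteredModule

variable {U V : Opens Circle} {M N : FilteredModule P}

/-! ### Splittings -/

/-- This is `gr(η) = id` as a congruence modulo `ℒ_{<c}`, the form in which splittings are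
manipulated below. -/
theorem IsSplitting.sub_mem_lt {η : FilteredIso U M.tens M} (hη : IsSplitting η) (x : U) (c : ℂ)
    (m : M.le c x) : η.equiv x (M.unitTensor c x (M.grMk c x m)) - m ∈ M.lt c x := by
  have h := hη x c (M.grMk c x m)
  unfold grUnit at h
  rw [FilteredIso.gr_grMk, grMk_eq] at h
  exact h

theorem isSplitting_of_sub_mem_lt {η : FilteredIso U M.tens M}
    (h : ∀ (x : U) (c : ℂ) (m : M.le c x),
      η.equiv x (M.unitTensor c x (M.grMk c x m)) - m ∈ M.lt c x) : IsSplitting η := by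
  intro x c m
  obtain ⟨m, rfl⟩ := Submodule.Quotient.mk_surjective _ m
  show η.gr x c (M.grUnit c x (M.grMk c x m)) = M.grMk c x m
  unfold grUnit
  rw [FilteredIso.gr_grMk, grMk_eq]
  exact h x c m

theorem IsSplitting.res {η : FilteredIso U M.tens M} (hη : IsSplitting η) (h : V ≤ U) :
    IsSplitting (η.res h) := fun x c m => hη ⟨x, h x.2⟩ c m

/-- The existence of a splitting forces `gr_c ℒ → gr_c (𝒜_μ ⊗ gr ℒ)` to be surjective: the class of
`η t` is a preimage of that of `t`. -/
theorem IsSplitting.exists_unitTensor {η : FilteredIso U M.tens M} (hη : IsSplitting η) {x : U}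
    {c : ℂ} {t : M.tens.stalk x} (ht : t ∈ M.tens.le c x) :
    ∃ m : M.le c x, t - (M.unitTensor c x (M.grMk c x m) : M.tens.stalk x) ∈ M.tens.lt c x := by
  refine ⟨⟨η.equiv x t, (η.mem_le x c t).2 ht⟩, ?_⟩
  have h := hη.sub_mem_lt x c ⟨η.equiv x t, (η.mem_le x c t).2 ht⟩
  have h1 := η.symm.mem_lt h
  rw [map_sub] at h1
  have h2 : ∀ t, η.symm.equiv x (η.equiv x t) = t := fun t => LinearEquiv.symm_apply_apply _ _
  rw [h2, h2] at h1
  rw [← neg_sub]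
  exact neg_mem h1

theorem IsSplitting.symm_sub_mem_lt {η : FilteredIso U M.tens M} (hη : IsSplitting η) (x : U) (c : ℂ)
    (m : M.le c x) : (η.equiv x).symm m - (M.unitTensor c x (M.grMk c x m) : M.tens.stalk x) ∈
      M.tens.lt c x := by
  have h1 := η.symm.mem_lt (hη.sub_mem_lt x c m)
  rw [map_sub] at h1
  have h2 : ∀ t, η.symm.equiv x (η.equiv x t) = t := fun t => LinearEquiv.symm_apply_apply _ _
  rw [h2] at h1
  rw [← neg_sub]
  exact neg_mem h1

theorem GrTrivial.symm {e : FilteredIso U M M} {x : U} (he : M.GrTrivial (e.equiv x)) :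
    M.GrTrivial (e.symm.equiv x) := by
  intro c m hm
  have h := he c _ ((e.symm.mem_le x c m).2 hm)
  have h2 : e.equiv x (e.symm.equiv x m) = m := LinearEquiv.apply_symm_apply _ _
  rw [h2] at h
  rw [← neg_sub]
  exact neg_mem h

theorem GrTrivial.conj {x : U} {e : M.stalk x ≃ₗ[P.Amu x] M.stalk x} (he : M.GrTrivial e)
    (f : FilteredIso U M N) :
    N.GrTrivial (((f.equiv x).symm.trans e).trans (f.equiv x)) := by
  intro c m hm
  have h := f.mem_lt (he c _ ((f.symm.mem_le x c m).2 hm))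
  rw [map_sub] at h
  have h2 : f.equiv x (f.symm.equiv x m) = m := LinearEquiv.apply_symm_apply _ _
  rw [h2] at h
  exact h

/-- Modulo lower degree `t` is `1 ⊗ [m]`, which both splittings send to `m`. -/
theorem IsSplitting.grTrivial {η η' : FilteredIso U M.tens M} (hη : IsSplitting η)
    (hη' : IsSplitting η') (x : U) :
    M.tens.GrTrivial ((η'.equiv x).trans (η.equiv x).symm) := by
  intro c t ht
  obtain ⟨m, hm⟩ := hη.exists_unitTensor ht
  have h1 := η'.sub_mem_lt hm
  have h2 := add_mem h1 (hη'.sub_mem_lt x c m)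
  rw [sub_add_sub_cancel] at h2
  have h3 := sub_mem (add_mem (η.symm.sub_mem_lt h2) (hη.symm_sub_mem_lt x c m)) hm
  convert h3 using 1
  rw [LinearEquiv.trans_apply]
  show _ = (η.equiv x).symm _ - (η.equiv x).symm _ + _ - _
  abel

/-! ### Sections of the sheaf of automorphisms -/

theorem EndLTZero.apply_mem_lt {φ : M.EndFamily U} (hφ : EndLTZero φ) {x : U} {b : ℂ}
    {m : M.stalk x} (hm : m ∈ M.le b x) : φ x m ∈ M.lt b x := by
  obtain ⟨c, hc, V, hV, hx, h⟩ := endLTZero_iff.1 hφ x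
  refine M.le_le_lt ?_ (h.2 ⟨x, hx⟩ b m hm)
  unfold ltAt at hc ⊢
  rwa [add_sub_cancel_left, ← sub_zero c]

theorem EndLTZero.isMorphism {φ : M.EndFamily U} (hφ : EndLTZero φ) : IsMorphism φ := by
  refine IsMorphism.of_local fun x => ?_
  obtain ⟨c, hc, V, hV, hx, h⟩ := endLTZero_iff.1 hφ x
  exact ⟨V, hV, hx, h.1⟩

theorem autEval_sub_mem_lt (g : M.autSheaf.obj (Opposite.op U)) {x : U} {b : ℂ} {m : M.stalk x}
    (hm : m ∈ M.le b x) : autEval g x m - m ∈ M.lt b x :=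
  EndLTZero.apply_mem_lt (show M.autLTZero U from g).2.1 hm

/-- Continuity is known for `g - id`, being a local property of sections of `End^{<0}`, and adding
the identity preserves it. -/
theorem isMorphism_autEval (g : M.autSheaf.obj (Opposite.op U)) :
    IsMorphism fun x => (autEval g x).toLinearMap := by
  have h := (EndLTZero.isMorphism (show M.autLTZero U from g).2.1).add (IsMorphism.id U M)
  convert h using 2 with x
  refine LinearMap.ext fun m => ?_
  show autEval g x m = (autEval g x m - m) + m
  rw [sub_add_cancel]

theorem autEval_mem_le (g : M.autSheaf.obj (Opposite.op U)) {x : U} {b : ℂ} {m : M.stalk x}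
    (hm : m ∈ M.le b x) : autEval g x m ∈ M.le b x := by
  have h := add_mem (M.lt_le b x (autEval_sub_mem_lt g hm)) hm
  rwa [sub_add_cancel] at h

/-- A section of `𝒜ut^{<0}` as an isomorphism of filtered modules. -/
def autIso (g : M.autSheaf.obj (Opposite.op U)) : FilteredIso U M M where
  equiv := autEval g
  isMorphism := isMorphism_autEval g
  isMorphism_symm := isMorphism_autEval g⁻¹
  mem_le x c m := by
    refine ⟨fun h => ?_, autEval_mem_le g⟩
    have h1 := autEval_mem_le g⁻¹ h
    have h2 : autEval g⁻¹ x (autEval g x m) = m := LinearEquiv.symm_apply_apply (autEval g x) m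
    rwa [h2] at h1

theorem autSheaf_ext {g h : M.autSheaf.obj (Opposite.op U)}
    (H : ∀ (x : U) (m : M.stalk x), autEval g x m = autEval h x m) : g = h :=
  Subtype.ext (funext fun x => LinearEquiv.ext (H x))

theorem autEval_mul (g h : M.autSheaf.obj (Opposite.op U)) (x : U) (m : M.stalk x) :
    autEval (g * h) x m = autEval g x (autEval h x m) := rfl

theorem autEval_map {f : V ⟶ U} (g : M.autSheaf.obj (Opposite.op U)) (x : V) :
    autEval (M.autSheaf.map f.op g) x = autEval g ⟨x, f.le x.2⟩ := rfl

variable {C : Finset ℂ}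

/-- A filtered automorphism which is trivial on the graded pieces as a section of `𝒜ut^{<0}`. -/
def autMk (hM : M.IsBetti C) (e : FilteredIso U M M) (he : ∀ x, M.GrTrivial (e.equiv x)) :
    M.autSheaf.obj (Opposite.op U) :=
  (⟨e.equiv, endLTZero_of_grTrivial hM e he,
    endLTZero_of_grTrivial hM e.symm fun x => (he x).symm⟩ : M.autLTZero U)

theorem autEval_autMk (hM : M.IsBetti C) (e : FilteredIso U M M)
    (he : ∀ x, M.GrTrivial (e.equiv x)) (x : U) : autEval (autMk hM e he) x = e.equiv x := rfl

end FilteredModule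

namespace GradedPair

open FilteredModule

variable {C : Finset ℂ} {G : FilteredModule P} (p q : GradedPair C G)

/-- The automorphism `ξ η⁻¹ η' ξ⁻¹` of `𝒢` defined by two splittings `η`, `η'`. -/
def transition {T : Opens Circle} (η η' : FilteredIso T p.obj.tens p.obj) : FilteredIso T G G :=
  (((p.ξ.res le_top).symm.trans η').trans η.symm).trans (p.ξ.res le_top)

theorem grTrivial_transition {T : Opens Circle} {η η' : FilteredIso T p.obj.tens p.obj}
    (hη : IsSplitting η) (hη' : IsSplitting η') (x : T) :
    G.GrTrivial ((p.transition η η').equiv x) :=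
  (hη.grTrivial hη' x).conj (p.ξ.res le_top)

/-- The 1-cocycle `g` is given by `g_ij = ξ η_i⁻¹ η_j ξ⁻¹`. -/
def IsCocycleOf {ι : Type} {U : ι → Opens Circle} (η : ∀ i, FilteredIso (U i) p.obj.tens p.obj)
    (g : PresheafOfGroups.OneCocycle G.autSheaf U) : Prop :=
  ∀ (i j : ι) (T : Opens Circle) (a : T ⟶ U i) (b : T ⟶ U j) (x : T),
    autEval (g.ev i j a b) x =
      (((p.ξ.equiv ⟨x, trivial⟩).symm.trans ((η j).equiv ⟨x, b.le x.2⟩)).trans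
        ((η i).equiv ⟨x, a.le x.2⟩).symm).trans (p.ξ.equiv ⟨x, trivial⟩)

/-- The cocycle of a family of splittings. -/
def cocycle (hG : G.IsBetti C) {ι : Type} {U : ι → Opens Circle}
    (η : ∀ i, FilteredIso (U i) p.obj.tens p.obj) (hη : ∀ i, IsSplitting (η i)) :
    PresheafOfGroups.OneCocycle G.autSheaf U where
  ev i j T a b := autMk hG (p.transition ((η i).res a.le) ((η j).res b.le))
    (p.grTrivial_transition ((hη i).res a.le) ((hη j).res b.le))
  ev_precomp i j T T' φ a b := rfl
  ev_trans i j k T a b c := autSheaf_ext fun x m => by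
    rw [autEval_mul, autEval_autMk, autEval_autMk, autEval_autMk]
    simp [transition, FilteredIso.trans, FilteredIso.symm, FilteredIso.res]

theorem isCocycleOf_cocycle (hG : G.IsBetti C) {ι : Type} {U : ι → Opens Circle}
    (η : ∀ i, FilteredIso (U i) p.obj.tens p.obj) (hη : ∀ i, IsSplitting (η i)) :
    p.IsCocycleOf η (p.cocycle hG η hη) := fun _ _ _ _ _ _ => rfl

variable {p q} {ι ι' : Type} {U : ι → Opens Circle} {U' : ι' → Opens Circle}
  {hU : ∀ x, ∃ i, x ∈ U i} {hU' : ∀ x, ∃ i, x ∈ U' i}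
  {g : PresheafOfGroups.OneCocycle G.autSheaf U} {g' : PresheafOfGroups.OneCocycle G.autSheaf U'}

/-- The class of the cocycle does not depend on the cover and on the splittings. -/
theorem IsCocycleOf.class_eq (hG : G.IsBetti C) {η : ∀ i, FilteredIso (U i) p.obj.tens p.obj}
    {η' : ∀ i, FilteredIso (U' i) p.obj.tens p.obj} (hη : ∀ i, IsSplitting (η i))
    (hη' : ∀ i, IsSplitting (η' i)) (hg : p.IsCocycleOf η g) (hg' : p.IsCocycleOf η' g') :
    CechCocycle.class ⟨ι, U, hU, g⟩ = CechCocycle.class ⟨ι', U', hU', g'⟩ := by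
  -- On `U_i ∩ U'_j` the 0-cochain is `ξ η'_j⁻¹ η_i ξ⁻¹`; with this choice the cohomology relation
  -- telescopes.
  refine Quotient.sound ⟨ι × ι', fun k => U k.1 ⊓ U' k.2, Prod.fst, Prod.snd,
    fun k => inf_le_left, fun k => inf_le_right, fun x => ?_,
    fun k => autMk hG (p.transition ((η' k.2).res inf_le_right) ((η k.1).res inf_le_left))
      (p.grTrivial_transition ((hη' k.2).res inf_le_right) ((hη k.1).res inf_le_left)), ?_⟩
  · obtain ⟨i, hi⟩ := hU x
    obtain ⟨j, hj⟩ := hU' x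
    exact ⟨(i, j), hi, hj⟩
  · intro k l T a b
    refine autSheaf_ext fun x m => ?_
    rw [autEval_mul, autEval_mul, autEval_map, autEval_map, autEval_autMk, autEval_autMk]
    simp only [refineCocycle]
    rw [hg, hg']
    simp [transition, FilteredIso.trans, FilteredIso.symm, FilteredIso.res]

/-- Isomorphic pairs have the same cocycles. -/
theorem Isomorphic.exists_isCocycleOf (h : Isomorphic p q)
    {η : ∀ i, FilteredIso (U i) p.obj.tens p.obj} (hη : ∀ i, IsSplitting (η i))
    (hg : p.IsCocycleOf η g) :
    ∃ η' : ∀ i, FilteredIso (U i) q.obj.tens q.obj, (∀ i, IsSplitting (η' i)) ∧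
      q.IsCocycleOf η' g := by
  obtain ⟨f, hf⟩ := h
  -- The splittings of the second object are `f η_i ξ⁻¹ ξ'`. In the transition cocycle `f` and `ξ'`
  -- cancel, leaving `g`.
  refine ⟨fun i => ((q.ξ.trans p.ξ.symm).res le_top).trans ((η i).trans (f.res le_top)),
    fun i => isSplitting_of_sub_mem_lt fun x c m => ?_, fun i j T a b x => ?_⟩
  · have hm : (f.equiv ⟨x, trivial⟩).symm m ∈ p.obj.le c x := (f.symm.mem_le ⟨x, trivial⟩ c m).2 m.2
    have h1 := hf ⟨x, trivial⟩ c (p.obj.grMk c x ⟨_, hm⟩)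
    rw [FilteredIso.gr_grMk] at h1
    have h2 : (⟨f.equiv ⟨x, trivial⟩ ((f.equiv ⟨x, trivial⟩).symm m),
        (f.mem_le ⟨x, trivial⟩ c _).2 hm⟩ : q.obj.le c x) = m :=
      Subtype.ext (LinearEquiv.apply_symm_apply _ _)
    have h3 := f.mem_lt (x := ⟨x, trivial⟩) ((hη i).sub_mem_lt x c ⟨_, hm⟩)
    rw [map_sub, LinearEquiv.apply_symm_apply] at h3
    -- The compatibility of `f` with `ξ` and `ξ'` says that `ξ⁻¹ ξ'` takes `1 ⊗ [m]` to `1 ⊗ [f⁻¹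
    -- m]`, so the new map still induces the identity on the graded pieces.
    have h4 : (p.ξ.equiv ⟨x, trivial⟩).symm (q.ξ.equiv ⟨x, trivial⟩
        (q.obj.unitTensor c x (q.obj.grMk c x m))) =
        p.obj.unitTensor c x (p.obj.grMk c x ⟨_, hm⟩) := by
      rw [LinearEquiv.symm_apply_eq, ← h1, h2]
    show f.equiv ⟨x, trivial⟩ ((η i).equiv x ((p.ξ.equiv ⟨x, trivial⟩).symm
      (q.ξ.equiv ⟨x, trivial⟩ (q.obj.unitTensor c x (q.obj.grMk c x m))))) - m ∈ _
    rw [h4]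
    exact h3
  · rw [hg]
    refine LinearEquiv.ext fun m => ?_
    simp [FilteredIso.trans, FilteredIso.symm, FilteredIso.res]

end GradedPair

end

end BettiStokes

/-! ### Pairs with cohomologous cocycles are isomorphic -/

namespace BettiStokes

noncomputable section

variable {L : Type} [AddCommGroup L] [Module.Finite ℤ L] {P : PeriodMap L}

namespace FilteredModule

variable (M : FilteredModule P)

/-- The map `m ↦ 1 ⊗ m` from `gr_c ℒ` to `𝒜_μ ⊗ gr ℒ`. -/
def unitLinear (c : ℂ) (x : Circle) : M.gr c x →ₗ[ℂ] M.tens.stalk x where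
  toFun m := M.unitTensor c x m
  map_add' m n := by
    show M.tmul 1 _ = M.tmul 1 _ + M.tmul 1 _
    rw [map_add]
    exact M.tmul_add _ _ _
  map_smul' r m := by
    show M.tmul 1 _ = r • M.tmul 1 _
    rw [map_smul, tmul_smul]
    exact (M.smul_tmul_complex _ _ _).symm

end FilteredModule

namespace GradedPair

open FilteredModule

variable {C : Finset ℂ} {G : FilteredModule P} {p q : GradedPair C G}

/-- A filtered isomorphism whose graded pieces are those of `ξ'⁻¹ ξ` is an isomorphism of pairs. -/
theorem isomorphic_of_sub_mem_lt [Module.Free ℤ L]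
    (hC : ∀ c ∈ C, ∀ c' ∈ C, c ≠ c' → ∀ γ : L, c ≠ c' + P.μ γ) (f : FilteredIso ⊤ p.obj q.obj)
    (hf : ∀ (x : (⊤ : Opens Circle)) (c : ℂ) (m : p.obj.gr c x),
      (q.ξ.equiv x).symm (p.ξ.equiv x (p.obj.unitTensor c x m)) -
        q.obj.unitTensor c x (f.gr x c m) ∈ q.obj.tens.lt c x) : Isomorphic p q := by
  let θ : FilteredIso ⊤ p.obj.tens q.obj.tens := p.ξ.trans q.ξ.symm
  refine ⟨f, fun x c m => ?_⟩
  -- The map `m ↦ ξ'⁻¹ ξ (1 ⊗ m) - 1 ⊗ gr f(m)` takes values in lower degree over the whole circle.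
  -- Rigidity makes it zero, turning a congruence into the required equality.
  let D : ∀ y, p.obj.gr c y →ₗ[ℂ] q.obj.tens.stalk y := fun y =>
    ((θ.equiv ⟨y, trivial⟩).toLinearMap.restrictScalars ℂ).comp (p.obj.unitLinear c y) -
      (q.obj.unitLinear c y).comp (f.gr ⟨y, trivial⟩ c)
  have h0 : D x m = 0 := by
    refine FilteredModule.eq_zero_of_mem_lt (N := q.obj) (p.isBetti.isLocalSystem c) q.isBetti hC D
      ?_ (fun y m => hf ⟨y, trivial⟩ c m) x m
    intro s y hs
    have h1 : q.obj.tens.sheaf.IsSec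
        (fun y => θ.equiv ⟨y, trivial⟩ (p.obj.unitTensor c y (s y))) y :=
      θ.isMorphism ⟨y, trivial⟩ _ _ (p.obj.isSec_unit hs) (Eventually.of_forall fun y hy => rfl)
    have h2 : (q.obj.grSheaf c).IsSec (fun y => f.gr ⟨y, trivial⟩ c (s y)) y :=
      f.isSec_gr (x := ⟨y, trivial⟩) hs (Eventually.of_forall fun y hy => rfl)
    refine q.obj.tens.sheaf.isSec_congr (Eventually.of_forall fun y => ?_)
      (q.obj.tens.sheaf.isSec_add h1 (q.obj.tens.sheaf.isSec_neg (q.obj.isSec_unit h2)))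
    exact (sub_eq_add_neg _ _).symm
  have h1 : (q.ξ.equiv x).symm (p.ξ.equiv x (p.obj.unitTensor c x m)) =
      q.obj.unitTensor c x (f.gr x c m) := sub_eq_zero.1 h0
  rw [← h1, LinearEquiv.apply_symm_apply]

variable {ι ι' : Type} {U : ι → Opens Circle} {U' : ι' → Opens Circle}
  {hU : ∀ x, ∃ i, x ∈ U i} {hU' : ∀ x, ∃ i, x ∈ U' i}
  {g : PresheafOfGroups.OneCocycle G.autSheaf U} {g' : PresheafOfGroups.OneCocycle G.autSheaf U'}

/-- Cohomologous cocycles give an isomorphism, which locally is `η' ξ'⁻¹ e ξ η⁻¹` with `e` in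
`𝒜ut^{<0}`. -/
theorem exists_filteredIso_of_class_eq
    {η : ∀ i, FilteredIso (U i) p.obj.tens p.obj}
    {η' : ∀ i, FilteredIso (U' i) q.obj.tens q.obj} (hg : p.IsCocycleOf η g)
    (hg' : q.IsCocycleOf η' g')
    (h : CechCocycle.class ⟨ι, U, hU, g⟩ = CechCocycle.class ⟨ι', U', hU', g'⟩) :
    ∃ f : FilteredIso ⊤ p.obj q.obj, ∀ x : Circle, ∃ (i : ι) (j : ι') (hi : x ∈ U i) (hj : x ∈ U' j)
      (e : G.stalk x ≃ₗ[P.Amu x] G.stalk x), G.GrTrivial e ∧ ∀ m : p.obj.stalk x,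
        f.equiv ⟨x, trivial⟩ m = (η' j).equiv ⟨x, hj⟩ ((q.ξ.equiv ⟨x, trivial⟩).symm
          (e (p.ξ.equiv ⟨x, trivial⟩ (((η i).equiv ⟨x, hi⟩).symm m)))) := by
  obtain ⟨κ, W, a, b, ha, hb, hW, α, hα⟩ :
      CechCocycle.Cohomologous ⟨ι, U, hU, g⟩ ⟨ι', U', hU', g'⟩ := Quotient.exact h
  let F : ∀ k, FilteredIso (W k) p.obj q.obj := fun k =>
    (((((η (a k)).res (ha k)).symm.trans (p.ξ.res le_top)).trans (autIso (α k))).trans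
      (q.ξ.res le_top).symm).trans ((η' (b k)).res (hb k))
  have hF : ∀ k (x : Circle) (hk : x ∈ W k) (m : p.obj.stalk x), (F k).equiv ⟨x, hk⟩ m =
      (η' (b k)).equiv ⟨x, hb k hk⟩ ((q.ξ.equiv ⟨x, trivial⟩).symm (autEval (α k) ⟨x, hk⟩
        (p.ξ.equiv ⟨x, trivial⟩ (((η (a k)).equiv ⟨x, ha k hk⟩).symm m)))) := fun _ _ _ _ => rfl
  have hcompat : ∀ k l (x : Circle) (hk : x ∈ W k) (hl : x ∈ W l),
      (F k).equiv ⟨x, hk⟩ = (F l).equiv ⟨x, hl⟩ := by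
    intro k l x hk hl
    refine LinearEquiv.ext fun m => ?_
    -- The relation `α_k g_kl = g'_kl α_l`, with both cocycles written through splittings, is
    -- exactly agreement of the local isomorphisms on `W_k ∩ W_l`.
    have h1 := hα k l (T := W k ⊓ W l) (homOfLE inf_le_left) (homOfLE inf_le_right)
    have h2 : ∀ v : G.stalk x, autEval (α k) ⟨x, hk⟩ (autEval (g.ev (a k) (a l)
        (homOfLE (inf_le_left.trans (ha k))) (homOfLE (inf_le_right.trans (ha l))))
          (⟨x, hk, hl⟩ : (W k ⊓ W l : Opens Circle)) v) =
        autEval (g'.ev (b k) (b l)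
          (homOfLE (inf_le_left.trans (hb k))) (homOfLE (inf_le_right.trans (hb l))))
          (⟨x, hk, hl⟩ : (W k ⊓ W l : Opens Circle)) (autEval (α l) ⟨x, hl⟩ v) :=
      fun v => LinearEquiv.congr_fun (congrArg
        (fun s => autEval s (⟨x, hk, hl⟩ : (W k ⊓ W l : Opens Circle))) h1) v
    have h3 := h2 (p.ξ.equiv ⟨x, trivial⟩ (((η (a l)).equiv ⟨x, ha l hl⟩).symm m))
    rw [hg, hg'] at h3
    simp only [LinearEquiv.trans_apply, LinearEquiv.symm_apply_apply,
      LinearEquiv.apply_symm_apply] at h3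
    rw [hF, hF, h3, LinearEquiv.symm_apply_apply, LinearEquiv.apply_symm_apply]
  obtain ⟨f, hfF⟩ := FilteredIso.exists_glue hW F hcompat
  refine ⟨f, fun x => ?_⟩
  obtain ⟨k, hk⟩ := hW x
  refine ⟨a k, b k, ha k hk, hb k hk, autEval (α k) ⟨x, hk⟩,
    fun c m hm => autEval_sub_mem_lt (α k) (x := ⟨x, hk⟩) hm, fun m => ?_⟩
  rw [hfF k x hk]
  exact hF k x hk m

/-- Pairs with cohomologous cocycles are isomorphic. -/
theorem isomorphic_of_class_eq [Module.Free ℤ L]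
    (hC : ∀ c ∈ C, ∀ c' ∈ C, c ≠ c' → ∀ γ : L, c ≠ c' + P.μ γ)
    {η : ∀ i, FilteredIso (U i) p.obj.tens p.obj}
    {η' : ∀ i, FilteredIso (U' i) q.obj.tens q.obj} (hη : ∀ i, IsSplitting (η i))
    (hη' : ∀ i, IsSplitting (η' i)) (hg : p.IsCocycleOf η g) (hg' : q.IsCocycleOf η' g')
    (h : CechCocycle.class ⟨ι, U, hU, g⟩ = CechCocycle.class ⟨ι', U', hU', g'⟩) :
    Isomorphic p q := by
  obtain ⟨f, hf⟩ := exists_filteredIso_of_class_eq hg hg' h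
  refine isomorphic_of_sub_mem_lt hC f fun x c m => ?_
  obtain ⟨m, rfl⟩ := Submodule.Quotient.mk_surjective _ m
  obtain ⟨i, j, hi, hj, e, he, hfe⟩ := hf x
  set t : p.obj.tens.stalk x := ((η i).equiv ⟨x, hi⟩).symm m with ht
  have htle : t ∈ p.obj.tens.le c x := ((η i).symm.mem_le ⟨x, hi⟩ c m).2 m.2
  have h1 : t - p.obj.unitTensor c x (p.obj.grMk c x m) ∈ p.obj.tens.lt c x :=
    (hη i).symm_sub_mem_lt ⟨x, hi⟩ c m
  obtain ⟨s, hs⟩ : ∃ s : q.obj.tens.stalk x, s = (q.ξ.equiv x).symm (p.ξ.equiv x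
    (p.obj.unitTensor c x (p.obj.grMk c x m))) := ⟨_, rfl⟩
  have hsle : s ∈ q.obj.tens.le c x := by
    rw [hs]
    exact (q.ξ.symm.mem_le x c _).2 ((p.ξ.mem_le x c _).2
      (p.obj.unitTensor c x (p.obj.grMk c x m)).2)
  have h2 : (q.ξ.equiv x).symm (p.ξ.equiv x t) - s ∈ q.obj.tens.lt c x := by
    rw [hs]
    exact (p.ξ.trans q.ξ.symm).sub_mem_lt h1
  have h3 : (q.ξ.equiv x).symm (e (p.ξ.equiv x t)) -
      (q.ξ.equiv x).symm (p.ξ.equiv x t) ∈ q.obj.tens.lt c x :=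
    q.ξ.symm.sub_mem_lt (he c _ ((p.ξ.mem_le x c t).2 htle))
  have h4 := add_mem h3 h2
  rw [sub_add_sub_cancel] at h4
  have h5 := (η' j).sub_mem_lt (x := ⟨x, hj⟩) h4
  -- Here `m₁` represents the class that `ξ'⁻¹ ξ` assigns to `[m]`. Following `m` through `η⁻¹`,
  -- `ξ`, the graded-trivial `e`, `ξ'⁻¹` and `η'`, modulo lower degree, shows that `gr f` assigns
  -- the same class.
  obtain ⟨m₁, hm₁⟩ := (hη' j).exists_unitTensor (x := ⟨x, hj⟩) hsle
  have h6 := add_mem (add_mem h5 ((η' j).sub_mem_lt (x := ⟨x, hj⟩) hm₁))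
    ((hη' j).sub_mem_lt ⟨x, hj⟩ c m₁)
  rw [sub_add_sub_cancel, sub_add_sub_cancel] at h6
  have h7 : f.gr x c (p.obj.grMk c x m) = q.obj.grMk c x m₁ := by
    rw [FilteredIso.gr_grMk, grMk_eq]
    have h8 := hfe m
    rw [← ht] at h8
    show f.equiv x m - _ ∈ _
    rw [show f.equiv x m = _ from h8]
    exact h6
  have h9 : (q.ξ.equiv x).symm (p.ξ.equiv x (p.obj.unitTensor c x (p.obj.grMk c x m))) -
      q.obj.unitTensor c x (f.gr x c (p.obj.grMk c x m)) ∈ q.obj.tens.lt c x := by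
    rw [h7, ← hs]
    exact hm₁
  exact h9

end GradedPair

end

end BettiStokes

/-! ### Twisted forms with unchanged stalks -/

namespace BettiStokes

noncomputable section

variable {L : Type} [AddCommGroup L] [Module.Finite ℤ L] {P : PeriodMap L}

namespace FilteredModule

/-- Gluing data for a twisted form of `ℳ` with the same stalks and the same filtration. -/
structure TwistData (M : FilteredModule P) where
  A : Type
  W : A → Opens Circle
  cover : ∀ x, ∃ a, x ∈ W a
  τ : A → ∀ x, M.stalk x ≃ₗ[P.Amu x] M.stalk x
  isSec_τ : ∀ {a b : A} {x : Circle}, x ∈ W a → x ∈ W b → ∀ {s : ∀ y, M.stalk y},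
    M.sheaf.IsSec s x → M.sheaf.IsSec (fun y => τ a y ((τ b y).symm (s y))) x
  mem_le : ∀ {a : A} {x : Circle}, x ∈ W a → ∀ (c : ℂ) (m : M.stalk x),
    τ a x m ∈ M.le c x ↔ m ∈ M.le c x
  grTrivial : ∀ {a : A} {x : Circle}, x ∈ W a → M.GrTrivial (τ a x)

namespace TwistData

variable {M : FilteredModule P} (T : M.TwistData)

/-- Since `τ_b τ_a⁻¹` preserves sections on the overlap, the condition at one index whose open set
contains the point implies it at all such indices. The individual `τ_a` need not preserve sections.
-/
theorem isSec_of_mem {a b : T.A} {x : Circle} (ha : x ∈ T.W a) (hb : x ∈ T.W b)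
    {s : ∀ y, M.stalk y} (hs : M.sheaf.IsSec (fun y => T.τ a y (s y)) x) :
    M.sheaf.IsSec (fun y => T.τ b y (s y)) x := by
  have h := T.isSec_τ hb ha hs
  simpa only [LinearEquiv.symm_apply_apply] using h

/-- The sheaf whose sections are the families `s` such that the `τ_a s` are sections of `ℳ`. -/
def sheaf : StalkSheaf M.stalk where
  IsSec s x := ∀ a, x ∈ T.W a → M.sheaf.IsSec (fun y => T.τ a y (s y)) x
  isSec_congr := fun h hs a ha => M.sheaf.isSec_congr (by
    filter_upwards [h] with y hy
    rw [hy]) (hs a ha)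
  isSec_eventually := by
    intro s x hs
    obtain ⟨a, ha⟩ := T.cover x
    filter_upwards [(T.W a).isOpen.mem_nhds ha, M.sheaf.isSec_eventually (hs a ha)] with y h1 h2 b hb
    exact T.isSec_of_mem h1 hb h2
  exists_isSec := by
    intro x m
    obtain ⟨a, ha⟩ := T.cover x
    obtain ⟨s, hs, hsx⟩ := M.sheaf.exists_isSec x (T.τ a x m)
    refine ⟨fun y => (T.τ a y).symm (s y), fun b hb => T.isSec_τ hb ha hs, ?_⟩
    show (T.τ a x).symm (s x) = m
    rw [hsx, LinearEquiv.symm_apply_apply]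
  eventually_eq := by
    intro s t x hs ht h
    obtain ⟨a, ha⟩ := T.cover x
    filter_upwards [M.sheaf.eventually_eq (hs a ha) (ht a ha) (by rw [h])] with y hy
    exact (T.τ a y).injective hy
  isSec_add := fun hs ht a ha => M.sheaf.isSec_congr
    (Eventually.of_forall fun y => (map_add (T.τ a y) _ _).symm)
    (M.sheaf.isSec_add (hs a ha) (ht a ha))
  isSec_neg := fun hs a ha => M.sheaf.isSec_congr
    (Eventually.of_forall fun y => (map_neg (T.τ a y) _).symm) (M.sheaf.isSec_neg (hs a ha))

/-- The twisted form of `ℳ`. -/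
def twist : FilteredModule P where
  toModule :=
    { stalk := M.stalk
      sheaf := T.sheaf
      isSec_smul := fun ha hs b hb => M.sheaf.isSec_congr
        (Eventually.of_forall fun y => (map_smul (T.τ b y) _ _).symm)
        (M.toModule.isSec_smul ha (hs b hb)) }
  le := M.le
  le_eventually := by
    intro c s x hs h
    obtain ⟨a, ha⟩ := T.cover x
    filter_upwards [(T.W a).isOpen.mem_nhds ha,
      M.le_eventually (hs a ha) ((T.mem_le ha c _).2 h)] with y h1 h2
    exact (T.mem_le h1 c _).1 h2
  smul_mem := M.smul_mem
  mono := M.mono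
  shift := M.shift

/-- Over `W_a` the twisted form is isomorphic to `ℳ`. -/
def localIso (a : T.A) : FilteredIso (T.W a) T.twist M where
  equiv x := T.τ a x
  isMorphism x s t hs h := M.sheaf.isSec_congr (by
    filter_upwards [h, (T.W a).isOpen.mem_nhds x.2] with y h1 h2 using (h1 h2).symm) (hs a x.2)
  isMorphism_symm x s t hs h := by
    refine T.sheaf.isSec_congr (s := fun y => (T.τ a y).symm (s y)) ?_ fun b hb => T.isSec_τ hb x.2 hs
    filter_upwards [h, (T.W a).isOpen.mem_nhds x.2] with y h1 h2 using (h1 h2).symm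
  mem_le x c m := T.mem_le x.2 c m

/-- As `τ_a` is trivial on the graded pieces, `m` and `τ_a m` have the same class in `gr_c`, so the
twist is invisible to the graded sheaf. -/
theorem grSheaf_isSec_iff {c : ℂ} {s : ∀ y, M.gr c y} {x : Circle} :
    (T.twist.grSheaf c).IsSec s x ↔ (M.grSheaf c).IsSec s x := by
  obtain ⟨a, ha⟩ := T.cover x
  constructor
  · rintro ⟨m, hm, hs⟩
    refine ⟨fun y => T.τ a y (m y), hm a ha, ?_⟩
    filter_upwards [hs, (T.W a).isOpen.mem_nhds ha] with y ⟨h1, h2⟩ hy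
    refine ⟨(T.mem_le hy c _).2 h1, h2.trans ?_⟩
    refine M.grMk_eq.2 ?_
    rw [← neg_sub]
    exact neg_mem (T.grTrivial hy c _ h1)
  · rintro ⟨m, hm, hs⟩
    refine ⟨fun y => (T.τ a y).symm (m y), fun b hb => T.isSec_τ hb ha hm, ?_⟩
    filter_upwards [hs, (T.W a).isOpen.mem_nhds ha] with y ⟨h1, h2⟩ hy
    have h3 : (T.τ a y).symm (m y) ∈ M.le c y := by
      rw [← T.mem_le hy, LinearEquiv.apply_symm_apply]
      exact h1
    refine ⟨h3, h2.trans ?_⟩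
    refine M.grMk_eq.2 ?_
    have h4 := T.grTrivial hy c _ h3
    rwa [LinearEquiv.apply_symm_apply] at h4

theorem GrSheaf_isSec_iff {s : ∀ y, M.Gr y} {x : Circle} :
    T.twist.GrSheaf.IsSec s x ↔ M.GrSheaf.IsSec s x := by
  have h : {t : ∀ y, M.Gr y | ∃ (c : ℂ) (s : ∀ y, M.gr c y), (T.twist.grSheaf c).IsSec s x ∧
      t = fun y => M.grIncl c y (s y)} = {t | ∃ (c : ℂ) (s : ∀ y, M.gr c y),
        (M.grSheaf c).IsSec s x ∧ t = fun y => M.grIncl c y (s y)} := by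
    ext t
    exact exists_congr fun c => exists_congr fun s => and_congr_left fun _ => T.grSheaf_isSec_iff
  have h' : T.twist.GrSheaf.IsSec s x ↔ ∃ t ∈ AddSubgroup.closure
      {t : ∀ y, M.Gr y | ∃ (c : ℂ) (s : ∀ y, M.gr c y), (T.twist.grSheaf c).IsSec s x ∧
        t = fun y => M.grIncl c y (s y)}, ∀ᶠ y in 𝓝 x, s y = t y := Iff.rfl
  rw [h', h]
  rfl

theorem tens_isSec_iff {s : ∀ y, M.tensStalk y} {x : Circle} :
    T.twist.tensSheaf.IsSec s x ↔ M.tensSheaf.IsSec s x := by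
  have h : {t : ∀ y, M.tensStalk y | ∃ (a : ∀ y, P.Amu y) (m : ∀ y, M.Gr y),
      P.AmuSheaf.IsSec a x ∧ T.twist.GrSheaf.IsSec m x ∧ t = fun y => a y ⊗ₜ m y} =
      {t | ∃ (a : ∀ y, P.Amu y) (m : ∀ y, M.Gr y),
        P.AmuSheaf.IsSec a x ∧ M.GrSheaf.IsSec m x ∧ t = fun y => a y ⊗ₜ m y} := by
    ext t
    exact exists_congr fun a => exists_congr fun m => and_congr_right fun _ =>
      and_congr_left fun _ => T.GrSheaf_isSec_iff
  have h' : T.twist.tensSheaf.IsSec s x ↔ ∃ t ∈ AddSubgroup.closure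
      {t : ∀ y, M.tensStalk y | ∃ (a : ∀ y, P.Amu y) (m : ∀ y, M.Gr y),
        P.AmuSheaf.IsSec a x ∧ T.twist.GrSheaf.IsSec m x ∧ t = fun y => a y ⊗ₜ m y},
      ∀ᶠ y in 𝓝 x, s y = t y := Iff.rfl
  rw [h', h]
  rfl

/-- Twisting does not change the stalks of the associated graded module. -/
def tensEquiv (x : Circle) : T.twist.tens.stalk x ≃ₗ[P.Amu x] M.tens.stalk x :=
  LinearEquiv.refl (P.Amu x) (M.tens.stalk x)

theorem tmul_eq {x : Circle} (a : P.Amu x) (m : M.Gr x) : T.twist.tmul a m = M.tmul a m := rfl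

theorem tensEquiv_apply {x : Circle} (t : M.tensStalk x) : T.tensEquiv x t = t := rfl

theorem grIncl_eq (c : ℂ) (x : Circle) (m : M.gr c x) :
    T.twist.grIncl c x m = M.grIncl c x m := rfl

theorem tensEquiv_tmul {x : Circle} (a : P.Amu x) (c : ℂ) (m : M.gr c x) :
    T.tensEquiv x (T.twist.tmul a (T.twist.grIncl c x m)) = M.tmul a (M.grIncl c x m) :=
  (T.tensEquiv_apply _).trans ((T.tmul_eq a _).trans (congrArg (M.tmul a) (T.grIncl_eq c x m)))

theorem tensEquiv_mem {x : Circle} {c : ℂ} {t : T.twist.tensModule.stalk x}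
    (ht : t ∈ T.twist.tensLE c x) : T.tensEquiv x t ∈ M.tensLE c x := by
  unfold tensLE at ht
  induction ht using Submodule.span_induction with
  | zero => exact (map_zero (T.tensEquiv x)).symm ▸ zero_mem _
  | add p q _ _ hp hq => exact (map_add (T.tensEquiv x) p q).symm ▸ add_mem hp hq
  | smul r p _ hp =>
    have h : T.tensEquiv x (r • p) = algebraMap ℂ (P.Amu x) r • T.tensEquiv x p :=
      map_smul (T.tensEquiv x) (algebraMap ℂ (P.Amu x) r) p
    rw [h]
    exact (M.tensLE c x).smul_mem r hp
  | mem t ht =>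
    obtain ⟨c', c'', a, m, h1, h2, rfl⟩ := ht
    exact Submodule.subset_span ⟨c', c'', a, m, h1, h2, T.tensEquiv_tmul a c'' m⟩

theorem tensEquiv_symm_mem {x : Circle} {c : ℂ} {t : M.tensModule.stalk x}
    (ht : t ∈ M.tensLE c x) : (T.tensEquiv x).symm t ∈ T.twist.tensLE c x := by
  unfold tensLE at ht
  induction ht using Submodule.span_induction with
  | zero => exact (map_zero (T.tensEquiv x).symm).symm ▸ zero_mem _
  | add p q _ _ hp hq => exact (map_add (T.tensEquiv x).symm p q).symm ▸ add_mem hp hq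
  | smul r p _ hp =>
    have h : (T.tensEquiv x).symm (r • p) =
        algebraMap ℂ (P.Amu x) r • (T.tensEquiv x).symm p :=
      map_smul (T.tensEquiv x).symm (algebraMap ℂ (P.Amu x) r) p
    rw [h]
    exact (T.twist.tensLE c x).smul_mem r hp
  | mem t ht =>
    obtain ⟨c', c'', a, m, h1, h2, rfl⟩ := ht
    refine Submodule.subset_span ⟨c', c'', a, m, h1, h2, ?_⟩
    rw [← T.tensEquiv_tmul a c'' m]
    exact LinearEquiv.symm_apply_apply _ _

/-- Twisting does not change the associated graded module. -/
def tensIso : FilteredIso ⊤ T.twist.tens M.tens where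
  equiv x := T.tensEquiv x
  isMorphism x s t hs h := by
    have h1 : M.tensModule.sheaf.IsSec (fun y => T.tensEquiv y (s y)) x := T.tens_isSec_iff.1 hs
    refine M.tens.sheaf.isSec_congr ?_ h1
    filter_upwards [h] with y hy using (hy trivial).symm
  isMorphism_symm x s t hs h := by
    have h1 : T.twist.tensModule.sheaf.IsSec (fun y => (T.tensEquiv y).symm (s y)) x :=
      T.tens_isSec_iff.2 hs
    refine T.twist.tens.sheaf.isSec_congr ?_ h1
    filter_upwards [h] with y hy using (hy trivial).symm
  mem_le x c m := by
    refine ⟨fun h => ?_, fun h => T.tensEquiv_mem h⟩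
    have h1 := T.tensEquiv_symm_mem h
    have h2 : (T.tensEquiv x).symm (T.tensEquiv x m) = m := LinearEquiv.symm_apply_apply _ _
    rwa [h2] at h1

/-- A splitting of `ℳ` over `W_a` defines one of the twisted form. -/
def splitting {a : T.A} (σ : FilteredIso (T.W a) M.tens M) : FilteredIso (T.W a) T.twist.tens T.twist :=
  ((T.tensIso.res le_top).trans σ).trans (T.localIso a).symm

/-- The new splitting is `τ_a⁻¹ σ_a`, and on the graded pieces both `τ_a` and `σ_a` induce the
identity. -/
theorem isSplitting {a : T.A} {σ : FilteredIso (T.W a) M.tens M} (hσ : IsSplitting σ) :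
    IsSplitting (T.splitting σ) := by
  refine isSplitting_of_sub_mem_lt fun x c => ?_
  have key : ∀ m : M.le c x, (T.τ a x).symm (σ.equiv x (T.tensEquiv x
      (T.twist.unitTensor c x (M.grMk c x m)))) - (m : M.stalk x) ∈ M.lt c x := by
    intro m
    have h1 : σ.equiv x (M.unitTensor c x (M.grMk c x m)) - m ∈ M.lt c x := hσ.sub_mem_lt x c m
    have hm : (T.τ a x).symm (m : M.stalk x) ∈ M.le c x := by
      rw [← T.mem_le x.2, LinearEquiv.apply_symm_apply]
      exact m.2
    have h2 := T.grTrivial x.2 c _ hm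
    rw [LinearEquiv.apply_symm_apply] at h2
    have h3 : (T.τ a x).symm (σ.equiv x (M.unitTensor c x (M.grMk c x m))) -
        (T.τ a x).symm (m : M.stalk x) ∈ M.lt c x := (T.localIso a).symm.sub_mem_lt h1
    have h4 := sub_mem h3 h2
    rw [sub_sub_sub_cancel_right] at h4
    have h5 : T.tensEquiv x (T.twist.unitTensor c x (M.grMk c x m)) =
        M.unitTensor c x (M.grMk c x m) := T.tensEquiv_tmul 1 c _
    rw [h5]
    exact h4
  exact fun m => key m

theorem isBetti {C : Finset ℂ} (hM : M.IsBetti C)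
    (hσ : ∀ a, ∃ σ : FilteredIso (T.W a) M.tens M, IsSplitting σ) : T.twist.IsBetti C where
  isLocalSystem c x := by
    obtain ⟨n, φ, hφ⟩ := hM.isLocalSystem c x
    refine ⟨n, φ, ?_⟩
    filter_upwards [hφ] with y hy
    exact ⟨hy.1, fun v => T.grSheaf_isSec_iff.2 (hy.2 v)⟩
  exponents := hM.exponents
  splitting x := by
    obtain ⟨a, ha⟩ := T.cover x
    obtain ⟨σ, h⟩ := hσ a
    exact ⟨T.W a, ha, T.splitting σ, T.isSplitting h⟩

end TwistData

theorem GrTrivial.trans {M : FilteredModule P} {x : Circle} {e e' : M.stalk x ≃ₗ[P.Amu x] M.stalk x}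
    (he : M.GrTrivial e) (he' : M.GrTrivial e') : M.GrTrivial (e.trans e') := by
  intro c m hm
  have h1 := he c m hm
  have h2 : e m ∈ M.le c x := by
    have := add_mem (M.lt_le c x h1) hm
    rwa [sub_add_cancel] at this
  have h3 := add_mem (he' c _ h2) h1
  rwa [sub_add_sub_cancel] at h3

end FilteredModule

end

end BettiStokes

/-! ### Realising a cocycle by twisting `𝒢` -/

namespace BettiStokes

noncomputable section

variable {L : Type} [AddCommGroup L] [Module.Finite ℤ L] {P : PeriodMap L}

namespace FilteredModule

variable {G : FilteredModule P} {ι : Type} {W : ι → Opens Circle}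

/-- The value at a point of `W_a ∩ W_b` of a 1-cocycle. -/
def cocycleAt (g : PresheafOfGroups.OneCocycle G.autSheaf W) (a b : ι) {x : Circle}
    (ha : x ∈ W a) (hb : x ∈ W b) : G.stalk x ≃ₗ[P.Amu x] G.stalk x :=
  autEval (g.ev a b (homOfLE inf_le_left : W a ⊓ W b ⟶ W a) (homOfLE inf_le_right)) ⟨x, ha, hb⟩

/-- Compatibility with restriction shows that the value at a point depends only on the two indices,
so computations can be made pointwise on the largest overlap. -/
theorem autEval_ev (g : PresheafOfGroups.OneCocycle G.autSheaf W) {a b : ι} {T : Opens Circle}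
    (p : T ⟶ W a) (q : T ⟶ W b) (x : T) :
    autEval (g.ev a b p q) x = cocycleAt g a b (p.le x.2) (q.le x.2) := by
  have h := g.ev_precomp a b (homOfLE (le_inf p.le q.le) : T ⟶ W a ⊓ W b)
    (homOfLE inf_le_left) (homOfLE inf_le_right)
  have h' : g.ev a b p q = G.autSheaf.map (homOfLE (le_inf p.le q.le) : T ⟶ W a ⊓ W b).op
      (g.ev a b (homOfLE inf_le_left) (homOfLE inf_le_right)) := h.symm
  rw [h', autEval_map]
  rfl

theorem cocycleAt_trans (g : PresheafOfGroups.OneCocycle G.autSheaf W) {a b c : ι} {x : Circle}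
    (ha : x ∈ W a) (hb : x ∈ W b) (hc : x ∈ W c) (m : G.stalk x) :
    cocycleAt g a b ha hb (cocycleAt g b c hb hc m) = cocycleAt g a c ha hc m := by
  have hle : W a ⊓ W b ⊓ W c ≤ W c := inf_le_right
  have h := g.ev_trans a b c
    (homOfLE (inf_le_left.trans inf_le_left) : W a ⊓ W b ⊓ W c ⟶ W a)
    (homOfLE (inf_le_left.trans inf_le_right)) (homOfLE hle)
  have h1 := congrArg (fun f => autEval f (⟨x, ⟨ha, hb⟩, hc⟩ : (W a ⊓ W b ⊓ W c : Opens Circle)) m) h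
  simp only [← autEval_ev g (homOfLE (inf_le_left.trans inf_le_left) : W a ⊓ W b ⊓ W c ⟶ W a)
    (homOfLE hle) ⟨x, ⟨ha, hb⟩, hc⟩]
  rw [← h1, autEval_mul, autEval_ev, autEval_ev]

theorem cocycleAt_symm (g : PresheafOfGroups.OneCocycle G.autSheaf W) {a b c : ι} {x : Circle}
    (ha : x ∈ W a) (hb : x ∈ W b) (hc : x ∈ W c) (m : G.stalk x) :
    cocycleAt g a c ha hc ((cocycleAt g b c hb hc).symm m) = cocycleAt g a b ha hb m := by
  rw [← cocycleAt_trans g ha hb hc, LinearEquiv.apply_symm_apply]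

variable (g : PresheafOfGroups.OneCocycle G.autSheaf W) (ψ : FilteredIso ⊤ G G.tens)
  (σ : ∀ a, FilteredIso (W a) G.tens G) {i : Circle → ι} (hi : ∀ x, x ∈ W (i x))

open Classical in
/-- The automorphisms of the stalks whose differences `τ_a τ_b⁻¹` are conjugate to the cocycle
`g_ab` by the automorphisms `σ_a ψ`. -/
def twistAut (a : ι) (x : Circle) : G.stalk x ≃ₗ[P.Amu x] G.stalk x :=
  -- The index `i x` is an arbitrary choice at each point, with no continuity in `x`; it cancels in
  -- `τ_a τ_b⁻¹`. The identity outside `W a` is a default that plays no role.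
  if h : x ∈ W a then
    ((((ψ.res le_top).trans (σ (i x))).equiv ⟨x, hi x⟩).symm.trans
      (cocycleAt g a (i x) h (hi x))).trans (((ψ.res le_top).trans (σ a)).equiv ⟨x, h⟩)
  else LinearEquiv.refl _ _

theorem twistAut_of_mem {a : ι} {x : Circle} (h : x ∈ W a) : twistAut g ψ σ hi a x =
    ((((ψ.res le_top).trans (σ (i x))).equiv ⟨x, hi x⟩).symm.trans
      (cocycleAt g a (i x) h (hi x))).trans (((ψ.res le_top).trans (σ a)).equiv ⟨x, h⟩) :=
  dif_pos h

theorem twistAut_symm {a b : ι} {x : Circle} (ha : x ∈ W a) (hb : x ∈ W b) (m : G.stalk x) :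
    twistAut g ψ σ hi a x ((twistAut g ψ σ hi b x).symm m) =
      ((ψ.res le_top).trans (σ a)).equiv ⟨x, ha⟩ (cocycleAt g a b ha hb
        ((((ψ.res le_top).trans (σ b)).equiv ⟨x, hb⟩).symm m)) := by
  rw [twistAut_of_mem g ψ σ hi ha, twistAut_of_mem g ψ σ hi hb]
  simp only [LinearEquiv.trans_apply, LinearEquiv.symm_trans_apply, LinearEquiv.symm_symm,
    LinearEquiv.symm_apply_apply]
  rw [cocycleAt_symm]

/-- The gluing data defined by a cocycle. -/
def twistData (hσ : ∀ a, IsSplitting (σ a)) : G.TwistData where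
  A := ι
  W := W
  cover x := ⟨i x, hi x⟩
  τ := twistAut g ψ σ hi
  isSec_τ := by
    intro a b x ha hb s hs
    -- `F` is the filtered isomorphism `(σ_a ψ) g_ab (σ_b ψ)⁻¹`, whose stalks are `τ_a τ_b⁻¹`; the
    -- required continuity is that of `F`.
    let F : FilteredIso (W a ⊓ W b) G G :=
      ((((ψ.res le_top).trans (σ b)).symm.res inf_le_right).trans
        (autIso (g.ev a b (homOfLE inf_le_left) (homOfLE inf_le_right)))).trans
        (((ψ.res le_top).trans (σ a)).res inf_le_left)
    refine F.isMorphism ⟨x, ha, hb⟩ s _ hs (Eventually.of_forall fun y hy => ?_)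
    exact twistAut_symm g ψ σ hi hy.1 hy.2 (s y)
  mem_le := by
    intro a x h c m
    rw [twistAut_of_mem g ψ σ hi h]
    refine (FilteredIso.mem_le ((ψ.res le_top).trans (σ a)) ⟨x, h⟩ c _).trans ?_
    refine Iff.trans (FilteredIso.mem_le (autIso (g.ev a (i x) (homOfLE inf_le_left)
      (homOfLE inf_le_right))) ⟨x, h, hi x⟩ c _) ?_
    exact FilteredIso.mem_le ((ψ.res le_top).trans (σ (i x))).symm ⟨x, hi x⟩ c m
  grTrivial := by
    intro a x h
    rw [twistAut_of_mem g ψ σ hi h]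
    have hx : x ∈ W a ⊓ W (i x) := ⟨h, hi x⟩
    -- `τ_a` is the conjugate of the cocycle value by `σ_{i(x)} ψ`, followed by `σ_a σ_{i(x)}⁻¹`.
    -- The first is trivial on the graded pieces by conjugation, the second because it compares two
    -- splittings.
    have h1 := (GrTrivial.conj (x := ⟨x, hx⟩) (fun c m hm => autEval_sub_mem_lt
      (g.ev a (i x) (homOfLE inf_le_left) (homOfLE inf_le_right)) hm)
      (((ψ.res le_top).trans (σ (i x))).res inf_le_right))
    have h2 := (((hσ (i x)).res inf_le_right).grTrivial
      ((hσ a).res (inf_le_left : W a ⊓ W (i x) ≤ W a)) ⟨x, hx⟩).conj ((σ (i x)).res inf_le_right)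
    have h3 := h1.trans h2
    intro c m hm
    have h4 := h3 c m hm
    convert h4 using 2
    simp [FilteredIso.trans, FilteredIso.res, cocycleAt]

end FilteredModule

namespace GradedPair

open FilteredModule

variable {C : Finset ℂ} {G : FilteredModule P} {ι : Type} {W : ι → Opens Circle}

/-- Every cocycle on a cover on which `𝒢` splits comes from a pair. -/
theorem exists_isCocycleOf (hG : G.IsBetti C) (ψ : FilteredIso ⊤ G G.tens)
    (hW : ∀ x, ∃ a, x ∈ W a) (σ : ∀ a, FilteredIso (W a) G.tens G) (hσ : ∀ a, IsSplitting (σ a))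
    (g : PresheafOfGroups.OneCocycle G.autSheaf W) :
    ∃ (p : GradedPair C G) (η : ∀ a, FilteredIso (W a) p.obj.tens p.obj),
      (∀ a, IsSplitting (η a)) ∧ p.IsCocycleOf η g := by
  choose i hi using hW
  let T := twistData g ψ σ hi hσ
  refine ⟨⟨T.twist, T.isBetti hG fun a => ⟨σ a, hσ a⟩, T.tensIso.trans ψ.symm⟩,
    fun a => T.splitting (a := a) (σ a), fun a => T.isSplitting (hσ a), fun a b V p q x => ?_⟩
  rw [autEval_ev]
  refine LinearEquiv.ext fun m => ?_
  have h := twistAut_symm g ψ σ hi (p.le x.2) (q.le x.2) ((σ b).equiv ⟨x, q.le x.2⟩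
    (ψ.equiv ⟨x, trivial⟩ m))
  have h1 : (((ψ.res le_top).trans (σ b)).equiv ⟨x, q.le x.2⟩).symm ((σ b).equiv ⟨x, q.le x.2⟩
    (ψ.equiv ⟨x, trivial⟩ m)) = m := LinearEquiv.symm_apply_apply
      (((ψ.res le_top).trans (σ b)).equiv ⟨x, q.le x.2⟩) m
  rw [h1] at h
  have h2 : ∀ m, (ψ.equiv ⟨x, trivial⟩).symm (((σ a).equiv ⟨x, p.le x.2⟩).symm
      (((ψ.res le_top).trans (σ a)).equiv ⟨x, p.le x.2⟩ m)) = m := fun m =>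
    LinearEquiv.symm_apply_apply (((ψ.res le_top).trans (σ a)).equiv ⟨x, p.le x.2⟩) m
  -- With `ξ = ψ⁻¹` and `η_a = τ_a⁻¹ σ_a`, up to the identification of graded modules, `ξ η_a⁻¹ η_b
  -- ξ⁻¹` is `(σ_a ψ)⁻¹ τ_a τ_b⁻¹ (σ_b ψ)`, which is the given cocycle.
  rw [← h2 (cocycleAt g a b _ _ m), ← h]
  rfl

/-! ### The class of a pair and the bijection -/

theorem exists_splittings (p : GradedPair C G) : ∃ (U : Circle → Opens Circle)
    (η : ∀ x, FilteredIso (U x) p.obj.tens p.obj), (∀ x, ∃ y, x ∈ U y) ∧ ∀ x, IsSplitting (η x) := by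
  choose U hU η hη using p.isBetti.splitting
  exact ⟨U, η, fun x => ⟨x, hU x⟩, hη⟩

/-- The cohomology class `c` is the class of the cocycle of a family of splittings. -/
def HasClass (p : GradedPair C G) (c : CechH1 G.autSheaf) : Prop :=
  ∃ (ι : Type) (U : ι → Opens Circle) (hU : ∀ x, ∃ i, x ∈ U i)
    (η : ∀ i, FilteredIso (U i) p.obj.tens p.obj) (g : PresheafOfGroups.OneCocycle G.autSheaf U),
    (∀ i, IsSplitting (η i)) ∧ p.IsCocycleOf η g ∧ c = CechCocycle.class ⟨ι, U, hU, g⟩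

theorem exists_hasClass (hG : G.IsBetti C) (p : GradedPair C G) : ∃ c, p.HasClass c := by
  obtain ⟨U, η, hU, hη⟩ := p.exists_splittings
  exact ⟨_, _, U, hU, η, p.cocycle hG η hη, hη, p.isCocycleOf_cocycle hG η hη, rfl⟩

theorem HasClass.unique (hG : G.IsBetti C) {p : GradedPair C G} {c d : CechH1 G.autSheaf}
    (hc : p.HasClass c) (hd : p.HasClass d) : c = d := by
  obtain ⟨ι, U, hU, η, g, hη, hg, rfl⟩ := hc
  obtain ⟨ι', U', hU', η', g', hη', hg', rfl⟩ := hd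
  exact IsCocycleOf.class_eq hG hη hη' hg hg'

theorem HasClass.of_isomorphic {p q : GradedPair C G} (h : Isomorphic p q)
    {c : CechH1 G.autSheaf} (hc : p.HasClass c) : q.HasClass c := by
  obtain ⟨ι, U, hU, η, g, hη, hg, rfl⟩ := hc
  obtain ⟨η', hη', hg'⟩ := h.exists_isCocycleOf hη hg
  exact ⟨ι, U, hU, η', g, hη', hg', rfl⟩

/-- The cover of a given cocycle is refined by opens on which `𝒢` splits, indexed by the points of
the circle. The refined cocycle is realised by a twist and represents the same class. -/
theorem exists_hasClass_eq (hG : G.IsBetti C) (hgr : G.IsGraded) (c : CechH1 G.autSheaf) :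
    ∃ p : GradedPair C G, p.HasClass c := by
  obtain ⟨⟨ι, U, hU, g⟩, rfl⟩ := Quotient.exists_rep c
  obtain ⟨ψ⟩ := hgr
  choose i hi using id hU
  choose V hV σ hσ using hG.splitting
  let W : Circle → Opens Circle := fun x => U (i x) ⊓ V x
  have hW : ∀ x, ∃ a, x ∈ W a := fun x => ⟨x, hi x, hV x⟩
  obtain ⟨p, η, hη, hg⟩ := exists_isCocycleOf hG ψ hW
    (fun x => (σ x).res inf_le_right) (fun x => (hσ x).res inf_le_right)
    (refineCocycle g i fun x => inf_le_left)
  -- The refined cocycle and the original one coincide on the refinement, so the trivial cochain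
  -- relates them.
  refine ⟨p, Circle, W, hW, η, _, hη, hg, Quotient.sound ⟨Circle, W, i, id, fun x => inf_le_left,
    fun x => le_rfl, hW, 1, fun a b T p q => ?_⟩⟩
  simp [refineCocycle]

end GradedPair

end

end BettiStokes


theorem theorem4p4 {L : Type} [AddCommGroup L] [Module.Free ℤ L] [Module.Finite ℤ L]
    (P : BettiStokes.PeriodMap L) (C : Finset ℂ)
    (hC : ∀ c ∈ C, ∀ c' ∈ C, c ≠ c' → ∀ γ : L, c ≠ c' + P.μ γ)
    (G : BettiStokes.FilteredModule P) (hG : G.IsBetti C) (hgr : G.IsGraded) :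
    ∃! Φ : BettiStokes.GradedPairClass C G ≃ BettiStokes.CechH1 G.autSheaf,
      ∀ (p : BettiStokes.GradedPair C G) (ι : Type) (U : ι → TopologicalSpace.Opens Circle) (hU : ∀ x, ∃ i, x ∈ U i)
        (η : ∀ i, BettiStokes.FilteredIso (U i) p.obj.tens p.obj), (∀ i, BettiStokes.FilteredModule.IsSplitting (η i)) →
        ∃ g : CategoryTheory.PresheafOfGroups.OneCocycle G.autSheaf U,
          (∀ (i j : ι) (T : TopologicalSpace.Opens Circle) (a : T ⟶ U i) (b : T ⟶ U j) (x : T),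
            BettiStokes.FilteredModule.autEval (g.ev i j a b) x =
              (((p.ξ.equiv ⟨x, trivial⟩).symm.trans ((η j).equiv ⟨x, b.le x.2⟩)).trans
                ((η i).equiv ⟨x, a.le x.2⟩).symm).trans (p.ξ.equiv ⟨x, trivial⟩)) ∧
          Φ (Quotient.mk _ p) = BettiStokes.CechCocycle.class ⟨ι, U, hU, g⟩ := by
  choose cl hcl using BettiStokes.GradedPair.exists_hasClass (C := C) hG
  let φ : BettiStokes.GradedPairClass C G → BettiStokes.CechH1 G.autSheaf :=
    Quotient.lift cl fun p q h => (BettiStokes.GradedPair.HasClass.of_isomorphic h (hcl p)).unique hG (hcl q)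
  have hφ : Function.Bijective φ := by
    constructor
    · intro p q h
      induction p using Quotient.ind with | _ p
      induction q using Quotient.ind with | _ q
      have h' : cl p = cl q := h
      obtain ⟨ι, U, hU, η, g, hη, hg, h1⟩ := hcl p
      obtain ⟨ι', U', hU', η', g', hη', hg', h2⟩ := hcl q
      rw [h1, h2] at h'
      exact Quotient.sound (BettiStokes.GradedPair.isomorphic_of_class_eq hC hη hη' hg hg' h')
    · intro c
      obtain ⟨p, hp⟩ := BettiStokes.GradedPair.exists_hasClass_eq hG hgr c
      exact ⟨Quotient.mk _ p, (hcl p).unique hG hp⟩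
  -- Uniqueness of the bijection: every pair has a cover with splittings, so the stated property
  -- forces the value on its class.
  refine ⟨Equiv.ofBijective φ hφ, fun p ι U hU η hη => ?_, fun Φ hΦ => Equiv.ext fun c => ?_⟩
  · refine ⟨p.cocycle hG η hη, p.isCocycleOf_cocycle hG η hη, ?_⟩
    exact (hcl p).unique hG ⟨ι, U, hU, η, _, hη, p.isCocycleOf_cocycle hG η hη, rfl⟩
  · induction c using Quotient.ind with | _ p
    obtain ⟨U, η, hU, hη⟩ := p.exists_splittings
    obtain ⟨g, hg, h⟩ := hΦ p Circle U hU η hη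
    exact h.trans (BettiStokes.GradedPair.HasClass.unique hG ⟨Circle, U, hU, η, g, hη, hg, rfl⟩ (hcl p))
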